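/- **Conventions.** A *$C^*$-tensor category* is a $\mathbb C$-linear monoidal category $\mathcal C$ with bilinear tensor product $\boxtimes$ and an antilinear involution $*:\mathrm{Hom}(W_i,W_j)\to\mathrm{Hom}(W_j,W_i)$ that reverses composition, such that the morphism spaces are Banach spaces for submultiplicative norms with $\|F^*F\|=\|F\|^2$ and every $F^*F$ is positive in the corresponding endomorphism algebra; $(F\otimes G)^*=F^*\otimes G^*$; associators and unitors are unitary; the unit object is simple ($\mathrm{End}(W_0)=\mathbb C\mathbf 1$); and $\mathcal C$ is closed under finite orthogonal direct sums and orthogonal subobjects. It is *braided* if it carries a unitary braiding $ß$, and *rigid* if every object has a dual. For a dual pair $W_i,W_{\overline i}$ one has evaluations $\mathrm{ev}_{i,\overline i}$, $\mathrm{ev}_{\overline i,i}$ and $\mathrm{coev}_{i,\overline i}=(\mathrm{ev}_{i,\overline i})^*$, $\mathrm{coev}_{\overline i,i}=(\mathrm{ev}_{\overline i,i})^*$ satisfying the conjugate equations; they are *standard* if $\mathrm{ev}_{i,\overline i}(F\otimes\mathbf 1_{\overline i})\mathrm{coev}_{i,\overline i}=\mathrm{ev}_{\overline i,i}(\mathbf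 1_{\overline i}\otimes F)\mathrm{coev}_{\overline i,i}$ for all $F\in\mathrm{End}(W_i)$. The *canonical twist* of a rigid braided $C^*$-tensor category is given, for any choice of standard evaluations, by $$\vartheta_i=(\mathrm{ev}_{\overline i,i}\otimes\mathbf 1_i)(\mathbf 1_{\overline i}\otimes ß_{i,i})(\mathrm{coev}_{\overline i,i}\otimes\mathbf 1_i)=(\mathbf 1_i\otimes\mathrm{ev}_{i,\overline i})(ß_{i,i}\otimes\mathbf 1_{\overline i})(\mathbf 1_i\otimes\mathrm{coev}_{i,\overline i}).$$ A *haploid commutative Q-system* in $\mathcal C$ is an associative unital algebra $A=(W_a,\mu,\iota)$ in $\mathcal C$ with $\mu ß_{a,a}=\mu$, $\dim\mathrm{Hom}(W_0,W_a)=1$, $\mu\mu^*\in\mathbb R_{>0}\mathbf 1_a$ and $(\mathbf 1_a\otimes\mu)(\mu^*\otimes\mathbf 1_a)=\mu^*\mu$. A left $A$-module $(W_i,\mu_L)$ is *unitary* if $\mu_L=(\iota^*\mu\otimes\mathbf 1_i)(\mathbf 1_a\otimes\mu_L^*)$ (similarly for right modules and bimodules) and *single-valued* if $\mu_L ß_{i,a}ß_{a,i}=\mu_L$;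 it is then a unitary bimodule with right action $\mu_R=\mu_L ß_{i,a}$. Let $\mathrm{Rep}^{\mathrm u}(A)$ be the category of single-valued unitary left $A$-modules and $A$-module morphisms, with the $*$-structure of $\mathcal C$. A *unitary tensor product* of unitary $A$-bimodules $W_i,W_j$ is a unitary $A$-bimodule $W_{ij}$ with an $A$-bimodule morphism $\mu_{i,j}:W_i\boxtimes W_j\to W_{ij}$ satisfying $\mu_{i,j}(\mu_R\otimes\mathbf 1_j)=\mu_{i,j}(\mathbf 1_i\otimes\mu_L)$, universal among all such morphisms to unitary $A$-bimodules, and with $\mu_{i,j}^*\mu_{i,j}=(\mathbf 1_i\otimes\mu_L)(\mu_R^*\otimes\mathbf 1_j)$. For a choice $W_i\boxtimes_A W_j=W_{ij}$ of unitary tensor products in $\mathrm{Rep}^{\mathrm u}(A)$ of all pairs of its objects, the tensor product of morphisms, the associators, the unitors (with unit object $W_a$) and the braiding $ß^A$ are the morphisms induced through the $\mu_{i,j}$ by those of $\mathcal C$ and by the module actions; in particular $ß^A_{i,j}\mu_{i,j}=\mu_{j,i}ß_{i,j}$. A *modular tensor category* is a rigid $\mathbb C$-linear ribbon category $(\mathcal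 C,\boxtimes,ß,\vartheta)$ with bilinear $\boxtimes$, simple unit and finite direct sums, semisimple with finitely many simple objects $W_1,\dots,W_n$ up to isomorphism (each with $\mathrm{End}=\mathbb C$), whose matrix with entries $\mathrm{tr}_\vartheta(ß_{j,i}ß_{i,j})$ is invertible. It is *unitary* if it is a braided $C^*$-tensor category and $\vartheta$ is its canonical twist. **Theorem.** Let $\mathcal C$ be a rigid braided $C^*$-tensor category and $A=(W_a,\mu,\iota)$ a haploid commutative Q-system in $\mathcal C$. Then unitary tensor products in $\mathrm{Rep}^{\mathrm u}(A)$ exist and, for every choice of them: 1. $(\mathrm{Rep}^{\mathrm u}(A),\boxtimes_A,ß^A)$ is a rigid braided $C^*$-tensor category. 2. Let $\vartheta$ and $\vartheta^A$ be the canonical twists of $\mathcal C$ and of $\mathrm{Rep}^{\mathrm u}(A)$. For every object $W_i$ of $\mathrm{Rep}^{\mathrm u}(A)$, $\vartheta_i$ is a unitary morphism of $A$-modules and $\vartheta_i=\vartheta^A_i$. In particular $\vartheta_a=\mathbf 1_a$. 3. If $(\mathcal C,\boxtimes,ß,\vartheta)$ is a unitary modular tensor category, then so is $(\mathrm{Rep}^{\mathrm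 u}(A),\boxtimes_A,ß^A,\vartheta)$. -/

import Mathlib

open CategoryTheory MonoidalCategory

universe v u

set_option linter.unusedSectionVars false

namespace CStarRep

open scoped MonObj

/-! ### C*-tensor categories -/

/-- A complex linear category with an antilinear involution `* : Hom(X, Y) → Hom(Y, X)`
reversing composition. -/
class StarCategory (C : Type u) [Category.{v} C] [Preadditive C] [Linear ℂ C] where
  /-- The adjoint of a morphism. -/
  dag : ∀ {X Y : C}, (X ⟶ Y) → (Y ⟶ X)
  dag_dag : ∀ {X Y : C} (f : X ⟶ Y), dag (dag f) = f
  dag_comp : ∀ {X Y Z : C} (f : X ⟶ Y) (g : Y ⟶ Z), dag (f ≫ g) = dag g ≫ dag f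
  dag_add : ∀ {X Y : C} (f g : X ⟶ Y), dag (f + g) = dag f + dag g
  dag_smul : ∀ {X Y : C} (c : ℂ) (f : X ⟶ Y), dag (c • f) = (starRingEnd ℂ) c • dag f

open StarCategory

/-- C*-categories: the morphism spaces are Banach spaces for a submultiplicative norm with the
C*-identity, and `f* f` is a positive element of the C*-algebra `End X` for all `f : X ⟶ Y`.
(The norm is determined by the `*`-structure.) -/
class IsCStarCategory (C : Type u) [Category.{v} C] [Preadditive C] [Linear ℂ C]
    [StarCategory C] : Prop where
  exists_norm : ∃ N : ∀ X Y : C, Seminorm ℂ (X ⟶ Y),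
    (∀ {X Y : C} (f : X ⟶ Y), N X Y f = 0 → f = 0) ∧
    (∀ {X Y Z : C} (f : X ⟶ Y) (g : Y ⟶ Z), N X Z (f ≫ g) ≤ N X Y f * N Y Z g) ∧
    (∀ {X Y : C} (f : X ⟶ Y), N X X (f ≫ dag f) = N X Y f ^ 2) ∧
    (∀ {X Y : C} (s : ℕ → (X ⟶ Y)),
      (∀ ε > 0, ∃ n, ∀ p ≥ n, ∀ q ≥ n, N X Y (s p - s q) < ε) →
        ∃ f, ∀ ε > 0, ∃ n, ∀ p ≥ n, N X Y (s p - f) < ε)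
  exists_sqrt : ∀ {X Y : C} (f : X ⟶ Y), ∃ g : X ⟶ X, f ≫ dag f = g ≫ dag g

/-- C*-tensor categories with simple unit object, closed under finite orthogonal direct sums
and orthogonal subobjects. -/
class IsCStarTensorCategory (C : Type u) [Category.{v} C] [Preadditive C] [Linear ℂ C]
    [StarCategory C] [MonoidalCategory C] : Prop
    extends IsCStarCategory C, MonoidalPreadditive C, MonoidalLinear ℂ C where
  dag_whiskerLeft : ∀ (X : C) {Y Z : C} (f : Y ⟶ Z), dag (X ◁ f) = X ◁ dag f
  dag_whiskerRight : ∀ {Y Z : C} (f : Y ⟶ Z) (X : C), dag (f ▷ X) = dag f ▷ X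
  dag_associator : ∀ X Y Z : C, dag (α_ X Y Z).hom = (α_ X Y Z).inv
  dag_leftUnitor : ∀ X : C, dag (λ_ X).hom = (λ_ X).inv
  dag_rightUnitor : ∀ X : C, dag (ρ_ X).hom = (ρ_ X).inv
  simple_unit : Module.finrank ℂ (𝟙_ C ⟶ 𝟙_ C) = 1
  exists_directSum : ∀ (n : ℕ) (W : Fin n → C), ∃ (X : C) (p : ∀ s, X ⟶ W s),
    (∀ s, dag (p s) ≫ p s = 𝟙 (W s)) ∧ (∀ s t, s ≠ t → dag (p s) ≫ p t = 0) ∧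
      ∑ s, p s ≫ dag (p s) = 𝟙 X
  exists_subobject : ∀ (X : C) (e : X ⟶ X), e ≫ e = e → dag e = e →
    ∃ (Y : C) (p : X ⟶ Y), dag p ≫ p = 𝟙 Y ∧ p ≫ dag p = e

/-- Braided C*-tensor categories: the braiding is unitary. -/
class IsBraidedCStarTensorCategory (C : Type u) [Category.{v} C] [Preadditive C] [Linear ℂ C]
    [StarCategory C] [MonoidalCategory C] [BraidedCategory C] : Prop
    extends IsCStarTensorCategory C where
  dag_braiding : ∀ X Y : C, dag (β_ X Y).hom = (β_ X Y).inv

/-- Every object is dualizable. -/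
def IsRigid (C : Type u) [Category.{v} C] [MonoidalCategory C] : Prop :=
  ∀ X : C, ∃ Y : C, Nonempty (ExactPairing X Y)

section Twist

variable {C : Type u} [Category.{v} C] [Preadditive C] [Linear ℂ C] [StarCategory C]

/-- Unitary morphisms. -/
def IsUnitary {X Y : C} (f : X ⟶ Y) : Prop := f ≫ dag f = 𝟙 X ∧ dag f ≫ f = 𝟙 Y

variable [MonoidalCategory C]

/-- For an object `X` with dual `Y`, evaluation `ε : Y ⊗ X ⟶ 𝟙` and coevaluation
`η : 𝟙 ⟶ X ⊗ Y`, the other evaluation and coevaluation of the pair are `η*` and `ε*`. The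
evaluations are standard if the left trace `η* ∘ (F ⊗ 1) ∘ η` and the right trace
`ε ∘ (1 ⊗ F) ∘ ε*` coincide on `End X`. -/
def IsStandard {X Y : C} (p : ExactPairing X Y) : Prop :=
  ∀ F : X ⟶ X, p.coevaluation' ≫ F ▷ Y ≫ dag p.coevaluation' =
    dag p.evaluation' ≫ Y ◁ F ≫ p.evaluation'

variable [BraidedCategory C]

/-- `(ε ⊗ 1) ∘ (1 ⊗ β) ∘ (ε* ⊗ 1)` -/
def twistLeft {X Y : C} (p : ExactPairing X Y) : X ⟶ X :=
  (λ_ X).inv ≫ dag p.evaluation' ▷ X ≫ (α_ Y X X).hom ≫ Y ◁ (β_ X X).hom ≫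
    (α_ Y X X).inv ≫ p.evaluation' ▷ X ≫ (λ_ X).hom

/-- `(1 ⊗ η*) ∘ (β ⊗ 1) ∘ (1 ⊗ η)` -/
def twistRight {X Y : C} (p : ExactPairing X Y) : X ⟶ X :=
  (ρ_ X).inv ≫ X ◁ p.coevaluation' ≫ (α_ X X Y).inv ≫ (β_ X X).hom ▷ Y ≫
    (α_ X X Y).hom ≫ X ◁ dag p.coevaluation' ≫ (ρ_ X).hom

/-- `θ` is the value at `X` of the canonical twist: standard evaluations of `X` exist, and `θ` is
given by either of the two formulas for every choice of them. -/
def IsCanonicalTwistAt (X : C) (θ : X ⟶ X) : Prop :=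
  (∃ (Y : C) (p : ExactPairing X Y), IsStandard p) ∧
    ∀ (Y : C) (p : ExactPairing X Y), IsStandard p → θ = twistLeft p ∧ θ = twistRight p

end Twist

/-! ### Modular tensor categories -/

section Modular

variable (C : Type u) [Category.{v} C] [Preadditive C] [Linear ℂ C] [MonoidalCategory C]
  [BraidedCategory C]

/-- Ribbon structures (twists) on a braided tensor category. -/
structure IsRibbonTwist (θ : ∀ X : C, X ⟶ X) : Prop where
  isIso : ∀ X, IsIso (θ X)
  naturality : ∀ {X Y : C} (f : X ⟶ Y), f ≫ θ Y = θ X ≫ f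
  tensor : ∀ X Y : C, θ (X ⊗ Y) = (β_ X Y).hom ≫ (β_ Y X).hom ≫ (θ X ⊗ₘ θ Y)
  dual : ∀ {X Y : C} (p : ExactPairing X Y),
    p.coevaluation' ≫ θ X ▷ Y = p.coevaluation' ≫ X ◁ θ Y

variable {C}

/-- The trace of `F : X ⟶ X` with respect to a twist, as an endomorphism of the unit object. -/
def ribbonTrace (θ : ∀ X : C, X ⟶ X) {X Y : C} (p : ExactPairing X Y) (F : X ⟶ X) :
    𝟙_ C ⟶ 𝟙_ C :=
  p.coevaluation' ≫ (F ≫ θ X) ▷ Y ≫ (β_ X Y).hom ≫ p.evaluation'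

variable (C)

/-- Modular tensor categories over `ℂ`: rigid ribbon categories with bilinear tensor product and
simple unit object, semisimple with finitely many simple objects `S i` (up to isomorphism), and
with invertible S-matrix `s i j = tr (β_{S j, S i} ∘ β_{S i, S j})`. -/
structure IsModular (θ : ∀ X : C, X ⟶ X) : Prop
    extends MonoidalPreadditive C, MonoidalLinear ℂ C where
  rigid : IsRigid C
  ribbon : IsRibbonTwist C θ
  simple_unit : Module.finrank ℂ (𝟙_ C ⟶ 𝟙_ C) = 1
  hasFiniteBiproducts : Limits.HasFiniteBiproducts C
  exists_simples : ∃ (n : ℕ) (S : Fin n → C),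
    (∀ i, Module.finrank ℂ (S i ⟶ S i) = 1) ∧
    (∀ i j, i ≠ j → ∀ f : S i ⟶ S j, f = 0) ∧
    (∀ X : C, ∃ (k : ℕ) (c : Fin k → Fin n) (a : ∀ t, S (c t) ⟶ X) (b : ∀ t, X ⟶ S (c t)),
      (∀ t, a t ≫ b t = 𝟙 _) ∧ (∀ t t', t ≠ t' → a t ≫ b t' = 0) ∧ ∑ t, b t ≫ a t = 𝟙 X) ∧
    ∃ (D : Fin n → Fin n → C) (p : ∀ i j, ExactPairing (S i ⊗ S j) (D i j))
      (s : Matrix (Fin n) (Fin n) ℂ),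
      (∀ i j, ribbonTrace θ (p i j) ((β_ (S i) (S j)).hom ≫ (β_ (S j) (S i)).hom) =
        s i j • 𝟙 (𝟙_ C)) ∧ IsUnit s

/-- Unitary modular tensor categories: modular tensor categories which are braided C*-tensor
categories and whose twist is the canonical twist. -/
structure IsUnitaryModular [StarCategory C] (θ : ∀ X : C, X ⟶ X) : Prop where
  cstar : IsBraidedCStarTensorCategory C
  modular : IsModular C θ
  canonical : ∀ X, IsCanonicalTwistAt X (θ X)

end Modular

/-! ### Q-systems and their modules -/

section QSystem

variable {C : Type u} [Category.{v} C] [Preadditive C] [Linear ℂ C] [StarCategory C]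
  [MonoidalCategory C]

/-- Q-systems: special C*-Frobenius algebras. -/
class IsQSystem (A : C) [MonObj A] : Prop where
  frobenius : dag μ[A] ▷ A ≫ (α_ A A A).hom ≫ A ◁ μ[A] = μ[A] ≫ dag μ[A]
  special : ∃ d : ℝ, 0 < d ∧ dag μ[A] ≫ μ[A] = (d : ℂ) • 𝟙 A

/-- Haploid algebras. -/
def IsHaploid (A : C) : Prop := Module.finrank ℂ (𝟙_ C ⟶ A) = 1

/-- The evaluation `η* ∘ μ : A ⊗ A ⟶ 𝟙`. -/
def evA (A : C) [MonObj A] : A ⊗ A ⟶ 𝟙_ C := μ[A] ≫ dag η[A]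

/-- Unitarity of a left action of `A`: `a = (ev ⊗ 1) ∘ (1 ⊗ a*)`. -/
def IsUnitaryLeft (A : C) [MonObj A] {X : C} (a : A ⊗ X ⟶ X) : Prop :=
  a = A ◁ dag a ≫ (α_ A A X).inv ≫ evA A ▷ X ≫ (λ_ X).hom

/-- Unitarity of a right action of `A`: `a = (1 ⊗ ev) ∘ (a* ⊗ 1)`. -/
def IsUnitaryRight (A : C) [MonObj A] {X : C} (a : X ⊗ A ⟶ X) : Prop :=
  a = dag a ▷ A ≫ (α_ X A A).hom ≫ X ◁ evA A ≫ (ρ_ X).hom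

/-- Unitary `A`-bimodules. -/
structure UnitaryBimodule (A : C) [MonObj A] where
  obj : C
  actL : A ⊗ obj ⟶ obj
  actR : obj ⊗ A ⟶ obj
  one_actL : η[A] ▷ obj ≫ actL = (λ_ obj).hom
  actR_one : obj ◁ η[A] ≫ actR = (ρ_ obj).hom
  assocL : μ[A] ▷ obj ≫ actL = (α_ A A obj).hom ≫ A ◁ actL ≫ actL
  assocR : actR ▷ A ≫ actR = (α_ obj A A).hom ≫ obj ◁ μ[A] ≫ actR
  assocM : actL ▷ A ≫ actR = (α_ A obj A).hom ≫ A ◁ actR ≫ actL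
  unitaryL : IsUnitaryLeft A actL
  unitaryR : IsUnitaryRight A actR

/-- `(P, m)` is a unitary tensor product over `A` of the unitary bimodules `M` and `N`. The
bimodule `M ⊗ N` carries the left action of `M` and the right action of `N`. -/
structure IsUnitaryTensorProduct {A : C} [MonObj A] (M N P : UnitaryBimodule A)
    (m : M.obj ⊗ N.obj ⟶ P.obj) : Prop where
  linearL : A ◁ m ≫ P.actL = (α_ A M.obj N.obj).inv ≫ M.actL ▷ N.obj ≫ m
  linearR : m ▷ A ≫ P.actR = (α_ M.obj N.obj A).hom ≫ M.obj ◁ N.actR ≫ m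
  balanced : M.actR ▷ N.obj ≫ m = (α_ M.obj A N.obj).hom ≫ M.obj ◁ N.actL ≫ m
  universal : ∀ (K : UnitaryBimodule A) (f : M.obj ⊗ N.obj ⟶ K.obj),
    A ◁ f ≫ K.actL = (α_ A M.obj N.obj).inv ≫ M.actL ▷ N.obj ≫ f →
    f ▷ A ≫ K.actR = (α_ M.obj N.obj A).hom ≫ M.obj ◁ N.actR ≫ f →
    M.actR ▷ N.obj ≫ f = (α_ M.obj A N.obj).hom ≫ M.obj ◁ N.actL ≫ f →
    ∃! g : P.obj ⟶ K.obj, A ◁ g ≫ K.actL = P.actL ≫ g ∧ g ▷ A ≫ K.actR = P.actR ≫ g ∧ m ≫ g = f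
  unitary : m ≫ dag m = dag M.actR ▷ N.obj ≫ (α_ M.obj A N.obj).hom ≫ M.obj ◁ N.actL

variable [BraidedCategory C]

/-- Single-valued unitary left `A`-modules. -/
structure RepU (A : C) [MonObj A] where
  obj : C
  act : A ⊗ obj ⟶ obj
  one_act : η[A] ▷ obj ≫ act = (λ_ obj).hom
  assoc : μ[A] ▷ obj ≫ act = (α_ A A obj).hom ≫ A ◁ act ≫ act
  unitary : IsUnitaryLeft A act
  singleValued : (β_ A obj).hom ≫ (β_ obj A).hom ≫ act = act

namespace RepU

variable {A : C} [MonObj A]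

/-- Morphisms of left `A`-modules. -/
@[ext]
structure Hom (X Y : RepU A) where
  hom : X.obj ⟶ Y.obj
  comm : A ◁ hom ≫ Y.act = X.act ≫ hom

instance : Category (RepU A) where
  Hom X Y := Hom X Y
  id X := ⟨𝟙 _, by simp⟩
  comp f g := ⟨f.hom ≫ g.hom, by
    rw [MonoidalCategory.whiskerLeft_comp, Category.assoc, g.comm, ← Category.assoc, f.comm,
      Category.assoc]⟩
  id_comp f := Hom.ext (Category.id_comp _)
  comp_id f := Hom.ext (Category.comp_id _)
  assoc f g h := Hom.ext (Category.assoc _ _ _)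

theorem hom_ext {X Y : RepU A} {f g : X ⟶ Y} (h : f.hom = g.hom) : f = g := Hom.ext h

@[simp] theorem id_hom (X : RepU A) : (𝟙 X : X ⟶ X).hom = 𝟙 X.obj := rfl

@[simp] theorem comp_hom {X Y Z : RepU A} (f : X ⟶ Y) (g : Y ⟶ Z) :
    (f ≫ g).hom = f.hom ≫ g.hom := rfl

/-- A module morphism which is invertible in `C` is an isomorphism of modules. -/
def mkIso {X Y : RepU A} (f : X ⟶ Y) (g : Y.obj ⟶ X.obj) (h₁ : f.hom ≫ g = 𝟙 _)
    (h₂ : g ≫ f.hom = 𝟙 _) : X ≅ Y where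
  hom := f
  inv := ⟨g, by
    have := f.comm
    calc A ◁ g ≫ X.act = A ◁ g ≫ (X.act ≫ f.hom) ≫ g := by simp [h₁]
      _ = (A ◁ g ≫ A ◁ f.hom) ≫ Y.act ≫ g := by simp [← this]
      _ = Y.act ≫ g := by rw [← MonoidalCategory.whiskerLeft_comp, h₂]; simp⟩
  hom_inv_id := hom_ext h₁
  inv_hom_id := hom_ext h₂

section Linear

variable [IsCStarTensorCategory C]

instance (X Y : RepU A) : Zero (X ⟶ Y) := ⟨⟨0, by simp⟩⟩
instance (X Y : RepU A) : Add (X ⟶ Y) := ⟨fun f g => ⟨f.hom + g.hom, by simp [f.comm, g.comm]⟩⟩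
instance (X Y : RepU A) : Neg (X ⟶ Y) := ⟨fun f => ⟨-f.hom, by
  have h : A ◁ (-f.hom) = -(A ◁ f.hom) := (tensorLeft A).map_neg
  simp [h, f.comm]⟩⟩
instance (X Y : RepU A) : Sub (X ⟶ Y) := ⟨fun f g => ⟨f.hom - g.hom, by
  have h : A ◁ (f.hom - g.hom) = A ◁ f.hom - A ◁ g.hom := (tensorLeft A).map_sub
  simp [h, f.comm, g.comm]⟩⟩
instance (X Y : RepU A) : SMul ℂ (X ⟶ Y) := ⟨fun c f => ⟨c • f.hom, by simp [f.comm]⟩⟩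
instance (X Y : RepU A) : SMul ℕ (X ⟶ Y) := ⟨fun n f => ⟨n • f.hom, by
  simp [← Nat.cast_smul_eq_nsmul ℂ, f.comm]⟩⟩
instance (X Y : RepU A) : SMul ℤ (X ⟶ Y) := ⟨fun n f => ⟨n • f.hom, by
  simp [← Int.cast_smul_eq_zsmul ℂ, f.comm]⟩⟩

instance (X Y : RepU A) : AddCommGroup (X ⟶ Y) :=
  Function.Injective.addCommGroup (fun f : X ⟶ Y => f.hom) (fun _ _ h => hom_ext h) rfl
    (fun _ _ => rfl) (fun _ => rfl) (fun _ _ => rfl) (fun _ _ => rfl) (fun _ _ => rfl)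

instance : Preadditive (RepU A) where
  add_comp _ _ _ _ _ _ := hom_ext (Preadditive.add_comp _ _ _ _ _ _)
  comp_add _ _ _ _ _ _ := hom_ext (Preadditive.comp_add _ _ _ _ _ _)

/-- The underlying morphism, as an additive map. -/
def homAddHom (X Y : RepU A) : (X ⟶ Y) →+ (X.obj ⟶ Y.obj) where
  toFun f := f.hom
  map_zero' := rfl
  map_add' _ _ := rfl

instance (X Y : RepU A) : Module ℂ (X ⟶ Y) :=
  Function.Injective.module ℂ (homAddHom X Y) (fun _ _ h => hom_ext h) (fun _ _ => rfl)

instance : Linear ℂ (RepU A) where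
  smul_comp _ _ _ _ _ _ := hom_ext (Linear.smul_comp _ _ _ _ _ _)
  comp_smul _ _ _ _ _ _ := hom_ext (Linear.comp_smul _ _ _ _ _ _)

end Linear

end RepU

end QSystem

section Star

variable {C : Type u} [Category.{v} C] [Preadditive C] [Linear ℂ C] [StarCategory C]
  [MonoidalCategory C] [IsCStarTensorCategory C]

open IsCStarTensorCategory

theorem dag_associator_inv (X Y Z : C) : dag (α_ X Y Z).inv = (α_ X Y Z).hom := by
  rw [← dag_associator, dag_dag]

/-- The adjoint of the unitarity relation of a left action. -/
theorem dag_act {A : C} [MonObj A] {X : C} {a : A ⊗ X ⟶ X} (h : IsUnitaryLeft A a) :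
    dag a = (λ_ X).inv ≫ (η[A] ≫ dag μ[A]) ▷ X ≫ (α_ A A X).hom ≫ A ◁ a := by
  conv_lhs => rw [h]
  simp [evA, dag_comp, dag_whiskerLeft, dag_whiskerRight, dag_associator_inv, dag_leftUnitor,
    dag_dag]

/-- The adjoint of a morphism of unitary left modules is a morphism of left modules. -/
theorem dag_linear {A : C} [MonObj A] {X Y : C} {a : A ⊗ X ⟶ X} {b : A ⊗ Y ⟶ Y}
    (ha : IsUnitaryLeft A a) (hb : IsUnitaryLeft A b) {f : X ⟶ Y} (hf : A ◁ f ≫ b = a ≫ f) :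
    A ◁ dag f ≫ a = b ≫ dag f := by
  have h : dag b ≫ A ◁ dag f = dag f ≫ dag a := by
    rw [← dag_whiskerLeft, ← dag_comp, hf, dag_comp]
  rw [ha, hb, ← MonoidalCategory.whiskerLeft_comp_assoc, ← h]
  simp only [MonoidalCategory.whiskerLeft_comp, Category.assoc, associator_inv_naturality_right_assoc,
    ← leftUnitor_naturality, whisker_exchange_assoc]

theorem tensor_unitaryLeft {A : C} [MonObj A] {X : C} {a : A ⊗ X ⟶ X} (ha : IsUnitaryLeft A a)
    (Y : C) : IsUnitaryLeft A ((α_ A X Y).inv ≫ a ▷ Y) := by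
  unfold IsUnitaryLeft
  conv_lhs => rw [ha]
  simp [dag_comp, dag_whiskerRight, dag_associator_inv]

end Star

section Module

variable {C : Type u} [Category.{v} C] [Preadditive C] [Linear ℂ C] [StarCategory C]
  [MonoidalCategory C] [BraidedCategory C] [IsBraidedCStarTensorCategory C] {A : C} [MonObj A]

open IsCStarTensorCategory IsBraidedCStarTensorCategory

namespace RepU

instance : StarCategory (RepU A) where
  dag {X Y} f := ⟨dag f.hom, dag_linear X.unitary Y.unitary f.comm⟩
  dag_dag f := hom_ext (StarCategory.dag_dag f.hom)
  dag_comp f g := hom_ext (StarCategory.dag_comp f.hom g.hom)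
  dag_add f g := hom_ext (StarCategory.dag_add f.hom g.hom)
  dag_smul c f := hom_ext (StarCategory.dag_smul c f.hom)

/-- The right action of `A` on a single-valued left module. -/
def actR (X : RepU A) : X.obj ⊗ A ⟶ X.obj := (β_ X.obj A).hom ≫ X.act

variable [IsCommMonObj A]

theorem actR_assocM (X : RepU A) :
    X.act ▷ A ≫ X.actR = (α_ A X.obj A).hom ≫ A ◁ X.actR ≫ X.act := by
  have h := X.assoc
  rw [← Iso.inv_comp_eq] at h
  simp only [actR, BraidedCategory.braiding_naturality_left_assoc,
    BraidedCategory.braiding_tensor_left_hom, Category.assoc, MonoidalCategory.whiskerLeft_comp]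
  rw [← h]
  simp only [Iso.hom_inv_id_assoc, ← comp_whiskerRight_assoc, IsCommMonObj.mul_comm]

/-- A single-valued unitary left module as a unitary bimodule. -/
def bim (X : RepU A) : UnitaryBimodule A where
  obj := X.obj
  actL := X.act
  actR := X.actR
  one_actL := X.one_act
  actR_one := by
    rw [actR, BraidedCategory.braiding_naturality_right_assoc, X.one_act, braiding_leftUnitor]
  assocL := X.assoc
  assocR := by
    have h := X.actR_assocM
    nth_rw 1 [actR]
    rw [comp_whiskerRight, Category.assoc, h]
    simp [actR, X.assoc]
  assocM := X.actR_assocM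
  unitaryL := X.unitary
  unitaryR := by
    have h : X.obj ◁ evA A ≫ (ρ_ X.obj).hom = (α_ X.obj A A).inv ≫ (β_ X.obj A).hom ▷ A ≫
        (α_ A X.obj A).hom ≫ A ◁ (β_ X.obj A).hom ≫ (α_ A A X.obj).inv ≫
          evA A ▷ X.obj ≫ (λ_ X.obj).hom := by
      rw [← braiding_leftUnitor, BraidedCategory.braiding_naturality_right_assoc]
      simp
    have h' : (β_ A A).hom ≫ evA A = evA A := by simp [evA]
    unfold IsUnitaryRight
    rw [h]
    conv_lhs => rw [actR, X.unitary]
    simp only [actR, dag_comp, dag_braiding, comp_whiskerRight, Category.assoc,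
      Iso.hom_inv_id_assoc, ← BraidedCategory.braiding_naturality_left_assoc,
      BraidedCategory.braiding_tensor_left_hom, inv_hom_whiskerRight_assoc]
    rw [← comp_whiskerRight_assoc (β_ A A).hom, h']

end RepU

end Module

/-! ### The braided tensor category of single-valued unitary modules -/

section Tensor

variable {C : Type u} [Category.{v} C] [Preadditive C] [Linear ℂ C] [StarCategory C]
  [MonoidalCategory C] [BraidedCategory C] [IsBraidedCStarTensorCategory C]

open IsCStarTensorCategory IsBraidedCStarTensorCategory

/-- A choice of a unitary tensor product over `A` for every pair of single-valued unitary left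
modules. -/
class UnitaryTensorSystem (A : C) [MonObj A] [IsCommMonObj A] where
  prod : RepU A → RepU A → RepU A
  mul : ∀ X Y : RepU A, X.obj ⊗ Y.obj ⟶ (prod X Y).obj
  isTensor : ∀ X Y : RepU A, IsUnitaryTensorProduct X.bim Y.bim (prod X Y).bim (mul X Y)

namespace RepU

variable {A : C} [MonObj A] [IsQSystem A]

variable (A) in
/-- The scalar `d` with `μ μ* = d`. -/
noncomputable def dA : ℂ := ((IsQSystem.special (A := A)).choose : ℝ)

theorem dA_ne : dA A ≠ 0 := by
  have h := (IsQSystem.special (A := A)).choose_spec.1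
  unfold dA
  exact_mod_cast h.ne'

theorem dag_mul_mul : dag μ[A] ≫ μ[A] = dA A • 𝟙 A :=
  (IsQSystem.special (A := A)).choose_spec.2

variable [IsCommMonObj A] [T : UnitaryTensorSystem A]

theorem dag_act_act (X : RepU A) : dag X.act ≫ X.act = dA A • 𝟙 X.obj := by
  rw [dag_act X.unitary]
  simp only [Category.assoc]
  rw [← X.assoc, ← comp_whiskerRight_assoc, Category.assoc, dag_mul_mul]
  simp [X.one_act]

theorem dag_actR_actR (X : RepU A) : dag X.actR ≫ X.actR = dA A • 𝟙 X.obj := by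
  rw [actR, dag_comp, dag_braiding]
  simp [dag_act_act]

/-- The structure morphism `X ⊗ Y ⟶ X ⊗_A Y`. -/
abbrev m (X Y : RepU A) : X.obj ⊗ Y.obj ⟶ (T.prod X Y).obj := T.mul X Y

theorem m_linear (X Y : RepU A) : A ◁ m X Y ≫ (T.prod X Y).act =
    (α_ A X.obj Y.obj).inv ≫ X.act ▷ Y.obj ≫ m X Y := (T.isTensor X Y).linearL

theorem m_linearR (X Y : RepU A) : m X Y ▷ A ≫ (T.prod X Y).actR =
    (α_ X.obj Y.obj A).hom ≫ X.obj ◁ Y.actR ≫ m X Y := (T.isTensor X Y).linearR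

theorem m_balanced (X Y : RepU A) : X.actR ▷ Y.obj ≫ m X Y =
    (α_ X.obj A Y.obj).hom ≫ X.obj ◁ Y.act ≫ m X Y := (T.isTensor X Y).balanced

theorem m_dag (X Y : RepU A) : m X Y ≫ dag (m X Y) =
    dag X.actR ▷ Y.obj ≫ (α_ X.obj A Y.obj).hom ≫ X.obj ◁ Y.act := (T.isTensor X Y).unitary

theorem dag_m_linear (X Y : RepU A) :
    A ◁ dag (m X Y) ≫ (α_ A X.obj Y.obj).inv ≫ X.act ▷ Y.obj =
      (T.prod X Y).act ≫ dag (m X Y) :=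
  dag_linear (tensor_unitaryLeft X.unitary _) (T.prod X Y).unitary (by simpa using m_linear X Y)

theorem m_dag_balanced (X Y : RepU A) {Z : C} (f : X.obj ⊗ Y.obj ⟶ Z)
    (h : X.actR ▷ Y.obj ≫ f = (α_ X.obj A Y.obj).hom ≫ X.obj ◁ Y.act ≫ f) :
    m X Y ≫ dag (m X Y) ≫ f = dA A • f := by
  rw [← Category.assoc, m_dag, Category.assoc, Category.assoc, ← h, ← comp_whiskerRight_assoc,
    dag_actR_actR]
  simp

theorem dag_m_m (X Y : RepU A) : dag (m X Y) ≫ m X Y = dA A • 𝟙 _ := by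
  have hl : ∀ f : (T.prod X Y).obj ⟶ (T.prod X Y).obj, A ◁ f ≫ (T.prod X Y).act =
      (T.prod X Y).act ≫ f → f ▷ A ≫ (T.prod X Y).actR = (T.prod X Y).actR ≫ f := by
    intro f hf
    simp [actR, hf]
  have h₁ : A ◁ (dag (m X Y) ≫ m X Y) ≫ (T.prod X Y).act =
      (T.prod X Y).act ≫ (dag (m X Y) ≫ m X Y) := by
    rw [← Category.assoc, ← dag_m_linear]
    simp [m_linear]
  have h₂ : A ◁ (dA A • 𝟙 (T.prod X Y).obj) ≫ (T.prod X Y).act =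
      (T.prod X Y).act ≫ (dA A • 𝟙 _) := by simp
  have e₁ : A ◁ (dA A • m X Y) ≫ (T.prod X Y).act =
      (α_ A X.obj Y.obj).inv ≫ X.act ▷ Y.obj ≫ (dA A • m X Y) := by simp [m_linear]
  have e₂ : (dA A • m X Y) ▷ A ≫ (T.prod X Y).actR =
      (α_ X.obj Y.obj A).hom ≫ X.obj ◁ Y.actR ≫ (dA A • m X Y) := by simp [m_linearR]
  have e₃ : X.actR ▷ Y.obj ≫ (dA A • m X Y) =
      (α_ X.obj A Y.obj).hom ≫ X.obj ◁ Y.act ≫ (dA A • m X Y) := by simp [m_balanced]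
  have e₄ : m X Y ≫ (dA A • 𝟙 (T.prod X Y).obj) = dA A • m X Y := by simp
  exact ((T.isTensor X Y).universal (T.prod X Y).bim (dA A • m X Y) e₁ e₂ e₃).unique
    ⟨h₁, hl _ h₁, m_dag_balanced X Y _ (m_balanced X Y)⟩ ⟨h₂, hl _ h₂, e₄⟩

instance (X Y : RepU A) : IsSplitEpi (m X Y) :=
  ⟨⟨⟨(dA A)⁻¹ • dag (m X Y), by simp [dag_m_m, smul_smul, inv_mul_cancel₀ (dA_ne (A := A))]⟩⟩⟩

theorem isSplitEpi_whiskerLeft (Z : C) {X Y : C} (f : X ⟶ Y) [IsSplitEpi f] :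
    IsSplitEpi (Z ◁ f) :=
  inferInstanceAs (IsSplitEpi ((tensorLeft Z).map f))

theorem isSplitEpi_whiskerRight (Z : C) {X Y : C} (f : X ⟶ Y) [IsSplitEpi f] :
    IsSplitEpi (f ▷ Z) :=
  inferInstanceAs (IsSplitEpi ((tensorRight Z).map f))

attribute [local instance] isSplitEpi_whiskerLeft isSplitEpi_whiskerRight

/-- The morphism out of `X ⊗_A Y` induced by a balanced module morphism. -/
noncomputable def desc {X Y Z : RepU A} (f : X.obj ⊗ Y.obj ⟶ Z.obj)
    (_hb : X.actR ▷ Y.obj ≫ f = (α_ X.obj A Y.obj).hom ≫ X.obj ◁ Y.act ≫ f)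
    (hl : A ◁ f ≫ Z.act = (α_ A X.obj Y.obj).inv ≫ X.act ▷ Y.obj ≫ f) : T.prod X Y ⟶ Z where
  hom := (dA A)⁻¹ • (dag (m X Y) ≫ f)
  comm := by
    have h := dag_m_linear X Y
    have h' : (T.prod X Y).act ≫ dag (m X Y) ≫ f =
      A ◁ dag (m X Y) ≫ (α_ A X.obj Y.obj).inv ≫ X.act ▷ Y.obj ≫ f := by
      rw [← Category.assoc, ← h]; simp
    simp [hl, h']

theorem m_desc {X Y Z : RepU A} (f : X.obj ⊗ Y.obj ⟶ Z.obj) (hb) (hl) :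
    m X Y ≫ (desc (Z := Z) f hb hl).hom = f := by
  simp [desc, m_dag_balanced X Y f hb, smul_smul, inv_mul_cancel₀ (dA_ne (A := A))]

theorem prod_ext {X Y Z : RepU A} {f g : T.prod X Y ⟶ Z}
    (h : m X Y ≫ f.hom = m X Y ≫ g.hom) : f = g :=
  hom_ext ((cancel_epi _).1 h)

/-- `f ⊗_A g`, characterized by `μ (f ⊗ g) = (f ⊗_A g) μ`. -/
noncomputable def tensorMap {X X' Y Y' : RepU A} (f : X ⟶ X') (g : Y ⟶ Y') :
    T.prod X Y ⟶ T.prod X' Y' :=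
  desc ((f.hom ⊗ₘ g.hom) ≫ m X' Y')
    (by
      have hf : X.actR ≫ f.hom = f.hom ▷ A ≫ X'.actR := by simp [actR, f.comm]
      have hb := m_balanced X' Y'
      calc X.actR ▷ Y.obj ≫ (f.hom ⊗ₘ g.hom) ≫ m X' Y'
          = (X.actR ≫ f.hom) ▷ Y.obj ≫ X'.obj ◁ g.hom ≫ m X' Y' := by
            simp [MonoidalCategory.tensorHom_def]
        _ = f.hom ▷ A ▷ Y.obj ≫ (X'.obj ⊗ A) ◁ g.hom ≫ X'.actR ▷ Y'.obj ≫ m X' Y' := by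
            rw [hf, comp_whiskerRight, Category.assoc, ← whisker_exchange_assoc]
        _ = f.hom ▷ A ▷ Y.obj ≫ (α_ _ _ _).hom ≫ X'.obj ◁ (A ◁ g.hom ≫ Y'.act) ≫ m X' Y' := by
            rw [hb]; simp
        _ = _ := by
            rw [g.comm]
            simp [MonoidalCategory.tensorHom_def, whisker_exchange_assoc])
    (by
      have hb := m_linear X' Y'
      rw [MonoidalCategory.whiskerLeft_comp, Category.assoc, hb]
      have := f.comm
      simp only [MonoidalCategory.tensorHom_def, MonoidalCategory.whiskerLeft_comp, Category.assoc]
      rw [associator_inv_naturality_right_assoc, associator_inv_naturality_middle_assoc,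
        whisker_exchange_assoc, ← comp_whiskerRight_assoc, f.comm, comp_whiskerRight_assoc])

theorem m_tensorMap {X X' Y Y' : RepU A} (f : X ⟶ X') (g : Y ⟶ Y') :
    m X Y ≫ (tensorMap f g).hom = (f.hom ⊗ₘ g.hom) ≫ m X' Y' := m_desc _ _ _

/-- The algebra `A` as a module over itself. -/
abbrev unitObj : RepU A where
  obj := A
  act := μ
  one_act := MonObj.one_mul A
  assoc := MonObj.mul_assoc A
  unitary := by
    have h : A ◁ dag μ[A] ≫ (α_ A A A).inv ≫ μ[A] ▷ A = μ[A] ≫ dag μ[A] := by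
      have := congrArg dag (IsQSystem.frobenius (A := A))
      simpa [dag_comp, dag_whiskerLeft, dag_whiskerRight, dag_associator, dag_dag] using this
    have h' : dag μ[A] ≫ dag η[A] ▷ A = (λ_ A).inv := by
      rw [← dag_whiskerRight, ← dag_comp, MonObj.one_mul, dag_leftUnitor]
    unfold IsUnitaryLeft
    rw [evA, comp_whiskerRight]
    have h2 := congrArg (· ≫ dag η[A] ▷ A ≫ (λ_ A).hom) h
    simp only [Category.assoc] at h2
    rw [Category.assoc, h2, ← Category.assoc (dag μ[A]), h']
    simp
  singleValued := by simp

theorem unit_actR : (unitObj (A := A)).actR = μ[A] := by simp [unitObj, actR]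

/-- Morphisms out of `(X ⊗_A Y) ⊗ Z`. -/
noncomputable def descR (X Y : RepU A) {Z W : C} (f : (X.obj ⊗ Y.obj) ⊗ Z ⟶ W) :
    (T.prod X Y).obj ⊗ Z ⟶ W :=
  (dA A)⁻¹ • (dag (m X Y) ▷ Z ≫ f)

/-- Morphisms out of `Z ⊗ (X ⊗_A Y)`. -/
noncomputable def descL (X Y : RepU A) {Z W : C} (f : Z ⊗ (X.obj ⊗ Y.obj) ⟶ W) :
    Z ⊗ (T.prod X Y).obj ⟶ W :=
  (dA A)⁻¹ • (Z ◁ dag (m X Y) ≫ f)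

theorem m_descR (X Y : RepU A) {Z W : C} (f : (X.obj ⊗ Y.obj) ⊗ Z ⟶ W)
    (h : X.actR ▷ Y.obj ▷ Z ≫ f = (α_ X.obj A Y.obj).hom ▷ Z ≫ (X.obj ◁ Y.act) ▷ Z ≫ f) :
    m X Y ▷ Z ≫ descR X Y f = f := by
  have h' := congrArg (fun g => g ▷ Z ≫ f) (m_dag X Y)
  simp only [comp_whiskerRight, Category.assoc] at h'
  rw [← h, ← comp_whiskerRight_assoc, ← comp_whiskerRight_assoc, ← comp_whiskerRight,
    dag_actR_actR] at h'
  rw [descR, Linear.comp_smul, ← comp_whiskerRight_assoc, h']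
  simp [smul_smul, inv_mul_cancel₀ (dA_ne (A := A))]

theorem m_descL (X Y : RepU A) {Z W : C} (f : Z ⊗ (X.obj ⊗ Y.obj) ⟶ W)
    (h : Z ◁ X.actR ▷ Y.obj ≫ f = Z ◁ (α_ X.obj A Y.obj).hom ≫ Z ◁ X.obj ◁ Y.act ≫ f) :
    Z ◁ m X Y ≫ descL X Y f = f := by
  have h' := congrArg (fun g => Z ◁ g ≫ f) (m_dag X Y)
  simp only [MonoidalCategory.whiskerLeft_comp, Category.assoc] at h'
  rw [← h, ← MonoidalCategory.whiskerLeft_comp_assoc, ← MonoidalCategory.whiskerLeft_comp_assoc,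
    ← comp_whiskerRight, dag_actR_actR] at h'
  rw [descL, Linear.comp_smul, ← MonoidalCategory.whiskerLeft_comp_assoc, h']
  simp [smul_smul, inv_mul_cancel₀ (dA_ne (A := A))]

/-- `X ⊗ Y ⊗ Z ⟶ X ⊗_A (Y ⊗_A Z)` -/
def mR (X Y Z : RepU A) : X.obj ⊗ Y.obj ⊗ Z.obj ⟶ (T.prod X (T.prod Y Z)).obj :=
  X.obj ◁ m Y Z ≫ m X (T.prod Y Z)

/-- `X ⊗ Y ⊗ Z ⟶ (X ⊗_A Y) ⊗_A Z` -/
def mL (X Y Z : RepU A) : (X.obj ⊗ Y.obj) ⊗ Z.obj ⟶ (T.prod (T.prod X Y) Z).obj :=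
  m X Y ▷ Z.obj ≫ m (T.prod X Y) Z

theorem mR_linear (X Y Z : RepU A) : A ◁ mR X Y Z ≫ (T.prod X (T.prod Y Z)).act =
    (α_ _ _ _).inv ≫ X.act ▷ (Y.obj ⊗ Z.obj) ≫ mR X Y Z := by
  rw [mR, MonoidalCategory.whiskerLeft_comp, Category.assoc, m_linear,
    associator_inv_naturality_right_assoc, whisker_exchange_assoc]

theorem mL_linear (X Y Z : RepU A) : A ◁ mL X Y Z ≫ (T.prod (T.prod X Y) Z).act =
    (α_ _ _ _).inv ≫ (α_ _ _ _).inv ▷ _ ≫ X.act ▷ Y.obj ▷ Z.obj ≫ mL X Y Z := by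
  rw [mL, MonoidalCategory.whiskerLeft_comp, Category.assoc, m_linear,
    associator_inv_naturality_middle_assoc, ← comp_whiskerRight_assoc, m_linear]
  simp

theorem mR_balanced₁ (X Y Z : RepU A) : X.actR ▷ (Y.obj ⊗ Z.obj) ≫ mR X Y Z =
    (α_ _ _ _).hom ≫ X.obj ◁ (α_ _ _ _).inv ≫ X.obj ◁ Y.act ▷ Z.obj ≫ mR X Y Z := by
  have h := m_linear Y Z
  rw [mR, ← whisker_exchange_assoc, m_balanced, associator_naturality_right_assoc,
    ← MonoidalCategory.whiskerLeft_comp_assoc, h]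
  simp

theorem mR_balanced₂ (X Y Z : RepU A) : X.obj ◁ Y.actR ▷ Z.obj ≫ mR X Y Z =
    X.obj ◁ (α_ _ _ _).hom ≫ X.obj ◁ Y.obj ◁ Z.act ≫ mR X Y Z := by
  rw [mR, ← MonoidalCategory.whiskerLeft_comp_assoc, m_balanced]
  simp

theorem mL_balanced₁ (X Y Z : RepU A) : X.actR ▷ Y.obj ▷ Z.obj ≫ mL X Y Z =
    (α_ _ _ _).hom ▷ Z.obj ≫ (X.obj ◁ Y.act) ▷ Z.obj ≫ mL X Y Z := by
  rw [mL, ← comp_whiskerRight_assoc, m_balanced]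
  simp

theorem mL_balanced₂ (X Y Z : RepU A) : (X.obj ◁ Y.actR) ▷ Z.obj ≫ mL X Y Z =
    (α_ _ _ _).inv ▷ Z.obj ≫ (α_ _ _ _).hom ≫ (X.obj ⊗ Y.obj) ◁ Z.act ≫ mL X Y Z := by
  have h := m_linearR X Y
  rw [← Iso.inv_comp_eq] at h
  rw [mL, whisker_exchange_assoc, ← associator_naturality_left_assoc, ← m_balanced,
    ← comp_whiskerRight_assoc, ← comp_whiskerRight_assoc, ← comp_whiskerRight_assoc, ← h]
  simp

theorem m_descR_assoc (X Y Z : RepU A) :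
    m X Y ▷ Z.obj ≫ descR X Y ((α_ _ _ _).hom ≫ mR X Y Z) = (α_ _ _ _).hom ≫ mR X Y Z := by
  apply m_descR
  rw [associator_naturality_left_assoc, mR_balanced₁]
  simp

theorem m_descL_assoc (X Y Z : RepU A) :
    X.obj ◁ m Y Z ≫ descL Y Z ((α_ _ _ _).inv ≫ mL X Y Z) = (α_ _ _ _).inv ≫ mL X Y Z := by
  apply m_descL
  rw [associator_inv_naturality_middle_assoc, mL_balanced₂]
  simp

/-- The associator of modules, as a morphism. -/
noncomputable def assocHom (X Y Z : RepU A) :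
    T.prod (T.prod X Y) Z ⟶ T.prod X (T.prod Y Z) :=
  desc (descR X Y ((α_ _ _ _).hom ≫ mR X Y Z))
    (by
      rw [← cancel_epi (m X Y ▷ A ▷ Z.obj), ← comp_whiskerRight_assoc, m_linearR,
        associator_naturality_left_assoc, ← whisker_exchange_assoc, m_descR_assoc,
        comp_whiskerRight, comp_whiskerRight, Category.assoc, Category.assoc, m_descR_assoc,
        associator_naturality_middle_assoc, mR_balanced₂]
      simp)
    (by
      rw [← cancel_epi (A ◁ m X Y ▷ Z.obj), ← MonoidalCategory.whiskerLeft_comp_assoc,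
        m_descR_assoc, associator_inv_naturality_middle_assoc, ← comp_whiskerRight_assoc, m_linear,
        comp_whiskerRight, comp_whiskerRight, Category.assoc, Category.assoc, m_descR_assoc,
        MonoidalCategory.whiskerLeft_comp, Category.assoc, mR_linear]
      simp)

theorem mL_assocHom (X Y Z : RepU A) :
    mL X Y Z ≫ (assocHom X Y Z).hom = (α_ _ _ _).hom ≫ mR X Y Z := by
  rw [mL, Category.assoc, assocHom, m_desc, m_descR_assoc]

/-- The inverse associator of modules, as a morphism. -/
noncomputable def assocInv (X Y Z : RepU A) :
    T.prod X (T.prod Y Z) ⟶ T.prod (T.prod X Y) Z :=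
  desc (descL Y Z ((α_ _ _ _).inv ≫ mL X Y Z))
    (by
      rw [← cancel_epi ((X.obj ⊗ A) ◁ m Y Z), whisker_exchange_assoc, m_descL_assoc,
        associator_naturality_right_assoc, ← MonoidalCategory.whiskerLeft_comp_assoc, m_linear,
        MonoidalCategory.whiskerLeft_comp, MonoidalCategory.whiskerLeft_comp,
        Category.assoc, Category.assoc, m_descL_assoc, associator_inv_naturality_left_assoc,
        mL_balanced₁]
      simp)
    (by
      rw [← cancel_epi (A ◁ X.obj ◁ m Y Z), ← MonoidalCategory.whiskerLeft_comp_assoc,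
        m_descL_assoc, associator_inv_naturality_right_assoc, whisker_exchange_assoc,
        m_descL_assoc, MonoidalCategory.whiskerLeft_comp, Category.assoc, mL_linear]
      simp)

theorem mR_assocInv (X Y Z : RepU A) :
    mR X Y Z ≫ (assocInv X Y Z).hom = (α_ _ _ _).inv ≫ mL X Y Z := by
  rw [mR, Category.assoc, assocInv, m_desc, m_descL_assoc]

instance (X Y Z : RepU A) : Epi (mL X Y Z) := by unfold mL; infer_instance

instance (X Y Z : RepU A) : Epi (mR X Y Z) := by unfold mR; infer_instance

/-- The associator of modules. -/
noncomputable def assocIso (X Y Z : RepU A) :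
    T.prod (T.prod X Y) Z ≅ T.prod X (T.prod Y Z) where
  hom := assocHom X Y Z
  inv := assocInv X Y Z
  hom_inv_id := hom_ext (by
    rw [← cancel_epi (mL X Y Z), comp_hom, ← Category.assoc, mL_assocHom, Category.assoc,
      mR_assocInv]
    simp)
  inv_hom_id := hom_ext (by
    rw [← cancel_epi (mR X Y Z), comp_hom, ← Category.assoc, mR_assocInv, Category.assoc,
      mL_assocHom]
    simp)

/-- The left unitor as a morphism, induced by the left action. -/
noncomputable def leftUnitorHom (X : RepU A) : T.prod unitObj X ⟶ X :=
  desc X.act (by rw [unit_actR]; exact X.assoc) (by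
    have := X.assoc
    rw [← Iso.inv_comp_eq] at this
    exact this.symm)

theorem m_leftUnitor (X : RepU A) : m unitObj X ≫ (leftUnitorHom X).hom = X.act :=
  m_desc _ _ _

/-- The left unitor. -/
noncomputable def leftUnitorIso (X : RepU A) : T.prod unitObj X ≅ X :=
  mkIso (leftUnitorHom X) ((λ_ X.obj).inv ≫ η[A] ▷ X.obj ≫ m unitObj X)
    (by
      have h : μ[A] ▷ X.obj ≫ m unitObj X = (α_ A A X.obj).hom ≫ A ◁ X.act ≫ m unitObj X := by
        have := m_balanced unitObj X
        rwa [unit_actR] at this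
      rw [← Iso.inv_comp_eq] at h
      have h1 : X.act ≫ (λ_ X.obj).inv ≫ η[A] ▷ X.obj ≫ m unitObj X =
          (λ_ _).inv ≫ η[A] ▷ (A ⊗ X.obj) ≫ A ◁ X.act ≫ m unitObj X := by
        rw [← whisker_exchange_assoc, ← leftUnitor_inv_naturality_assoc]
      have h2 := MonObj.one_mul A
      rw [← cancel_epi (m unitObj X), ← Category.assoc, m_leftUnitor, Category.comp_id, h1, ← h]
      rw [associator_inv_naturality_left_assoc, ← comp_whiskerRight_assoc, h2]
      simp)
    (by
      rw [Category.assoc, Category.assoc, m_leftUnitor, X.one_act]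
      simp)

/-- The right unitor as a morphism, induced by the right action. -/
noncomputable def rightUnitorHom (X : RepU A) : T.prod X unitObj ⟶ X :=
  desc X.actR X.bim.assocR (by
    have := X.actR_assocM
    rw [← Iso.inv_comp_eq] at this
    exact this.symm)

theorem m_rightUnitor (X : RepU A) : m X unitObj ≫ (rightUnitorHom X).hom = X.actR :=
  m_desc _ _ _

/-- The right unitor. -/
noncomputable def rightUnitorIso (X : RepU A) : T.prod X unitObj ≅ X :=
  mkIso (rightUnitorHom X) ((ρ_ X.obj).inv ≫ X.obj ◁ η[A] ≫ m X unitObj)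
    (by
      have h : X.actR ▷ A ≫ m X unitObj = (α_ X.obj A A).hom ≫ X.obj ◁ μ[A] ≫ m X unitObj :=
        m_balanced X unitObj
      have h1 : X.actR ≫ (ρ_ X.obj).inv ≫ X.obj ◁ η[A] ≫ m X unitObj =
          (ρ_ _).inv ≫ (X.obj ⊗ A) ◁ η[A] ≫ X.actR ▷ A ≫ m X unitObj := by
        rw [whisker_exchange_assoc, ← rightUnitor_inv_naturality_assoc]
      have h2 := MonObj.mul_one A
      rw [← cancel_epi (m X unitObj), ← Category.assoc, m_rightUnitor, Category.comp_id, h1, h]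
      rw [associator_naturality_right_assoc, ← MonoidalCategory.whiskerLeft_comp_assoc, h2]
      simp)
    (by
      have h : X.obj ◁ η[A] ≫ X.actR = (ρ_ X.obj).hom := X.bim.actR_one
      rw [Category.assoc, Category.assoc, m_rightUnitor, h]
      simp)

theorem m_wL (X : RepU A) {Y Y' : RepU A} (g : Y ⟶ Y') :
    m X Y ≫ (tensorMap (𝟙 X) g).hom = X.obj ◁ g.hom ≫ m X Y' := by
  simp [m_tensorMap]

theorem m_wR {X X' : RepU A} (f : X ⟶ X') (Y : RepU A) :
    m X Y ≫ (tensorMap f (𝟙 Y)).hom = f.hom ▷ Y.obj ≫ m X' Y := by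
  simp [m_tensorMap]

theorem prod_ext₃ {X Y Z W : RepU A} {f g : T.prod (T.prod X Y) Z ⟶ W}
    (h : mL X Y Z ≫ f.hom = mL X Y Z ≫ g.hom) : f = g :=
  hom_ext ((cancel_epi (mL X Y Z)).1 h)

theorem prod_ext₃' {X Y Z W : RepU A} {f g : T.prod X (T.prod Y Z) ⟶ W}
    (h : mR X Y Z ≫ f.hom = mR X Y Z ≫ g.hom) : f = g :=
  hom_ext ((cancel_epi (mR X Y Z)).1 h)

theorem mL_tensorMap {X X' Y Y' Z Z' : RepU A} (f : X ⟶ X') (g : Y ⟶ Y') (h : Z ⟶ Z') :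
    mL X Y Z ≫ (tensorMap (tensorMap f g) h).hom =
      ((f.hom ⊗ₘ g.hom) ⊗ₘ h.hom) ≫ mL X' Y' Z' := by
  rw [mL, Category.assoc, m_tensorMap, ← tensorHom_id,
    MonoidalCategory.tensorHom_comp_tensorHom_assoc, Category.id_comp, m_tensorMap, mL,
    ← tensorHom_id, MonoidalCategory.tensorHom_comp_tensorHom_assoc, Category.comp_id]

theorem mR_tensorMap {X X' Y Y' Z Z' : RepU A} (f : X ⟶ X') (g : Y ⟶ Y') (h : Z ⟶ Z') :
    mR X Y Z ≫ (tensorMap f (tensorMap g h)).hom =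
      (f.hom ⊗ₘ (g.hom ⊗ₘ h.hom)) ≫ mR X' Y' Z' := by
  rw [mR, Category.assoc, m_tensorMap, ← id_tensorHom,
    MonoidalCategory.tensorHom_comp_tensorHom_assoc, Category.id_comp, m_tensorMap, mR,
    ← id_tensorHom, MonoidalCategory.tensorHom_comp_tensorHom_assoc, Category.comp_id]

theorem pentagon_aux (W X Y Z : RepU A) :
    tensorMap (assocHom W X Y) (𝟙 Z) ≫ assocHom W (T.prod X Y) Z ≫
        tensorMap (𝟙 W) (assocHom X Y Z) =
      assocHom (T.prod W X) Y Z ≫ assocHom W X (T.prod Y Z) := by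
  apply hom_ext
  have hE : Epi (mL W X Y ▷ Z.obj ≫ m (T.prod (T.prod W X) Y) Z) := by
    unfold mL
    rw [comp_whiskerRight]
    infer_instance
  rw [← cancel_epi (mL W X Y ▷ Z.obj ≫ m (T.prod (T.prod W X) Y) Z)]
  have a₁ : mL W X Y ▷ Z.obj ≫ m (T.prod (T.prod W X) Y) Z ≫
      (tensorMap (assocHom W X Y) (𝟙 Z)).hom =
      (α_ _ _ _).hom ▷ Z.obj ≫ (W.obj ◁ m X Y) ▷ Z.obj ≫ mL W (T.prod X Y) Z := by
    rw [m_wR, ← comp_whiskerRight_assoc, mL_assocHom, mR, mL]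
    simp only [comp_whiskerRight, Category.assoc]
  have a₂ := mL_assocHom W (T.prod X Y) Z
  have a₃ : mR W (T.prod X Y) Z ≫ (tensorMap (𝟙 W) (assocHom X Y Z)).hom =
      W.obj ◁ (m (T.prod X Y) Z ≫ (assocHom X Y Z).hom) ≫ m W (T.prod X (T.prod Y Z)) := by
    rw [mR, Category.assoc, MonoidalCategory.whiskerLeft_comp, Category.assoc, m_wL]
  have a₄ : m X Y ▷ Z.obj ≫ m (T.prod X Y) Z ≫ (assocHom X Y Z).hom =
      (α_ _ _ _).hom ≫ mR X Y Z := by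
    have := mL_assocHom X Y Z
    rwa [mL, Category.assoc] at this
  have b₁ : mL W X Y ▷ Z.obj ≫ m (T.prod (T.prod W X) Y) Z =
      m W X ▷ Y.obj ▷ Z.obj ≫ mL (T.prod W X) Y Z := by
    simp only [mL, comp_whiskerRight, Category.assoc]
  have b₂ := mL_assocHom (T.prod W X) Y Z
  have b₃ : m W X ▷ (Y.obj ⊗ Z.obj) ≫ mR (T.prod W X) Y Z =
      (W.obj ⊗ X.obj) ◁ m Y Z ≫ mL W X (T.prod Y Z) := by
    rw [mL, mR, whisker_exchange_assoc]
  have b₄ := mL_assocHom W X (T.prod Y Z)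
  have hl : (mL W X Y ▷ Z.obj ≫ m (T.prod (T.prod W X) Y) Z) ≫
      (tensorMap (assocHom W X Y) (𝟙 Z) ≫ assocHom W (T.prod X Y) Z ≫
        tensorMap (𝟙 W) (assocHom X Y Z)).hom =
      (α_ _ _ _).hom ≫ (α_ _ _ _).hom ≫ W.obj ◁ mR X Y Z ≫ m W (T.prod X (T.prod Y Z)) := by
    rw [comp_hom, comp_hom, Category.assoc, reassoc_of% a₁, reassoc_of% a₂, a₃,
      associator_naturality_middle_assoc, ← MonoidalCategory.whiskerLeft_comp_assoc, a₄,
      MonoidalCategory.whiskerLeft_comp, Category.assoc, MonoidalCategory.pentagon_assoc]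
  rw [hl, comp_hom, b₁, Category.assoc, reassoc_of% b₂, associator_naturality_left_assoc,
    reassoc_of% b₃, b₄, associator_naturality_right_assoc, mR, mR,
    MonoidalCategory.whiskerLeft_comp, Category.assoc]

theorem triangle_aux (X Y : RepU A) :
    assocHom X unitObj Y ≫ tensorMap (𝟙 X) (leftUnitorHom Y) =
      tensorMap (rightUnitorHom X) (𝟙 Y) := by
  apply prod_ext₃
  have a₁ := mL_assocHom X unitObj Y
  have a₂ : mR X unitObj Y ≫ (tensorMap (𝟙 X) (leftUnitorHom Y)).hom =
      X.obj ◁ Y.act ≫ m X Y := by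
    rw [mR, Category.assoc, m_wL, ← MonoidalCategory.whiskerLeft_comp_assoc, m_leftUnitor]
  have a₃ : mL X unitObj Y ≫ (tensorMap (rightUnitorHom X) (𝟙 Y)).hom =
      X.actR ▷ Y.obj ≫ m X Y := by
    rw [mL, Category.assoc, m_wR, ← comp_whiskerRight_assoc, m_rightUnitor]
  rw [a₃, comp_hom, reassoc_of% a₁, a₂, m_balanced]

/-- The tensor category of single-valued unitary left modules. -/
noncomputable instance : MonoidalCategory (RepU A) where
  tensorObj X Y := T.prod X Y
  whiskerLeft X _ _ f := tensorMap (𝟙 X) f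
  whiskerRight f Y := tensorMap f (𝟙 Y)
  tensorHom f g := tensorMap f g
  tensorUnit := unitObj
  associator X Y Z := assocIso X Y Z
  leftUnitor X := leftUnitorIso X
  rightUnitor X := rightUnitorIso X
  tensorHom_def f g := prod_ext (by
    rw [comp_hom, reassoc_of% (m_wR f), m_wL, m_tensorMap, MonoidalCategory.tensorHom_def,
      Category.assoc])
  id_tensorHom_id X Y := prod_ext (by simp [m_tensorMap])
  tensorHom_comp_tensorHom f f' g g' := prod_ext (by
    rw [comp_hom, reassoc_of% (m_tensorMap f f'), m_tensorMap, m_tensorMap]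
    simp)
  whiskerLeft_id X Y := prod_ext (by simp [m_tensorMap])
  id_whiskerRight X Y := prod_ext (by simp [m_tensorMap])
  associator_naturality {X Y Z X' Y' Z'} f g h := prod_ext₃ (by
    have e₃ := mL_assocHom X Y Z
    have e₄ := mL_assocHom X' Y' Z'
    change _ ≫ _ ≫ (assocHom X' Y' Z').hom = _ ≫ (assocHom X Y Z).hom ≫ _
    rw [reassoc_of% (mL_tensorMap f g h), reassoc_of% e₃, mR_tensorMap, e₄,
      MonoidalCategory.associator_naturality_assoc])
  leftUnitor_naturality {X Y} f := prod_ext (by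
    have e₂ := m_leftUnitor X
    change _ ≫ _ ≫ (leftUnitorHom Y).hom = _ ≫ (leftUnitorHom X).hom ≫ _
    rw [reassoc_of% (m_wL unitObj f), reassoc_of% e₂, m_leftUnitor]
    exact f.comm)
  rightUnitor_naturality {X Y} f := prod_ext (by
    have e₂ := m_rightUnitor X
    have e₄ : f.hom ▷ A ≫ Y.actR = X.actR ≫ f.hom := by simp [actR, f.comm]
    change _ ≫ _ ≫ (rightUnitorHom Y).hom = _ ≫ (rightUnitorHom X).hom ≫ _
    rw [reassoc_of% (m_wR f unitObj), reassoc_of% e₂, m_rightUnitor]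
    exact e₄)
  pentagon W X Y Z := pentagon_aux W X Y Z
  triangle X Y := triangle_aux X Y

/-! The braiding -/

theorem m_balanced' (X Y : RepU A) : X.obj ◁ Y.act ≫ m X Y =
    (α_ X.obj A Y.obj).inv ≫ X.actR ▷ Y.obj ≫ m X Y := by
  rw [m_balanced, Iso.inv_hom_id_assoc]

theorem braiding_actR (X : RepU A) : (β_ A X.obj).hom ≫ X.actR = X.act := X.singleValued

theorem actR_eq (X : RepU A) : X.actR = (β_ A X.obj).inv ≫ X.act := by
  rw [← braiding_actR, Iso.inv_hom_id_assoc]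

theorem yb (X Y Z : C) : (α_ X Y Z).inv ≫ (β_ X Y).hom ▷ Z ≫ (β_ (Y ⊗ X) Z).hom =
    X ◁ (β_ Y Z).hom ≫ (β_ X (Z ⊗ Y)).hom ≫ (α_ Z Y X).hom := by
  simp only [BraidedCategory.braiding_tensor_left_hom, BraidedCategory.braiding_tensor_right_hom,
    Category.assoc, Iso.inv_hom_id, Category.comp_id]
  exact BraidedCategory.yang_baxter X Y Z

theorem braiding_balanced (X Y : RepU A) : X.actR ▷ Y.obj ≫ (β_ X.obj Y.obj).hom ≫ m Y X =
    (α_ X.obj A Y.obj).hom ≫ X.obj ◁ Y.act ≫ (β_ X.obj Y.obj).hom ≫ m Y X := by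
  have h := yb X.obj A Y.obj
  rw [Iso.inv_comp_eq] at h
  rw [BraidedCategory.braiding_naturality_left_assoc,
    BraidedCategory.braiding_naturality_right_assoc, actR, MonoidalCategory.whiskerLeft_comp,
    Category.assoc, m_balanced', ← BraidedCategory.braiding_naturality_left_assoc, reassoc_of% h,
    Iso.hom_inv_id_assoc, ← BraidedCategory.braiding_naturality_right_assoc,
    ← BraidedCategory.braiding_naturality_right_assoc,
    ← MonoidalCategory.whiskerLeft_comp_assoc, braiding_actR]

theorem braiding_linear (X Y : RepU A) :
    A ◁ ((β_ X.obj Y.obj).hom ≫ m Y X) ≫ (T.prod Y X).act =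
      (α_ A X.obj Y.obj).inv ≫ X.act ▷ Y.obj ≫ (β_ X.obj Y.obj).hom ≫ m Y X := by
  rw [MonoidalCategory.whiskerLeft_comp, Category.assoc, m_linear,
    BraidedCategory.braiding_naturality_left_assoc, m_balanced',
    BraidedCategory.braiding_tensor_left_hom]
  simp only [Category.assoc, Iso.inv_hom_id_assoc, Iso.hom_inv_id_assoc]
  rw [← comp_whiskerRight_assoc (β_ A Y.obj).hom, braiding_actR]

theorem braiding_inv_balanced (X Y : RepU A) :
    Y.actR ▷ X.obj ≫ (β_ X.obj Y.obj).inv ≫ m X Y =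
      (α_ Y.obj A X.obj).hom ≫ Y.obj ◁ X.act ≫ (β_ X.obj Y.obj).inv ≫ m X Y := by
  have h := yb X.obj A Y.obj
  rw [BraidedCategory.braiding_inv_naturality_left_assoc,
    BraidedCategory.braiding_inv_naturality_right_assoc, actR_eq,
    MonoidalCategory.whiskerLeft_comp, Category.assoc, m_balanced']
  rw [← cancel_epi (X.obj ◁ (β_ A Y.obj).hom ≫ (β_ X.obj (Y.obj ⊗ A)).hom)]
  simp only [Category.assoc]
  rw [← reassoc_of% h, Iso.hom_inv_id_assoc, Iso.hom_inv_id_assoc, actR, comp_whiskerRight]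
  simp

/-- The braiding of modules, as a morphism. -/
noncomputable def braidHom (X Y : RepU A) : T.prod X Y ⟶ T.prod Y X :=
  desc ((β_ X.obj Y.obj).hom ≫ m Y X) (braiding_balanced X Y) (braiding_linear X Y)

theorem m_braidHom (X Y : RepU A) :
    m X Y ≫ (braidHom X Y).hom = (β_ X.obj Y.obj).hom ≫ m Y X := m_desc _ _ _

/-- The braiding of modules. -/
noncomputable def braidIso (X Y : RepU A) : T.prod X Y ≅ T.prod Y X :=
  mkIso (braidHom X Y) ((dA A)⁻¹ • (dag (m Y X) ≫ (β_ X.obj Y.obj).inv ≫ m X Y))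
    (by
      rw [← cancel_epi (m X Y), reassoc_of% (m_braidHom X Y), Linear.comp_smul, Linear.comp_smul,
        m_dag_balanced Y X _ (braiding_inv_balanced X Y)]
      simp [smul_smul, inv_mul_cancel₀ (dA_ne (A := A))])
    (by
      rw [← cancel_epi (m Y X), Linear.smul_comp, Linear.comp_smul, Category.assoc,
        Category.assoc, m_braidHom, Iso.inv_hom_id_assoc, m_dag_balanced Y X _ (m_balanced Y X)]
      simp [smul_smul, inv_mul_cancel₀ (dA_ne (A := A))])

theorem braid_natural {X X' Y Y' : RepU A} (f : X ⟶ X') (g : Y ⟶ Y') :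
    tensorMap f g ≫ braidHom X' Y' = braidHom X Y ≫ tensorMap g f := by
  apply prod_ext
  rw [comp_hom, comp_hom, reassoc_of% (m_tensorMap f g), reassoc_of% (m_braidHom X Y),
    m_braidHom, m_tensorMap, BraidedCategory.braiding_naturality_assoc]

theorem hexagon_aux (X Y Z : RepU A) :
    assocHom X Y Z ≫ braidHom X (T.prod Y Z) ≫ assocHom Y Z X =
      tensorMap (braidHom X Y) (𝟙 Z) ≫ assocHom Y X Z ≫ tensorMap (𝟙 Y) (braidHom X Z) := by
  apply prod_ext₃
  have a₁ := mL_assocHom X Y Z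
  have a₂ : mR X Y Z ≫ (braidHom X (T.prod Y Z)).hom =
      (β_ X.obj (Y.obj ⊗ Z.obj)).hom ≫ mL Y Z X := by
    rw [mR, Category.assoc, m_braidHom, BraidedCategory.braiding_naturality_right_assoc, mL]
  have a₃ := mL_assocHom Y Z X
  have b₁ : mL X Y Z ≫ (tensorMap (braidHom X Y) (𝟙 Z)).hom =
      (β_ X.obj Y.obj).hom ▷ Z.obj ≫ mL Y X Z := by
    rw [mL, Category.assoc, m_wR, ← comp_whiskerRight_assoc, m_braidHom, mL, comp_whiskerRight,
      Category.assoc]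
  have b₂ := mL_assocHom Y X Z
  have b₃ : mR Y X Z ≫ (tensorMap (𝟙 Y) (braidHom X Z)).hom =
      Y.obj ◁ (β_ X.obj Z.obj).hom ≫ mR Y Z X := by
    rw [mR, Category.assoc, m_wL, ← MonoidalCategory.whiskerLeft_comp_assoc, m_braidHom, mR,
      MonoidalCategory.whiskerLeft_comp, Category.assoc]
  simp only [comp_hom]
  rw [reassoc_of% a₁, reassoc_of% a₂, a₃, reassoc_of% b₁, reassoc_of% b₂, b₃,
    BraidedCategory.hexagon_forward_assoc]

theorem hexagon_aux' (X Y Z : RepU A) :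
    assocInv X Y Z ≫ braidHom (T.prod X Y) Z ≫ assocInv Z X Y =
      tensorMap (𝟙 X) (braidHom Y Z) ≫ assocInv X Z Y ≫ tensorMap (braidHom X Z) (𝟙 Y) := by
  apply prod_ext₃'
  have a₁ := mR_assocInv X Y Z
  have a₂ : mL X Y Z ≫ (braidHom (T.prod X Y) Z).hom =
      (β_ (X.obj ⊗ Y.obj) Z.obj).hom ≫ mR Z X Y := by
    rw [mL, Category.assoc, m_braidHom, BraidedCategory.braiding_naturality_left_assoc, mR]
  have a₃ := mR_assocInv Z X Y
  have b₁ : mR X Y Z ≫ (tensorMap (𝟙 X) (braidHom Y Z)).hom =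
      X.obj ◁ (β_ Y.obj Z.obj).hom ≫ mR X Z Y := by
    rw [mR, Category.assoc, m_wL, ← MonoidalCategory.whiskerLeft_comp_assoc, m_braidHom, mR,
      MonoidalCategory.whiskerLeft_comp, Category.assoc]
  have b₂ := mR_assocInv X Z Y
  have b₃ : mL X Z Y ≫ (tensorMap (braidHom X Z) (𝟙 Y)).hom =
      (β_ X.obj Z.obj).hom ▷ Y.obj ≫ mL Z X Y := by
    rw [mL, Category.assoc, m_wR, ← comp_whiskerRight_assoc, m_braidHom, mL, comp_whiskerRight,
      Category.assoc]
  simp only [comp_hom]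
  rw [reassoc_of% a₁, reassoc_of% a₂, a₃, reassoc_of% b₁, reassoc_of% b₂, b₃,
    BraidedCategory.hexagon_reverse_assoc]

/-- The braided tensor category of single-valued unitary left modules. -/
noncomputable instance : BraidedCategory (RepU A) where
  braiding X Y := braidIso X Y
  braiding_naturality_right X _ _ f := braid_natural (𝟙 X) f
  braiding_naturality_left f Z := braid_natural f (𝟙 Z)
  hexagon_forward X Y Z := hexagon_aux X Y Z
  hexagon_reverse X Y Z := hexagon_aux' X Y Z

end RepU
end Tensor
end CStarRep

open CStarRep

/-! Tensor products come from splitting a projection. For single-valued modules `X` and `Y`, the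
endomorphism `balancing X Y` of `X ⊗ Y` creates two `A`-strands and lets `X` and `Y` absorb one
each. It is selfadjoint, linear over `A`, and `d` times a projection, where `μ μ* = d`. Its image,
with the projection onto it rescaled by `√d`, is the unitary tensor product. As `m* m = d`, the
structure morphisms of `RepU A` are, up to a power of `d`, those of `C` sandwiched between `m*` and
`m`, so their unitarity is inherited. Hom spaces of a rigid C*-tensor category with simple unit are
finite-dimensional (`orthonormal_card_le`), so completeness is automatic, and the spectral theorem
in the star algebra of module endomorphisms supplies square roots there.

Rigidity: a dual of `X` in `C` carries the transposed action. Sliding strands around the evaluation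
shows that it is again single-valued (`braiding_action_eq`), and conjugating by the square root of a
positive operator makes it unitary (`exists_unitarization`). Letting the dual emit an `A`-strand
turns the evaluation of `C` into one of modules.

Twists: standard pairings exist (rescale on simple objects, then add up) and are unique up to a
unitary (`IsStandard.comparison`). The adjoint and the braided swap of a standard pairing are both
standard, and the unitary comparing them is the canonical twist. A pairing of modules restricts to
one in `C`, and its left and right traces in `C` are the same multiple of the module traces of a
conditional expectation (`trL_restrictPairing`, `trR_restrictPairing`). Hence standard pairings
restrict to standard ones, the twist relation restricts with them, and the two canonical twists
agree.

Modularity: let `hopf` be the trace of the monodromy. Local induction sends `V` to the single-valued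
part `N` of the free module `A ⊗ V`, and `hopf_localInduction` identifies `hopf X N`, up to a fixed
factor, with `hopf X V` in `C`. Every nonzero module receives a nonzero morphism from some module
induced from a simple object, so there are finitely many simple modules. Inverting the S-matrix of
`C` gives a linear combination of functions `hopf W i` that is nonzero exactly on objects containing
the unit. Since `Hom_A(A, X) = Hom(𝟙, X)`, the induced modules give such a combination for `RepU A`.
Such a detector forces the S-matrix to be invertible: if `x` lies in its kernel, tensoring with a
dual of `S k` and multiplicativity of `hopf` isolate the coordinate `x k`. -/

namespace CStarRep

open scoped MonObj ComplexOrder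

open StarCategory

/-! ### Finite-dimensional star algebras with a faithful positive functional -/

section StarAlgebra

variable {R : Type*} [Ring R] [Algebra ℂ R] [StarRing R] [StarModule ℂ R]

/-- Faithful positive functionals on a star algebra. -/
structure IsFaithfulPositive (φ : R →ₗ[ℂ] ℂ) : Prop where
  nonneg : ∀ a, 0 ≤ φ (star a * a)
  faithful : ∀ a, φ (star a * a) = 0 → a = 0

theorem IsFaithfulPositive.conj_apply {φ : R →ₗ[ℂ] ℂ} (hφ : IsFaithfulPositive φ) (a b : R) :
    (starRingEnd ℂ) (φ (star a * b)) = φ (star b * a) := by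
  -- Polarization: the choice `c = 1` compares the imaginary parts of the two sides, `c = I` the
  -- real parts.
  have key : ∀ c : ℂ, (φ (star (a + c • b) * (a + c • b))).im = 0 := fun c =>
    ((Complex.nonneg_iff.1 (hφ.nonneg (a + c • b))).2).symm
  have ha := ((Complex.nonneg_iff.1 (hφ.nonneg a)).2).symm
  have hb := ((Complex.nonneg_iff.1 (hφ.nonneg b)).2).symm
  have h1 := key 1
  have h2 := key Complex.I
  simp only [star_add, star_smul, add_mul, mul_add, map_add, smul_mul_assoc, mul_smul_comm,
    map_smul, smul_eq_mul, Complex.add_im, Complex.mul_im, Complex.mul_re, Complex.star_def,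
    Complex.conj_re, Complex.conj_im, Complex.one_re, Complex.one_im, Complex.I_re,
    Complex.I_im, ha, hb] at h1 h2
  apply Complex.ext
  · simp only [Complex.conj_re]
    linarith
  · simp only [Complex.conj_im]
    linarith

/-- The inner product `⟨a, b⟩ = φ (a* b)`. -/
abbrev IsFaithfulPositive.core {φ : R →ₗ[ℂ] ℂ} (hφ : IsFaithfulPositive φ) :
    InnerProductSpace.Core ℂ R where
  inner a b := φ (star a * b)
  conj_inner_symm a b := hφ.conj_apply b a
  re_inner_nonneg a := (Complex.nonneg_iff.1 (hφ.nonneg a)).1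
  add_left a b c := by simp [add_mul]
  smul_left a b c := by simp
  definite a h := hφ.faithful a h

open Polynomial in
theorem star_aeval_ofReal {h : R} (hh : star h = h) (q : ℝ[X]) :
    star (aeval h (q.map (algebraMap ℝ ℂ))) = aeval h (q.map (algebraMap ℝ ℂ)) := by
  induction q using Polynomial.induction_on' with
  | add p q hp hq => rw [Polynomial.map_add, map_add, star_add, hp, hq]
  | monomial n a => simp [Polynomial.map_monomial, Polynomial.aeval_monomial, hh,
      Algebra.algebraMap_eq_smul_one]

open Polynomial in
/-- The spectral theorem for selfadjoint elements. -/
theorem IsFaithfulPositive.spectral [FiniteDimensional ℂ R] {φ : R →ₗ[ℂ] ℂ}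
    (hφ : IsFaithfulPositive φ) {h : R} (hh : star h = h) :
    ∃ (Λ : Finset ℝ) (e : ℝ → R), (∀ l ∈ Λ, e l ≠ 0) ∧ (∀ l ∈ Λ, star (e l) = e l) ∧
      (∀ l ∈ Λ, e l * e l = e l) ∧ (∀ l ∈ Λ, ∀ m ∈ Λ, l ≠ m → e l * e m = 0) ∧
      ∑ l ∈ Λ, e l = 1 ∧ h = ∑ l ∈ Λ, (l : ℂ) • e l := by
  let := hφ.core
  let : NormedAddCommGroup R := hφ.core.toNormedAddCommGroup
  let : InnerProductSpace ℂ R := InnerProductSpace.ofCore hφ.core.toCore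
  classical
  -- Left multiplication by `h` is symmetric for the inner product `φ (a* b)`, hence diagonalizable
  -- with real eigenvalues.
  set T : R →ₗ[ℂ] R := Algebra.lmul ℂ R h with hT
  have hTs : T.IsSymmetric := by
    intro a b
    change φ (star (h * a) * b) = φ (star a * (h * b))
    simp [hh, mul_assoc]
  let n := Module.finrank ℂ R
  let b := (hTs.eigenvectorBasis (n := n) rfl)
  let ev : Fin n → ℝ := hTs.eigenvalues rfl
  let Λ : Finset ℝ := Finset.univ.image ev
  have hvec : ∀ (q : ℝ[X]) i, aeval h (q.map (algebraMap ℝ ℂ)) * b i = ((q.eval (ev i) : ℝ) : ℂ) • b i := by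
    intro q i
    have h1 : (aeval T (q.map (algebraMap ℝ ℂ))) (b i) =
        aeval h (q.map (algebraMap ℝ ℂ)) * b i := by
      rw [hT, Polynomial.aeval_algHom_apply]; rfl
    rw [← h1, Module.End.aeval_apply_of_hasEigenvector
      (hTs.hasEigenvector_eigenvectorBasis rfl i)]
    have : (Polynomial.eval ((ev i : ℝ) : ℂ) (q.map (algebraMap ℝ ℂ))) =
      ((q.eval (ev i) : ℝ) : ℂ) := by
      have := Polynomial.eval_map_algebraMap (B := ℂ) q ((ev i : ℝ) : ℂ)
      rw [this]
      exact Polynomial.aeval_algebraMap_apply ℂ (ev i) q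
    rw [← this]; rfl
  -- A polynomial in `h` depends only on its values at the eigenvalues: the eigenvectors form a
  -- basis, and an element is recovered from its left multiplication by applying it to `1`.
  have hext : ∀ q r : ℝ[X], (∀ l ∈ Λ, q.eval l = r.eval l) →
      aeval h (q.map (algebraMap ℝ ℂ)) = aeval h (r.map (algebraMap ℝ ℂ)) := by
    intro q r hqr
    have : LinearMap.mulLeft ℂ (aeval h (q.map (algebraMap ℝ ℂ))) =
        LinearMap.mulLeft ℂ (aeval h (r.map (algebraMap ℝ ℂ))) := by
      apply b.toBasis.ext
      intro i
      simp only [OrthonormalBasis.coe_toBasis, LinearMap.mulLeft_apply]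
      rw [hvec, hvec, hqr (ev i) (Finset.mem_image_of_mem _ (Finset.mem_univ _))]
    simpa using congrArg (fun f => f 1) this
  -- The eigenprojections are the Lagrange interpolation polynomials evaluated at `h`; every
  -- required identity becomes an identity of polynomial values on `Λ`.
  refine ⟨Λ, fun l => aeval h ((Lagrange.basis Λ id l).map (algebraMap ℝ ℂ)), ?_, ?_, ?_, ?_, ?_, ?_⟩
  · intro l hl h0
    beta_reduce at h0
    obtain ⟨i, -, hi⟩ := Finset.mem_image.1 hl
    have h1 := hvec (Lagrange.basis Λ id l) i
    have h2 : (Lagrange.basis Λ id l).eval (ev i) = 1 := by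
      rw [hi]; exact Lagrange.eval_basis_self (Function.injective_id.injOn) hl
    rw [h0, h2] at h1
    simp only [zero_mul, Complex.ofReal_one, one_smul] at h1
    exact b.orthonormal.ne_zero i h1.symm
  · intro l _
    exact star_aeval_ofReal hh _
  · intro l hl
    rw [← map_mul, ← Polynomial.map_mul]
    apply hext
    intro m hm
    rw [eval_mul]
    by_cases hlm : l = m
    · subst hlm
      have := Lagrange.eval_basis_self (v := id) (Function.injective_id.injOn) hl
      simp only [id] at this
      rw [this]; norm_num
    · have := Lagrange.eval_basis_of_ne (v := id) hlm hm
      simp only [id] at this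
      rw [this]; norm_num
  · intro l hl m hm hlm
    rw [← map_mul, ← Polynomial.map_mul]
    have h0 : (0 : R) = aeval h ((0 : ℝ[X]).map (algebraMap ℝ ℂ)) := by simp
    rw [h0]
    apply hext
    intro k hk
    rw [eval_mul, eval_zero]
    by_cases hlk : l = k
    · have := Lagrange.eval_basis_of_ne (v := id) (hlk ▸ hlm.symm) hk
      simp only [id] at this
      rw [this]; norm_num
    · have := Lagrange.eval_basis_of_ne (v := id) hlk hk
      simp only [id] at this
      rw [this]; norm_num
  · rw [← map_sum, ← Polynomial.map_sum]
    have h0 : (1 : R) = aeval h ((1 : ℝ[X]).map (algebraMap ℝ ℂ)) := by simp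
    rw [h0]
    apply hext
    intro k hk
    rw [Lagrange.sum_basis (Function.injective_id.injOn) ⟨k, hk⟩]
  · have h0 : h = aeval h ((X : ℝ[X]).map (algebraMap ℝ ℂ)) := by simp
    have h1 : ∑ l ∈ Λ, (l : ℂ) • aeval h ((Lagrange.basis Λ id l).map (algebraMap ℝ ℂ)) =
        aeval h ((∑ l ∈ Λ, C l * Lagrange.basis Λ id l).map (algebraMap ℝ ℂ)) := by
      rw [Polynomial.map_sum, map_sum]
      refine Finset.sum_congr rfl fun l _ => ?_
      rw [Polynomial.map_mul, map_mul, Polynomial.map_C, aeval_C, Algebra.smul_def]; rfl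
    rw [h1]
    conv_lhs => rw [h0]
    apply hext
    intro k hk
    rw [eval_X, eval_finsetSum, Finset.sum_eq_single k]
    · have := Lagrange.eval_basis_self (v := id) (Function.injective_id.injOn) hk
      simp only [id] at this
      rw [eval_mul, eval_C, this, mul_one]
    · intro l _ hlk
      have := Lagrange.eval_basis_of_ne (v := id) hlk hk
      simp only [id] at this
      rw [eval_mul, this, mul_zero]
    · exact fun h => absurd hk h

/-- Square roots of positive elements. -/
theorem IsFaithfulPositive.exists_sqrt [FiniteDimensional ℂ R] {φ : R →ₗ[ℂ] ℂ}
    (hφ : IsFaithfulPositive φ) {h : R} (hh : star h = h)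
    (hp : ∀ a, 0 ≤ φ (star a * h * a)) : ∃ g : R, star g = g ∧ g * g = h := by
  obtain ⟨Λ, e, he0, hes, hei, heo, h1, hsum⟩ := hφ.spectral hh
  have hmul : ∀ l ∈ Λ, h * e l = (l : ℂ) • e l := by
    intro l hl
    rw [hsum, Finset.sum_mul, Finset.sum_eq_single l]
    · rw [smul_mul_assoc, hei l hl]
    · intro m hm hml
      rw [smul_mul_assoc, heo m hm l hl hml, smul_zero]
    · exact fun h => absurd hl h
  -- Positivity is tested on the eigenprojection itself: `φ (e* h e) = l φ (e* e)`, and the last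
  -- factor is strictly positive by faithfulness.
  have hpos : ∀ l ∈ Λ, 0 ≤ l := by
    intro l hl
    have h2 := hp (e l)
    rw [mul_assoc, hmul l hl, mul_smul_comm, map_smul, smul_eq_mul] at h2
    have h3 := hφ.nonneg (e l)
    have h4 : φ (star (e l) * e l) ≠ 0 := fun h => he0 l hl (hφ.faithful _ h)
    obtain ⟨r, hr⟩ : ∃ r : ℝ, φ (star (e l) * e l) = r :=
      ⟨_, (Complex.ext rfl (by simpa using (Complex.nonneg_iff.1 h3).2.symm))⟩
    rw [hr] at h2 h3 h4
    have h5 : 0 ≤ l * r := by exact_mod_cast h2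
    have h6 : 0 ≤ r := by exact_mod_cast h3
    have h7 : r ≠ 0 := by exact_mod_cast h4
    exact nonneg_of_mul_nonneg_left h5 (lt_of_le_of_ne h6 h7.symm)
  refine ⟨∑ l ∈ Λ, ((Real.sqrt l : ℝ) : ℂ) • e l, ?_, ?_⟩
  · rw [star_sum]
    refine Finset.sum_congr rfl fun l hl => ?_
    rw [star_smul, hes l hl]; simp
  · rw [hsum, Finset.sum_mul]
    refine Finset.sum_congr rfl fun l hl => ?_
    rw [Finset.mul_sum, Finset.sum_eq_single l]
    · rw [smul_mul_smul_comm, hei l hl, ← Complex.ofReal_mul, Real.mul_self_sqrt (hpos l hl)]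
    · intro m hm hml
      rw [smul_mul_smul_comm, heo l hl m hm hml.symm, smul_zero]
    · exact fun h => absurd hl h

/-- Every element is a linear combination of selfadjoint idempotents. -/
theorem IsFaithfulPositive.mem_span_projections [FiniteDimensional ℂ R] {φ : R →ₗ[ℂ] ℂ}
    (hφ : IsFaithfulPositive φ) (a : R) :
    a ∈ Submodule.span ℂ {e : R | star e = e ∧ e * e = e} := by
  have hsa : ∀ h : R, star h = h → h ∈ Submodule.span ℂ {e : R | star e = e ∧ e * e = e} := by
    intro h hh
    obtain ⟨Λ, e, he0, hes, hei, heo, h1, hsum⟩ := hφ.spectral hh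
    rw [hsum]
    exact Submodule.sum_mem _ fun l hl => Submodule.smul_mem _ _
      (Submodule.subset_span ⟨hes l hl, hei l hl⟩)
  have h1 := hsa (a + star a) (by rw [star_add, star_star, add_comm])
  have h2 := hsa (Complex.I • (a - star a)) (by
    rw [star_smul, star_sub, star_star, Complex.star_def, Complex.conj_I, neg_smul, ← smul_neg,
      neg_sub])
  have h3 : a = (2⁻¹ : ℂ) • (a + star a) + (-(2⁻¹ : ℂ) * Complex.I) • (Complex.I • (a - star a)) := by
    rw [smul_smul, mul_assoc, Complex.I_mul_I]
    have : a = ((2⁻¹ : ℂ) + 2⁻¹) • a := by norm_num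
    conv_lhs => rw [this]
    rw [mul_neg, mul_one, neg_neg, smul_add, smul_sub, add_smul]; abel
  rw [h3]
  exact Submodule.add_mem _ (Submodule.smul_mem _ _ h1) (Submodule.smul_mem _ _ h2)

/-- An algebra of dimension greater than one has a nontrivial selfadjoint idempotent. -/
theorem IsFaithfulPositive.exists_projection [FiniteDimensional ℂ R] {φ : R →ₗ[ℂ] ℂ}
    (hφ : IsFaithfulPositive φ) (hR : 1 < Module.finrank ℂ R) :
    ∃ e : R, star e = e ∧ e * e = e ∧ e ≠ 0 ∧ e ≠ 1 := by
  by_contra! hne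
  have hle : Submodule.span ℂ {e : R | star e = e ∧ e * e = e} ≤ Submodule.span ℂ {(1 : R)} := by
    rw [Submodule.span_le]
    rintro e ⟨h1, h2⟩
    by_cases h0 : e = 0
    · rw [h0]; exact Submodule.zero_mem _
    · rw [hne e h1 h2 h0]; exact Submodule.mem_span_singleton_self _
  have htop : Submodule.span ℂ {(1 : R)} = ⊤ :=
    top_le_iff.1 fun a _ => hle (hφ.mem_span_projections a)
  have h1 := finrank_span_le_card (R := ℂ) ({(1 : R)} : Set R)
  rw [htop, finrank_top] at h1
  simp at h1
  omega

end StarAlgebra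

/-! ### The involution -/

section Dag

variable {C : Type u} [Category.{v} C] [Preadditive C] [Linear ℂ C] [StarCategory C]

@[simp] theorem dag_id (X : C) : dag (𝟙 X) = 𝟙 X := by
  have h : dag (dag (𝟙 X)) = dag (𝟙 X ≫ dag (𝟙 X)) := by rw [Category.id_comp]
  rw [dag_comp, dag_dag, Category.id_comp] at h
  exact h.symm

/-- The involution as an additive map. -/
def dagHom (X Y : C) : (X ⟶ Y) →+ (Y ⟶ X) := AddMonoidHom.mk' dag dag_add

@[simp] theorem dag_zero (X Y : C) : dag (0 : X ⟶ Y) = 0 := map_zero (dagHom X Y)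

theorem dag_sub {X Y : C} (f g : X ⟶ Y) : dag (f - g) = dag f - dag g :=
  map_sub (dagHom X Y) f g

theorem dag_sum {J : Type*} (s : Finset J) {X Y : C} (f : J → (X ⟶ Y)) :
    dag (∑ i ∈ s, f i) = ∑ i ∈ s, dag (f i) := map_sum (dagHom X Y) f s

/-- The star ring structure of `End X`. -/
abbrev endStarRing (X : C) : StarRing (End X) where
  star f := (dag f : X ⟶ X)
  star_involutive f := dag_dag f
  star_mul f g := dag_comp g f
  star_add f g := dag_add f g

theorem endStarModule (X : C) : letI := endStarRing X; StarModule ℂ (End X) :=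
  letI := endStarRing X
  ⟨fun c f => dag_smul c f⟩

/-- Faithful positive functionals on the endomorphisms of an object. -/
structure IsFaithfulState {X : C} (φ : (X ⟶ X) →ₗ[ℂ] ℂ) : Prop where
  nonneg : ∀ a : X ⟶ X, 0 ≤ φ (a ≫ dag a)
  faithful : ∀ a : X ⟶ X, φ (a ≫ dag a) = 0 → a = 0

variable {X : C} {φ : (X ⟶ X) →ₗ[ℂ] ℂ} [FiniteDimensional ℂ (X ⟶ X)]

/-- Multiplication in `End X` is composition in reversed order, so `a ≫ dag a` is `star a * a` and
the algebraic results transfer without change. -/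
theorem IsFaithfulState.exists_sqrt (hφ : IsFaithfulState φ) {h : X ⟶ X} (hh : dag h = h)
    (hp : ∀ a : X ⟶ X, 0 ≤ φ (a ≫ h ≫ dag a)) : ∃ g : X ⟶ X, dag g = g ∧ g ≫ g = h := by
  let := endStarRing X
  have := endStarModule X
  have : FiniteDimensional ℂ (End X) := ‹FiniteDimensional ℂ (X ⟶ X)›
  let ψ : End X →ₗ[ℂ] ℂ := φ
  have hψ : IsFaithfulPositive ψ := ⟨hφ.nonneg, hφ.faithful⟩
  obtain ⟨g, h1, h2⟩ := hψ.exists_sqrt (h := (h : End X)) hh hp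
  exact ⟨g, h1, h2⟩

theorem IsFaithfulState.mem_span (hφ : IsFaithfulState φ) (a : X ⟶ X) :
    a ∈ Submodule.span ℂ {e : X ⟶ X | dag e = e ∧ e ≫ e = e} := by
  let := endStarRing X
  have := endStarModule X
  have : FiniteDimensional ℂ (End X) := ‹FiniteDimensional ℂ (X ⟶ X)›
  let ψ : End X →ₗ[ℂ] ℂ := φ
  have hψ : IsFaithfulPositive ψ := ⟨hφ.nonneg, hφ.faithful⟩
  exact hψ.mem_span_projections (a : End X)

theorem IsFaithfulState.exists_projection (hφ : IsFaithfulState φ)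
    (hX : 1 < Module.finrank ℂ (X ⟶ X)) :
    ∃ e : X ⟶ X, dag e = e ∧ e ≫ e = e ∧ e ≠ 0 ∧ e ≠ 𝟙 X := by
  let := endStarRing X
  have := endStarModule X
  have : FiniteDimensional ℂ (End X) := ‹FiniteDimensional ℂ (X ⟶ X)›
  let ψ : End X →ₗ[ℂ] ℂ := φ
  have hψ : IsFaithfulPositive ψ := ⟨hφ.nonneg, hφ.faithful⟩
  exact hψ.exists_projection hX

end Dag

/-! ### Definiteness of the C*-norm. -/

section CStar

variable {C : Type u} [Category.{v} C] [Preadditive C] [Linear ℂ C] [StarCategory C]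
  [IsCStarCategory C]

theorem eq_zero_of_comp_dag {X Y : C} {f : X ⟶ Y} (h : f ≫ dag f = 0) : f = 0 := by
  obtain ⟨N, h1, -, h3, -⟩ := IsCStarCategory.exists_norm (C := C)
  have := h3 f
  rw [h, map_zero] at this
  exact h1 f (by simpa using this.symm)

end CStar

/-! ### Scalars of the unit object and finite-dimensionality of `Hom(𝟙, Z)`. -/

section Scalar

variable {C : Type u} [Category.{v} C] [Preadditive C] [Linear ℂ C] [StarCategory C]
  [MonoidalCategory C] [IsCStarTensorCategory C]

open IsCStarTensorCategory

theorem dag_leftUnitor_inv (X : C) : dag (λ_ X).inv = (λ_ X).hom := by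
  rw [← dag_leftUnitor, dag_dag]

theorem dag_rightUnitor_inv (X : C) : dag (ρ_ X).inv = (ρ_ X).hom := by
  rw [← dag_rightUnitor, dag_dag]

theorem id_unit_ne_zero : 𝟙 (𝟙_ C) ≠ 0 := by
  intro h
  have h1 := simple_unit (C := C)
  have : Subsingleton (𝟙_ C ⟶ 𝟙_ C) := ⟨fun f g => by
    rw [← Category.comp_id f, ← Category.comp_id g, h, Limits.comp_zero, Limits.comp_zero]⟩
  rw [Module.finrank_zero_of_subsingleton] at h1
  exact absurd h1 (by norm_num)

variable (C) in
/-- Endomorphisms of the unit object are scalars. -/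
noncomputable def sc : (𝟙_ C ⟶ 𝟙_ C) ≃ₗ[ℂ] ℂ :=
  (LinearEquiv.ofBijective (LinearMap.toSpanSingleton ℂ _ (𝟙 (𝟙_ C)))
    ⟨by
      rw [← LinearMap.ker_eq_bot, LinearMap.ker_toSpanSingleton ℂ id_unit_ne_zero],
    fun f => by
      obtain ⟨c, hc⟩ := (finrank_eq_one_iff_of_nonzero' _ id_unit_ne_zero).1
        (simple_unit (C := C)) f
      exact ⟨c, hc⟩⟩).symm

@[simp] theorem sc_id : sc C (𝟙 (𝟙_ C)) = 1 := by
  refine (LinearEquiv.symm_apply_eq _).2 ?_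
  exact (one_smul ℂ (𝟙 (𝟙_ C))).symm

theorem sc_smul_id (f : 𝟙_ C ⟶ 𝟙_ C) : sc C f • 𝟙 (𝟙_ C) = f := by
  apply (sc C).injective
  simp

theorem sc_comp (f g : 𝟙_ C ⟶ 𝟙_ C) : sc C (f ≫ g) = sc C f * sc C g := by
  conv_lhs => rw [← sc_smul_id f]
  simp

theorem sc_dag (f : 𝟙_ C ⟶ 𝟙_ C) : sc C (dag f) = (starRingEnd ℂ) (sc C f) := by
  conv_lhs => rw [← sc_smul_id f]
  simp [dag_smul]

theorem sc_comp_dag_nonneg {Z : C} (f : 𝟙_ C ⟶ Z) : 0 ≤ sc C (f ≫ dag f) := by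
  obtain ⟨g, hg⟩ := IsCStarCategory.exists_sqrt f
  rw [hg, sc_comp, sc_dag, Complex.mul_conj]
  exact_mod_cast Complex.normSq_nonneg _

theorem eq_zero_of_sc {Z : C} {f : 𝟙_ C ⟶ Z} (h : sc C (f ≫ dag f) = 0) : f = 0 :=
  eq_zero_of_comp_dag ((sc C).injective (h.trans (map_zero _).symm))

theorem sc_comp_dag_conj {Z : C} (f g : 𝟙_ C ⟶ Z) :
    (starRingEnd ℂ) (sc C (f ≫ dag g)) = sc C (g ≫ dag f) := by
  rw [← sc_dag, dag_comp, dag_dag]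

variable (C) in
/-- The inner product on `Hom(𝟙, Z)`. -/
noncomputable abbrev pointCore (Z : C) : InnerProductSpace.Core ℂ (𝟙_ C ⟶ Z) where
  inner f g := sc C (g ≫ dag f)
  conj_inner_symm f g := sc_comp_dag_conj f g
  re_inner_nonneg f := (Complex.nonneg_iff.1 (sc_comp_dag_nonneg f)).1
  add_left f g h := by simp [dag_add]
  smul_left f g c := by simp [dag_smul]
  definite f h := eq_zero_of_sc h

theorem sc_projection_le {Z Y : C} (f : 𝟙_ C ⟶ Z ⊗ Y) {e : Z ⟶ Z} (h1 : dag e = e)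
    (h2 : e ≫ e = e) : sc C (f ≫ e ▷ Y ≫ dag f) ≤ sc C (f ≫ dag f) := by
  have h3 : (𝟙 Z - e) ≫ dag (𝟙 Z - e) = 𝟙 Z - e := by
    rw [dag_sub, dag_id, h1]; simp [h2]
  have h4 := sc_comp_dag_nonneg (f ≫ (𝟙 Z - e) ▷ Y)
  have h5 : (f ≫ (𝟙 Z - e) ▷ Y) ≫ dag (f ≫ (𝟙 Z - e) ▷ Y) = f ≫ dag f - f ≫ e ▷ Y ≫ dag f := by
    rw [dag_comp, dag_whiskerRight, Category.assoc, ← comp_whiskerRight_assoc, h3]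
    have : (𝟙 Z - e) ▷ Y = 𝟙 (Z ⊗ Y) - e ▷ Y := by
      rw [← id_whiskerRight]; exact (tensorRight Y).map_sub
    rw [this]; simp
  rw [h5, map_sub] at h4
  exact sub_nonneg.1 h4

theorem sc_projection_le' {Z Y : C} (f : 𝟙_ C ⟶ Y ⊗ Z) {e : Z ⟶ Z} (h1 : dag e = e)
    (h2 : e ≫ e = e) : sc C (f ≫ Y ◁ e ≫ dag f) ≤ sc C (f ≫ dag f) := by
  have h3 : (𝟙 Z - e) ≫ dag (𝟙 Z - e) = 𝟙 Z - e := by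
    rw [dag_sub, dag_id, h1]; simp [h2]
  have h4 := sc_comp_dag_nonneg (f ≫ Y ◁ (𝟙 Z - e))
  have h5 : (f ≫ Y ◁ (𝟙 Z - e)) ≫ dag (f ≫ Y ◁ (𝟙 Z - e)) = f ≫ dag f - f ≫ Y ◁ e ≫ dag f := by
    rw [dag_comp, dag_whiskerLeft, Category.assoc, ← MonoidalCategory.whiskerLeft_comp_assoc, h3]
    have : Y ◁ (𝟙 Z - e) = 𝟙 (Y ⊗ Z) - Y ◁ e := by
      rw [← MonoidalCategory.whiskerLeft_id]; exact (tensorLeft Y).map_sub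
    rw [this]; simp
  rw [h5, map_sub] at h4
  exact sub_nonneg.1 h4

/-- Each `e i` can be bent into a vector of `Hom(𝟙, Y)` in two ways, `s i` through the coevaluation
and `t i` through the adjoint of the evaluation. The zigzag identity gives inner product one between
them, so `0 ≤ ‖s i - t i‖²` yields `2 ≤ ‖s i‖² + ‖t i‖²`. Summed over `i`, the squared norms are the
two loops of `p` cut down by the projection `Q`, hence bounded by the full loops. -/
theorem orthonormal_card_le {Z Y : C} (p : ExactPairing Z Y) {n : ℕ} (e : Fin n → (𝟙_ C ⟶ Z))
    (he : ∀ i j, e i ≫ dag (e j) = if i = j then 𝟙 _ else 0) :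
    2 * (n : ℂ) ≤ sc C (p.coevaluation' ≫ dag p.coevaluation') +
      sc C (dag p.evaluation' ≫ p.evaluation') := by
  set Q : Z ⟶ Z := ∑ i, dag (e i) ≫ e i with hQ
  have hQ1 : dag Q = Q := by simp [hQ, dag_sum, dag_comp, dag_dag]
  have hQ2 : Q ≫ Q = Q := by
    rw [hQ]
    simp only [Preadditive.sum_comp, Preadditive.comp_sum, Category.assoc]
    refine Finset.sum_congr rfl fun i _ => ?_
    rw [Finset.sum_eq_single i]
    · rw [reassoc_of% (he i i)]; simp
    · intro j _ hj
      rw [reassoc_of% (he j i), if_neg hj]; simp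
    · simp
  let s : Fin n → (𝟙_ C ⟶ Y) := fun i => p.coevaluation' ≫ dag (e i) ▷ Y ≫ (λ_ Y).hom
  let t : Fin n → (𝟙_ C ⟶ Y) := fun i => dag p.evaluation' ≫ Y ◁ dag (e i) ≫ (ρ_ Y).hom
  have hs : ∀ i, s i ≫ dag (s i) = p.coevaluation' ≫ (dag (e i) ≫ e i) ▷ Y ≫ dag p.coevaluation' := by
    intro i
    simp [s, dag_comp, dag_leftUnitor, dag_whiskerRight, dag_dag]
  have ht : ∀ i, t i ≫ dag (t i) =
      dag p.evaluation' ≫ Y ◁ (dag (e i) ≫ e i) ≫ dag (dag p.evaluation') := by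
    intro i
    simp [t, dag_comp, dag_rightUnitor, dag_whiskerLeft, dag_dag]
  have hst : ∀ i, s i ≫ dag (t i) = 𝟙 _ := by
    intro i
    have hz := p.evaluation_coevaluation'
    have h1 := he i i
    rw [if_pos rfl] at h1
    simp only [s, t, dag_comp, dag_rightUnitor, dag_whiskerLeft, dag_dag, Category.assoc]
    calc _ = p.coevaluation' ⊗≫ (dag (e i) ▷ (Y ⊗ 𝟙_ C) ≫ 𝟙_ C ◁ (Y ◁ e i)) ⊗≫ p.evaluation' := by
            monoidal
      _ = p.coevaluation' ⊗≫ ((Z ⊗ Y) ◁ e i) ⊗≫ (dag (e i) ▷ (Y ⊗ Z) ≫ _ ◁ p.evaluation')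
            ⊗≫ 𝟙 _ := by
            rw [← whisker_exchange]; monoidal
      _ = 𝟙 _ ⊗≫ (p.coevaluation' ▷ 𝟙_ C ≫ (Z ⊗ Y) ◁ e i) ⊗≫ Z ◁ p.evaluation' ⊗≫ dag (e i) := by
            rw [← whisker_exchange]; monoidal
      _ = e i ⊗≫ (p.coevaluation' ▷ Z ≫ (α_ _ _ _).hom ≫ Z ◁ p.evaluation') ⊗≫ dag (e i) := by
            rw [← whisker_exchange]; monoidal
      _ = e i ≫ dag (e i) := by rw [hz]; monoidal
      _ = _ := h1
  have hsum : ∀ i, 2 ≤ sc C (s i ≫ dag (s i)) + sc C (t i ≫ dag (t i)) := by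
    intro i
    have h1 := sc_comp_dag_nonneg (s i - t i)
    have h2 : (s i - t i) ≫ dag (s i - t i) = s i ≫ dag (s i) + t i ≫ dag (t i)
        - (s i ≫ dag (t i) + t i ≫ dag (s i)) := by
      rw [dag_sub]; simp only [Preadditive.sub_comp, Preadditive.comp_sub]; abel
    have h3 : t i ≫ dag (s i) = 𝟙 _ := by
      rw [← dag_dag (t i), ← dag_comp, hst, dag_id]
    rw [h2, hst, h3, map_sub, map_add, map_add, sc_id] at h1
    have := sub_nonneg.1 h1
    norm_num at this ⊢
    exact this
  have h1 : ∑ i, sc C (s i ≫ dag (s i)) ≤ sc C (p.coevaluation' ≫ dag p.coevaluation') := by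
    have : ∑ i, sc C (s i ≫ dag (s i)) = sc C (p.coevaluation' ≫ Q ▷ Y ≫ dag p.coevaluation') := by
      have hw : Q ▷ Y = ∑ i, (dag (e i) ≫ e i) ▷ Y := by
        rw [hQ]; exact (tensorRight Y).map_sum _ _
      rw [hw, Preadditive.sum_comp, Preadditive.comp_sum, map_sum]
      exact Finset.sum_congr rfl fun i _ => by rw [hs]
    rw [this]
    exact sc_projection_le _ hQ1 hQ2
  have h2 : ∑ i, sc C (t i ≫ dag (t i)) ≤ sc C (dag p.evaluation' ≫ p.evaluation') := by
    have : ∑ i, sc C (t i ≫ dag (t i)) =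
        sc C (dag p.evaluation' ≫ Y ◁ Q ≫ dag (dag p.evaluation')) := by
      have hw : Y ◁ Q = ∑ i, Y ◁ (dag (e i) ≫ e i) := by
        rw [hQ]; exact (tensorLeft Y).map_sum _ _
      rw [hw, Preadditive.sum_comp, Preadditive.comp_sum, map_sum]
      exact Finset.sum_congr rfl fun i _ => by rw [ht]
    rw [this]
    have := sc_projection_le' (dag p.evaluation') hQ1 hQ2
    rwa [dag_dag] at this ⊢
  calc 2 * (n : ℂ) = ∑ _i : Fin n, (2 : ℂ) := by simp [mul_comm]
    _ ≤ ∑ i, (sc C (s i ≫ dag (s i)) + sc C (t i ≫ dag (t i))) :=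
        Finset.sum_le_sum fun i _ => hsum i
    _ ≤ _ := by rw [Finset.sum_add_distrib]; exact add_le_add h1 h2

/-- In infinite dimension there would be orthonormal families of every finite size, against the
bound by the two loops of `p`. -/
theorem finiteDimensional_point {Z Y : C} (p : ExactPairing Z Y) :
    FiniteDimensional ℂ (𝟙_ C ⟶ Z) := by
  by_contra hinf
  obtain ⟨n, hn⟩ := exists_nat_gt (sc C (p.coevaluation' ≫ dag p.coevaluation') +
      sc C (dag p.evaluation' ≫ p.evaluation')).re
  let := pointCore C Z
  let : NormedAddCommGroup (𝟙_ C ⟶ Z) := (pointCore C Z).toNormedAddCommGroup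
  let : InnerProductSpace ℂ (𝟙_ C ⟶ Z) := InnerProductSpace.ofCore (pointCore C Z).toCore
  have hr : (n : Cardinal) ≤ Module.rank ℂ (𝟙_ C ⟶ Z) := by
    have h := not_lt.1 (fun h => hinf (Module.rank_lt_aleph0_iff.1 h))
    exact (Cardinal.natCast_lt_aleph0 (n := n)).le.trans h
  obtain ⟨s, hs, hli⟩ := exists_finset_linearIndependent_of_le_rank hr
  let W := Submodule.span ℂ (s : Set (𝟙_ C ⟶ Z))
  have hW : Module.finrank ℂ W = n := by
    rw [← hs]; exact finrank_span_finset_eq_card hli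
  have : FiniteDimensional ℂ W := FiniteDimensional.span_finset ℂ s
  let b := (stdOrthonormalBasis ℂ W).reindex (finCongr hW)
  have hb : ∀ i j, (b i : 𝟙_ C ⟶ Z) ≫ dag (b j : 𝟙_ C ⟶ Z) = if i = j then 𝟙 _ else 0 := by
    intro i j
    have h := orthonormal_iff_ite.1 b.orthonormal j i
    rw [Submodule.coe_inner] at h
    change sc C ((b i : 𝟙_ C ⟶ Z) ≫ dag (b j : 𝟙_ C ⟶ Z)) = _ at h
    apply (sc C).injective
    rw [h]
    by_cases hij : i = j
    · simp [hij]
    · simp [hij, Ne.symm hij]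
  have h := orthonormal_card_le p (fun i => (b i : 𝟙_ C ⟶ Z)) hb
  have h' := (Complex.le_def.1 h).1
  simp at h' hn
  have : (0 : ℝ) ≤ n := Nat.cast_nonneg n
  linarith

end Scalar

/-! ### Exact pairings -/

section Pairing

variable {C : Type u} [Category.{v} C] [MonoidalCategory C] {X Y : C}

/-- This formula and its three variants recover a morphism from a bent form by a zigzag; they make
bending injective, which is how they are used in the cancellation lemmas below. -/
theorem eq_of_coev_whiskerRight (p : ExactPairing X Y) {Z : C} (f : X ⟶ Z) :
    f = (λ_ X).inv ≫ (p.coevaluation' ≫ f ▷ Y) ▷ X ≫ (α_ Z Y X).hom ≫ Z ◁ p.evaluation' ≫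
      (ρ_ Z).hom := by
  have h := p.evaluation_coevaluation'
  symm
  calc _ = 𝟙 _ ⊗≫ p.coevaluation' ▷ X ⊗≫ (f ▷ (Y ⊗ X) ≫ Z ◁ p.evaluation') ⊗≫ 𝟙 _ := by monoidal
    _ = 𝟙 _ ⊗≫ (p.coevaluation' ▷ X ≫ (α_ _ _ _).hom ≫ X ◁ p.evaluation') ⊗≫ f := by
      rw [← whisker_exchange]; monoidal
    _ = f := by rw [h]; monoidal

theorem eq_of_coev_whiskerLeft (p : ExactPairing X Y) {Z : C} (g : Y ⟶ Z) :
    g = (ρ_ Y).inv ≫ Y ◁ (p.coevaluation' ≫ X ◁ g) ≫ (α_ Y X Z).inv ≫ p.evaluation' ▷ Z ≫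
      (λ_ Z).hom := by
  have h := p.coevaluation_evaluation'
  symm
  calc _ = 𝟙 _ ⊗≫ Y ◁ p.coevaluation' ⊗≫ ((Y ⊗ X) ◁ g ≫ p.evaluation' ▷ Z) ⊗≫ 𝟙 _ := by monoidal
    _ = 𝟙 _ ⊗≫ (Y ◁ p.coevaluation' ≫ (α_ _ _ _).inv ≫ p.evaluation' ▷ Y) ⊗≫ g := by
      rw [whisker_exchange]; monoidal
    _ = g := by rw [h]; monoidal

theorem eq_of_whiskerLeft_ev (p : ExactPairing X Y) {Z : C} (f : Z ⟶ X) :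
    f = (λ_ Z).inv ≫ p.coevaluation' ▷ Z ≫ (α_ X Y Z).hom ≫ X ◁ (Y ◁ f ≫ p.evaluation') ≫
      (ρ_ X).hom := by
  have h := p.evaluation_coevaluation'
  symm
  calc _ = 𝟙 _ ⊗≫ (p.coevaluation' ▷ Z ≫ (X ⊗ Y) ◁ f) ⊗≫ X ◁ p.evaluation' ⊗≫ 𝟙 _ := by monoidal
    _ = f ⊗≫ (p.coevaluation' ▷ X ≫ (α_ _ _ _).hom ≫ X ◁ p.evaluation') ⊗≫ 𝟙 _ := by
      rw [← whisker_exchange]; monoidal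
    _ = f := by rw [h]; monoidal

theorem eq_of_whiskerRight_ev (p : ExactPairing X Y) {Z : C} (g : Z ⟶ Y) :
    g = (ρ_ Z).inv ≫ Z ◁ p.coevaluation' ≫ (α_ Z X Y).inv ≫ (g ▷ X ≫ p.evaluation') ▷ Y ≫
      (λ_ Y).hom := by
  have h := p.coevaluation_evaluation'
  symm
  calc _ = 𝟙 _ ⊗≫ (Z ◁ p.coevaluation' ≫ g ▷ (X ⊗ Y)) ⊗≫ p.evaluation' ▷ Y ⊗≫ 𝟙 _ := by monoidal
    _ = g ⊗≫ (Y ◁ p.coevaluation' ≫ (α_ _ _ _).inv ≫ p.evaluation' ▷ Y) ⊗≫ 𝟙 _ := by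
      rw [whisker_exchange]; monoidal
    _ = g := by rw [h]; monoidal

theorem coev_whiskerRight_cancel (p : ExactPairing X Y) {Z : C} {f g : X ⟶ Z}
    (h : p.coevaluation' ≫ f ▷ Y = p.coevaluation' ≫ g ▷ Y) : f = g := by
  rw [eq_of_coev_whiskerRight p f, h, ← eq_of_coev_whiskerRight p g]

theorem coev_whiskerLeft_cancel (p : ExactPairing X Y) {Z : C} {f g : Y ⟶ Z}
    (h : p.coevaluation' ≫ X ◁ f = p.coevaluation' ≫ X ◁ g) : f = g := by
  rw [eq_of_coev_whiskerLeft p f, h, ← eq_of_coev_whiskerLeft p g]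

theorem whiskerRight_ev_cancel (p : ExactPairing X Y) {Z : C} {f g : Z ⟶ Y}
    (h : f ▷ X ≫ p.evaluation' = g ▷ X ≫ p.evaluation') : f = g := by
  rw [eq_of_whiskerRight_ev p f, h, ← eq_of_whiskerRight_ev p g]

theorem exists_mate {X' Y' : C} (p : ExactPairing X Y) (p' : ExactPairing X' Y') (f : X ⟶ X') :
    ∃ g : Y' ⟶ Y, p.coevaluation' ≫ f ▷ Y = p'.coevaluation' ≫ X' ◁ g ∧
      Y' ◁ f ≫ p'.evaluation' = g ▷ X ≫ p.evaluation' := by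
  let : HasRightDual X := ⟨Y⟩
  let : HasRightDual X' := ⟨Y'⟩
  exact ⟨rightAdjointMate f, (coevaluation_comp_rightAdjointMate f).symm,
    (rightAdjointMate_comp_evaluation f).symm⟩

theorem exists_mate' {X' Y' : C} (p : ExactPairing X Y) (p' : ExactPairing X' Y') (g : Y' ⟶ Y) :
    ∃ f : X ⟶ X', p.coevaluation' ≫ f ▷ Y = p'.coevaluation' ≫ X' ◁ g ∧
      Y' ◁ f ≫ p'.evaluation' = g ▷ X ≫ p.evaluation' := by
  let : HasLeftDual Y := ⟨X⟩
  let : HasLeftDual Y' := ⟨X'⟩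
  exact ⟨leftAdjointMate g, coevaluation_comp_leftAdjointMate g,
    leftAdjointMate_comp_evaluation g⟩

/-- Two duals of an object are isomorphic. -/
theorem exists_dual_iso {Y' : C} (p : ExactPairing X Y) (p' : ExactPairing X Y') :
    ∃ (u : Y ⟶ Y') (w : Y' ⟶ Y), u ≫ w = 𝟙 Y ∧ w ≫ u = 𝟙 Y' ∧
      p.coevaluation' ≫ X ◁ u = p'.coevaluation' ∧ u ▷ X ≫ p'.evaluation' = p.evaluation' ∧
      p'.coevaluation' ≫ X ◁ w = p.coevaluation' ∧ w ▷ X ≫ p.evaluation' = p'.evaluation' := by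
  obtain ⟨w, hw1, hw2⟩ := exists_mate p p' (𝟙 X)
  obtain ⟨u, hu1, hu2⟩ := exists_mate p' p (𝟙 X)
  simp only [id_whiskerRight, Category.comp_id, MonoidalCategory.whiskerLeft_id,
    Category.id_comp] at hw1 hw2 hu1 hu2
  refine ⟨u, w, ?_, ?_, hu1.symm, hu2.symm, hw1.symm, hw2.symm⟩
  · apply coev_whiskerLeft_cancel p
    rw [MonoidalCategory.whiskerLeft_comp, ← Category.assoc, ← hu1, ← hw1]; simp
  · apply coev_whiskerLeft_cancel p'
    rw [MonoidalCategory.whiskerLeft_comp, ← Category.assoc, ← hw1, ← hu1]; simp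

/-- Transport of a pairing along an automorphism. -/
abbrev congrPairing (p : ExactPairing X Y) (i : X ≅ X) : ExactPairing X Y :=
  exactPairingCongrLeft i

theorem congrPairing_coev (p : ExactPairing X Y) (i : X ≅ X) :
    (congrPairing p i).coevaluation' = p.coevaluation' ≫ i.inv ▷ Y := rfl

theorem congrPairing_ev (p : ExactPairing X Y) (i : X ≅ X) :
    (congrPairing p i).evaluation' = Y ◁ i.hom ≫ p.evaluation' := rfl

end Pairing

/-! ### Left and right traces of a pairing; decomposition into simple objects. -/

section Trace

variable {C : Type u} [Category.{v} C] [Preadditive C] [Linear ℂ C] [StarCategory C]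
  [MonoidalCategory C] [IsCStarTensorCategory C]

open IsCStarTensorCategory

/-- The adjoint pairing. -/
abbrev dagPairing {X Y : C} (p : ExactPairing X Y) : ExactPairing Y X where
  coevaluation' := dag p.evaluation'
  evaluation' := dag p.coevaluation'
  coevaluation_evaluation' := by
    have h := congrArg dag p.evaluation_coevaluation'
    simpa [dag_comp, dag_whiskerLeft, dag_whiskerRight, dag_associator, dag_leftUnitor,
      dag_rightUnitor_inv] using h
  evaluation_coevaluation' := by
    have h := congrArg dag p.coevaluation_evaluation'
    simpa [dag_comp, dag_whiskerLeft, dag_whiskerRight, dag_associator_inv, dag_leftUnitor_inv,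
      dag_rightUnitor] using h

/-- The functional `F ↦ coev* (F ⊗ 1) coev`. -/
noncomputable def trL {X Y : C} (p : ExactPairing X Y) : (X ⟶ X) →ₗ[ℂ] ℂ where
  toFun F := sc C (p.coevaluation' ≫ F ▷ Y ≫ dag p.coevaluation')
  map_add' F G := by simp
  map_smul' c F := by simp

/-- The functional `F ↦ ev (1 ⊗ F) ev*`. -/
noncomputable def trR {X Y : C} (p : ExactPairing X Y) : (X ⟶ X) →ₗ[ℂ] ℂ where
  toFun F := sc C (dag p.evaluation' ≫ Y ◁ F ≫ p.evaluation')
  map_add' F G := by simp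
  map_smul' c F := by simp

theorem trL_apply {X Y : C} (p : ExactPairing X Y) (F : X ⟶ X) :
    trL p F = sc C (p.coevaluation' ≫ F ▷ Y ≫ dag p.coevaluation') := rfl

theorem trR_apply {X Y : C} (p : ExactPairing X Y) (F : X ⟶ X) :
    trR p F = sc C (dag p.evaluation' ≫ Y ◁ F ≫ p.evaluation') := rfl

theorem isStandard_iff {X Y : C} (p : ExactPairing X Y) : IsStandard p ↔ trL p = trR p := by
  constructor
  · intro h
    ext F
    rw [trL_apply, trR_apply, h F]
  · intro h F
    apply (sc C).injective
    exact DFunLike.congr_fun h F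

theorem trL_comp_dag {X Y Z : C} (p : ExactPairing X Y) (a : X ⟶ Z) :
    trL p (a ≫ dag a) = sc C ((p.coevaluation' ≫ a ▷ Y) ≫ dag (p.coevaluation' ≫ a ▷ Y)) := by
  simp [trL_apply, dag_comp, dag_whiskerRight]

theorem trL_nonneg {X Y Z : C} (p : ExactPairing X Y) (a : X ⟶ Z) : 0 ≤ trL p (a ≫ dag a) := by
  rw [trL_comp_dag]; exact sc_comp_dag_nonneg _

theorem trL_faithful {X Y Z : C} (p : ExactPairing X Y) {a : X ⟶ Z}
    (h : trL p (a ≫ dag a) = 0) : a = 0 := by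
  rw [trL_comp_dag] at h
  apply coev_whiskerRight_cancel p
  rw [eq_zero_of_sc h]; simp

theorem trL_state {X Y : C} (p : ExactPairing X Y) : IsFaithfulState (trL p) :=
  ⟨fun a => trL_nonneg p a, fun _ h => trL_faithful p h⟩

theorem trR_dagPairing {X Y : C} (p : ExactPairing X Y) (K : Y ⟶ Y) :
    trR (dagPairing p) K = sc C (p.coevaluation' ≫ X ◁ K ≫ dag p.coevaluation') := by
  change sc C (dag (dag p.coevaluation') ≫ X ◁ K ≫ dag p.coevaluation') = _
  rw [dag_dag]

theorem trL_dagPairing {X Y : C} (p : ExactPairing X Y) (K : Y ⟶ Y) :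
    trL (dagPairing p) K = sc C (dag p.evaluation' ≫ K ▷ X ≫ p.evaluation') := by
  change sc C (dag p.evaluation' ≫ K ▷ X ≫ dag (dag p.evaluation')) = _
  rw [dag_dag]

/-- An endomorphism `K` of the dual slides through both the cup and the cap to the same mate `F` on
`X`, which exchanges the two traces. -/
theorem IsStandard.adjoint {X Y : C} {p : ExactPairing X Y} (h : IsStandard p) :
    IsStandard (dagPairing p) := by
  rw [isStandard_iff]
  ext K
  obtain ⟨F, h1, h2⟩ := exists_mate' p p K
  rw [trR_dagPairing, trL_dagPairing, ← h2, ← reassoc_of% h1, h F]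

/-- Bending the source embeds `Hom(X, Z)` into `Hom(𝟙, Z ⊗ Y)`, and `Z ⊗ Y` again has a dual. -/
theorem finiteDimensional_hom (hC : IsRigid C) (X Z : C) : FiniteDimensional ℂ (X ⟶ Z) := by
  obtain ⟨Y, ⟨p⟩⟩ := hC X
  obtain ⟨W, ⟨q⟩⟩ := hC (Z ⊗ Y)
  have := finiteDimensional_point q
  let f : (X ⟶ Z) →ₗ[ℂ] (𝟙_ C ⟶ Z ⊗ Y) :=
    { toFun := fun F => p.coevaluation' ≫ F ▷ Y
      map_add' := fun F G => by simp
      map_smul' := fun c F => by simp }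
  exact Module.Finite.of_injective f fun a b h => coev_whiskerRight_cancel p h

/-- Square roots of positive endomorphisms. -/
theorem exists_sqrt_comp_dag (hC : IsRigid C) {X Z : C} (f : X ⟶ Z) :
    ∃ g : X ⟶ X, dag g = g ∧ g ≫ g = f ≫ dag f := by
  obtain ⟨Y, ⟨p⟩⟩ := hC X
  have := finiteDimensional_hom hC X X
  refine (trL_state p).exists_sqrt (by simp [dag_comp, dag_dag]) fun a => ?_
  have h := trL_nonneg p (a ≫ f)
  simpa [dag_comp] using h

/-! ### Orthogonal decompositions -/

/-- Orthogonal direct sum decompositions. -/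
structure IsOrthogonalSum {J : Type*} [Fintype J] {X : C} {W : J → C} (v : ∀ s, X ⟶ W s) :
    Prop where
  isometry : ∀ s, dag (v s) ≫ v s = 𝟙 (W s)
  orthogonal : ∀ s t, s ≠ t → dag (v s) ≫ v t = 0
  sum : ∑ s, v s ≫ dag (v s) = 𝟙 X

theorem exists_orthogonalSum {J : Type*} [Fintype J] (W : J → C) :
    ∃ (X : C) (v : ∀ s, X ⟶ W s), IsOrthogonalSum v := by
  classical
  let e := Fintype.equivFin J
  obtain ⟨X, p, h1, h2, h3⟩ := exists_directSum (C := C) (Fintype.card J) (fun i => W (e.symm i))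
  have key : ∀ s, W (e.symm (e s)) = W s := fun s => by rw [e.symm_apply_apply]
  have hnat : ∀ {s t : J} (h : s = t), dag (eqToHom (congrArg W h)) = eqToHom (congrArg W h.symm) := by
    rintro s t rfl; simp
  refine ⟨X, fun s => p (e s) ≫ eqToHom (key s), ?_, ?_, ?_⟩
  · intro s
    rw [dag_comp, Category.assoc, reassoc_of% (h1 (e s)), hnat (e.symm_apply_apply s)]
    simp
  · intro s t hst
    rw [dag_comp, Category.assoc, reassoc_of% (h2 (e s) (e t) (fun h => hst (e.injective h)))]
    simp
  · rw [← h3, ← e.sum_comp]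
    refine Finset.sum_congr rfl fun s _ => ?_
    rw [dag_comp, Category.assoc, hnat (e.symm_apply_apply s)]
    simp

/-- Strong induction on `dim End X`: above dimension one the spectral theorem gives a nontrivial
projection `e`, and the images of `e` and `1 - e` have smaller endomorphism algebras. -/
theorem exists_decomposition_aux (hC : IsRigid C) (n : ℕ) : ∀ X : C,
    Module.finrank ℂ (X ⟶ X) = n → ∃ (J : Type) (_ : Fintype J) (W : J → C) (v : ∀ s, X ⟶ W s),
      IsOrthogonalSum v ∧ ∀ s, Module.finrank ℂ (W s ⟶ W s) = 1 := by
  induction n using Nat.strong_induction_on with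
  | _ n ih =>
    intro X hX
    have hfin := finiteDimensional_hom hC X X
    rcases Nat.lt_or_ge 1 n with hn | hn
    · obtain ⟨Y, ⟨p⟩⟩ := hC X
      obtain ⟨e, he1, he2, he3, he4⟩ := (trL_state p).exists_projection (hX ▸ hn)
      have sub : ∀ e : X ⟶ X, dag e = e → e ≫ e = e → e ≠ 𝟙 X →
          ∃ (J : Type) (_ : Fintype J) (W : J → C) (v : ∀ s, X ⟶ W s),
            (∀ s, dag (v s) ≫ v s = 𝟙 (W s)) ∧ (∀ s t, s ≠ t → dag (v s) ≫ v t = 0) ∧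
            ∑ s, v s ≫ dag (v s) = e ∧ (∀ s, v s = e ≫ v s) ∧
            ∀ s, Module.finrank ℂ (W s ⟶ W s) = 1 := by
        intro e he1 he2 he4
        obtain ⟨Z, q, hq1, hq2⟩ := exists_subobject (C := C) X e he2 he1
        have hlt : Module.finrank ℂ (Z ⟶ Z) < n := by
          -- `End Z` is the corner of `End X` cut out by `e`; it misses the identity because `e ≠
          -- 1`, so the dimension drops.
          let f : (Z ⟶ Z) →ₗ[ℂ] (X ⟶ X) :=
            { toFun := fun F => q ≫ F ≫ dag q
              map_add' := fun F G => by simp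
              map_smul' := fun c F => by simp }
          have hinj : Function.Injective f := by
            intro a b h
            have h' : q ≫ a ≫ dag q = q ≫ b ≫ dag q := h
            have h2 := congrArg (fun t => dag q ≫ t ≫ q) h'
            simpa [reassoc_of% hq1, hq1] using h2
          have hns : LinearMap.range f ≠ ⊤ := by
            intro htop
            obtain ⟨a, ha⟩ := (LinearMap.range_eq_top.1 htop) (𝟙 X)
            have ha' : q ≫ a ≫ dag q = 𝟙 X := ha
            apply he4
            calc e = e ≫ 𝟙 X := by simp
              _ = 𝟙 X := by
                rw [← ha', ← hq2, Category.assoc, reassoc_of% hq1]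
          rw [← hX, ← LinearMap.finrank_range_of_inj hinj]
          exact Submodule.finrank_lt hns
        obtain ⟨J, hJ, W, v, hv, hs⟩ := ih _ hlt Z rfl
        refine ⟨J, hJ, W, fun s => q ≫ v s, ?_, ?_, ?_, ?_, hs⟩
        · intro s
          rw [dag_comp, Category.assoc, reassoc_of% hq1, hv.isometry]
        · intro s t hst
          rw [dag_comp, Category.assoc, reassoc_of% hq1, hv.orthogonal s t hst]
        · have : ∑ s, (q ≫ v s) ≫ dag (q ≫ v s) = q ≫ (∑ s, v s ≫ dag (v s)) ≫ dag q := by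
            simp [Preadditive.comp_sum, Preadditive.sum_comp, dag_comp]
          rw [this, hv.sum, Category.id_comp, hq2]
        · intro s
          rw [← hq2, Category.assoc, reassoc_of% hq1]
      obtain ⟨J, _, W, v, h1, h2, h3, h4, h5⟩ := sub e he1 he2 he4
      obtain ⟨K, _, W', v', h1', h2', h3', h4', h5'⟩ := sub (𝟙 X - e) (by
        rw [dag_sub, dag_id, he1]) (by simp [he2]) (by
          intro h; apply he3; simpa using h)
      have horth : e ≫ (𝟙 X - e) = 0 := by simp [he2]
      have horth' : (𝟙 X - e) ≫ e = 0 := by simp [he2]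
      refine ⟨J ⊕ K, inferInstance, Sum.elim W W', fun s => match s with
        | Sum.inl s => v s
        | Sum.inr s => v' s, ⟨?_, ?_, ?_⟩, ?_⟩
      · rintro (s | s)
        · exact h1 s
        · exact h1' s
      · rintro (s | s) (t | t) hst
        · exact h2 s t (fun h => hst (by rw [h]))
        · change dag (v s) ≫ v' t = 0
          rw [h4 s, h4' t, dag_comp, he1, Category.assoc, reassoc_of% horth]; simp
        · change dag (v' s) ≫ v t = 0
          rw [h4 t, h4' s, dag_comp, dag_sub, dag_id, he1, Category.assoc, reassoc_of% horth']; simp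
        · exact h2' s t (fun h => hst (by rw [h]))
      · rw [Fintype.sum_sum_type]
        change ∑ s, v s ≫ dag (v s) + ∑ s, v' s ≫ dag (v' s) = 𝟙 X
        rw [h3, h3']; abel
      · rintro (s | s)
        · exact h5 s
        · exact h5' s
    · interval_cases n
      · refine ⟨Empty, inferInstance, Empty.elim, fun s => s.elim, ⟨fun s => s.elim,
          fun s => s.elim, ?_⟩, fun s => s.elim⟩
        have := Module.finrank_zero_iff.1 hX
        exact Subsingleton.elim _ _
      · refine ⟨Unit, inferInstance, fun _ => X, fun _ => 𝟙 X, ⟨fun s => by simp,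
          fun s t h => absurd rfl h, by simp⟩, fun _ => hX⟩

/-- Every object is an orthogonal direct sum of simple objects. -/
theorem exists_decomposition (hC : IsRigid C) (X : C) :
    ∃ (J : Type) (_ : Fintype J) (W : J → C) (v : ∀ s, X ⟶ W s),
      IsOrthogonalSum v ∧ ∀ s, Module.finrank ℂ (W s ⟶ W s) = 1 :=
  exists_decomposition_aux hC _ X rfl

end Trace

/-! ### Orthogonal direct sums of exact pairings. -/

section Standard

variable {C : Type u} [Category.{v} C] [Preadditive C] [Linear ℂ C] [StarCategory C]
  [MonoidalCategory C] [IsCStarTensorCategory C]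

open IsCStarTensorCategory

theorem whiskerLeft_sum' (X : C) {Y Z : C} {J : Type*} (s : Finset J) (f : J → (Y ⟶ Z)) :
    X ◁ (∑ j ∈ s, f j) = ∑ j ∈ s, X ◁ f j := (tensorLeft X).map_sum _ _

theorem sum_whiskerRight' {Y Z : C} (X : C) {J : Type*} (s : Finset J) (f : J → (Y ⟶ Z)) :
    (∑ j ∈ s, f j) ▷ X = ∑ j ∈ s, f j ▷ X := (tensorRight X).map_sum _ _

theorem dag_tensorHom {X X' Y Y' : C} (f : X ⟶ X') (g : Y ⟶ Y') :
    dag (f ⊗ₘ g) = dag f ⊗ₘ dag g := by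
  rw [MonoidalCategory.tensorHom_def, dag_comp, dag_whiskerLeft, dag_whiskerRight,
    MonoidalCategory.tensorHom_def']

section DirectSum

variable {J : Type*} [Fintype J] {X Y : C} {W V : J → C} {v : ∀ s, X ⟶ W s} {w : ∀ s, Y ⟶ V s}

/-- `G` stands for the surroundings of the factor `dag (v s) ≫ v t`, so that orthogonality can
collapse a double sum wherever this factor occurs. -/
theorem IsOrthogonalSum.sum_sum (hv : IsOrthogonalSum v) {A B : C}
    (G : ∀ s t, (W s ⟶ W t) → (A ⟶ B)) (h0 : ∀ s t, G s t 0 = 0) :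
    ∑ s, ∑ t, G s t (dag (v s) ≫ v t) = ∑ s, G s s (𝟙 _) := by
  refine Finset.sum_congr rfl fun s _ => ?_
  rw [Finset.sum_eq_single s, hv.isometry]
  · intro t _ hts
    rw [hv.orthogonal s t hts.symm, h0]
  · simp

/-- The direct sum of exact pairings. -/
abbrev sumPairing (hv : IsOrthogonalSum v) (hw : IsOrthogonalSum w)
    (p : ∀ s, ExactPairing (W s) (V s)) : ExactPairing X Y where
  coevaluation' := ∑ s, (p s).coevaluation' ≫ (dag (v s) ⊗ₘ dag (w s))
  evaluation' := ∑ s, (w s ⊗ₘ v s) ≫ (p s).evaluation'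
  coevaluation_evaluation' := by
    rw [whiskerLeft_sum', sum_whiskerRight']
    simp only [Preadditive.sum_comp, Preadditive.comp_sum]
    -- The interchange law brings `dag (v s)` next to `v t`, where orthogonality kills the terms
    -- with `s ≠ t`, and moves the `w`'s to the two ends, where they add up to the identity of `Y`.
    have key : ∀ s t, Y ◁ ((p s).coevaluation' ≫ (dag (v s) ⊗ₘ dag (w s))) ≫ (α_ Y X Y).inv ≫
        ((w t ⊗ₘ v t) ≫ (p t).evaluation') ▷ Y =
        w t ▷ 𝟙_ C ≫ V t ◁ ((p s).coevaluation' ≫ (dag (v s) ≫ v t) ▷ V s) ≫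
          (α_ (V t) (W t) (V s)).inv ≫ (p t).evaluation' ▷ V s ≫ 𝟙_ C ◁ dag (w s) := by
      intro s t
      rw [MonoidalCategory.tensorHom_def', MonoidalCategory.tensorHom_def]
      calc _ = 𝟙 _ ⊗≫ Y ◁ ((p s).coevaluation' ⊗≫ W s ◁ dag (w s) ≫ dag (v s) ▷ Y) ⊗≫
              (w t ▷ X ≫ V t ◁ v t) ▷ Y ⊗≫ (p t).evaluation' ▷ Y := by monoidal
        _ = 𝟙 _ ⊗≫ Y ◁ (p s).coevaluation' ⊗≫ Y ◁ (W s ◁ dag (w s) ≫ dag (v s) ▷ Y) ⊗≫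
              (Y ◁ v t ≫ w t ▷ W t) ▷ Y ⊗≫ (p t).evaluation' ▷ Y := by
            rw [← whisker_exchange]; monoidal
        _ = 𝟙 _ ⊗≫ Y ◁ (p s).coevaluation' ⊗≫ Y ◁ (dag (v s) ▷ V s) ⊗≫
              ((Y ⊗ X) ◁ dag (w s) ≫ (Y ◁ v t) ▷ Y) ⊗≫ (w t ▷ W t) ▷ Y ⊗≫
              (p t).evaluation' ▷ Y := by
            rw [whisker_exchange]; monoidal
        _ = 𝟙 _ ⊗≫ Y ◁ (p s).coevaluation' ⊗≫ Y ◁ ((dag (v s) ≫ v t) ▷ V s) ⊗≫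
              ((Y ⊗ W t) ◁ dag (w s) ≫ (w t ▷ W t) ▷ Y) ⊗≫
              (p t).evaluation' ▷ Y := by
            rw [whisker_exchange]; monoidal
        _ = 𝟙 _ ⊗≫ (Y ◁ ((p s).coevaluation' ≫ (dag (v s) ≫ v t) ▷ V s) ≫ w t ▷ _) ⊗≫
              ((V t ⊗ W t) ◁ dag (w s) ≫ (p t).evaluation' ▷ Y) := by
            rw [whisker_exchange]; monoidal
        _ = _ := by rw [whisker_exchange, whisker_exchange]; monoidal
    simp only [key]
    rw [Finset.sum_comm,
      hv.sum_sum (fun s t f => w t ▷ 𝟙_ C ≫ V t ◁ ((p s).coevaluation' ≫ f ▷ V s) ≫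
          (α_ (V t) (W t) (V s)).inv ≫ (p t).evaluation' ▷ V s ≫ 𝟙_ C ◁ dag (w s))
          (fun s t => by simp)]
    have hz : ∀ s, w s ▷ 𝟙_ C ≫ V s ◁ ((p s).coevaluation' ≫ 𝟙 (W s) ▷ V s) ≫
          (α_ (V s) (W s) (V s)).inv ≫ (p s).evaluation' ▷ V s ≫ 𝟙_ C ◁ dag (w s) =
          (ρ_ Y).hom ≫ (w s ≫ dag (w s)) ≫ (λ_ Y).inv := by
      intro s
      have h := (p s).coevaluation_evaluation'
      rw [id_whiskerRight, Category.comp_id, reassoc_of% h]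
      monoidal
    simp only [hz]
    rw [← Preadditive.comp_sum, ← Preadditive.sum_comp, hw.sum, Category.id_comp]
  evaluation_coevaluation' := by
    rw [whiskerLeft_sum', sum_whiskerRight']
    simp only [Preadditive.sum_comp, Preadditive.comp_sum]
    have key : ∀ s t, ((p s).coevaluation' ≫ (dag (v s) ⊗ₘ dag (w s))) ▷ X ≫ (α_ X Y X).hom ≫
        X ◁ ((w t ⊗ₘ v t) ≫ (p t).evaluation') =
        𝟙_ C ◁ v t ≫ ((p s).coevaluation' ≫ W s ◁ (dag (w s) ≫ w t)) ▷ W t ≫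
          (α_ (W s) (V t) (W t)).hom ≫ W s ◁ (p t).evaluation' ≫ dag (v s) ▷ 𝟙_ C := by
      intro s t
      rw [MonoidalCategory.tensorHom_def, MonoidalCategory.tensorHom_def']
      calc _ = 𝟙 _ ⊗≫ ((p s).coevaluation' ⊗≫ dag (v s) ▷ (V s) ≫ X ◁ dag (w s)) ▷ X ⊗≫
              X ◁ (Y ◁ v t ≫ w t ▷ W t) ⊗≫ X ◁ (p t).evaluation' := by monoidal
        _ = 𝟙 _ ⊗≫ (p s).coevaluation' ▷ X ⊗≫ (dag (v s) ▷ (V s) ≫ X ◁ dag (w s)) ▷ X ⊗≫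
              X ◁ (w t ▷ X ≫ V t ◁ v t) ⊗≫ X ◁ (p t).evaluation' := by
            rw [whisker_exchange]; monoidal
        _ = 𝟙 _ ⊗≫ (p s).coevaluation' ▷ X ⊗≫ (W s ◁ dag (w s)) ▷ X ⊗≫
              (dag (v s) ▷ (Y ⊗ X) ≫ X ◁ (w t ▷ X)) ⊗≫ X ◁ V t ◁ v t ⊗≫
              X ◁ (p t).evaluation' := by
            rw [← whisker_exchange]; monoidal
        _ = 𝟙 _ ⊗≫ (p s).coevaluation' ▷ X ⊗≫ (W s ◁ (dag (w s) ≫ w t)) ▷ X ⊗≫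
              (dag (v s) ▷ (V t ⊗ X) ≫ X ◁ V t ◁ v t) ⊗≫
              X ◁ (p t).evaluation' := by
            rw [← whisker_exchange]; monoidal
        _ = 𝟙 _ ⊗≫ (((p s).coevaluation' ≫ (W s ◁ (dag (w s) ≫ w t))) ▷ X ≫ _ ◁ v t) ⊗≫
              (dag (v s) ▷ (V t ⊗ W t) ≫ X ◁ (p t).evaluation') := by
            rw [← whisker_exchange]; monoidal
        _ = _ := by rw [← whisker_exchange, ← whisker_exchange]; monoidal
    simp only [key]
    rw [Finset.sum_comm,
      hw.sum_sum (fun s t f => 𝟙_ C ◁ v t ≫ ((p s).coevaluation' ≫ W s ◁ f) ▷ W t ≫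
          (α_ (W s) (V t) (W t)).hom ≫ W s ◁ (p t).evaluation' ≫ dag (v s) ▷ 𝟙_ C)
          (fun s t => by simp)]
    have hz : ∀ s, 𝟙_ C ◁ v s ≫ ((p s).coevaluation' ≫ W s ◁ 𝟙 (V s)) ▷ W s ≫
          (α_ (W s) (V s) (W s)).hom ≫ W s ◁ (p s).evaluation' ≫ dag (v s) ▷ 𝟙_ C =
          (λ_ X).hom ≫ (v s ≫ dag (v s)) ≫ (ρ_ X).inv := by
      intro s
      have h := (p s).evaluation_coevaluation'
      rw [MonoidalCategory.whiskerLeft_id, Category.comp_id, reassoc_of% h]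
      monoidal
    simp only [hz]
    rw [← Preadditive.comp_sum, ← Preadditive.sum_comp, hv.sum, Category.id_comp]

theorem trL_sumPairing (hv : IsOrthogonalSum v) (hw : IsOrthogonalSum w)
    (p : ∀ s, ExactPairing (W s) (V s)) (F : X ⟶ X) :
    trL (sumPairing hv hw p) F = ∑ s, trL (p s) (dag (v s) ≫ F ≫ v s) := by
  change sc C ((∑ s, (p s).coevaluation' ≫ (dag (v s) ⊗ₘ dag (w s))) ≫ F ▷ Y ≫
    dag (∑ s, (p s).coevaluation' ≫ (dag (v s) ⊗ₘ dag (w s)))) = _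
  simp only [trL_apply]
  rw [← map_sum]
  congr 1
  simp only [dag_sum, dag_comp, dag_tensorHom, dag_dag, Preadditive.sum_comp, Preadditive.comp_sum,
    Category.assoc]
  have key : ∀ s t, (p s).coevaluation' ≫ (dag (v s) ⊗ₘ dag (w s)) ≫ F ▷ Y ≫ (v t ⊗ₘ w t) ≫
      dag (p t).coevaluation' = (p s).coevaluation' ≫ ((dag (v s) ≫ F ≫ v t) ⊗ₘ (dag (w s) ≫ w t)) ≫
      dag (p t).coevaluation' := by
    intro s t
    rw [← tensorHom_id]
    simp only [MonoidalCategory.tensorHom_comp_tensorHom_assoc, Category.id_comp]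
  simp only [key]
  rw [Finset.sum_comm, hw.sum_sum (fun s t f => (p s).coevaluation' ≫
    ((dag (v s) ≫ F ≫ v t) ⊗ₘ f) ≫ dag (p t).coevaluation') (fun s t => by simp)]
  simp

theorem trR_sumPairing (hv : IsOrthogonalSum v) (hw : IsOrthogonalSum w)
    (p : ∀ s, ExactPairing (W s) (V s)) (F : X ⟶ X) :
    trR (sumPairing hv hw p) F = ∑ s, trR (p s) (dag (v s) ≫ F ≫ v s) := by
  change sc C (dag (∑ s, (w s ⊗ₘ v s) ≫ (p s).evaluation') ≫ Y ◁ F ≫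
    (∑ s, (w s ⊗ₘ v s) ≫ (p s).evaluation')) = _
  simp only [trR_apply]
  rw [← map_sum]
  congr 1
  simp only [dag_sum, dag_comp, dag_tensorHom, Preadditive.sum_comp, Preadditive.comp_sum,
    Category.assoc]
  have key : ∀ s t, dag (p s).evaluation' ≫ (dag (w s) ⊗ₘ dag (v s)) ≫ Y ◁ F ≫ (w t ⊗ₘ v t) ≫
      (p t).evaluation' = dag (p s).evaluation' ≫ ((dag (w s) ≫ w t) ⊗ₘ (dag (v s) ≫ F ≫ v t)) ≫
      (p t).evaluation' := by
    intro s t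
    rw [← id_tensorHom]
    simp only [MonoidalCategory.tensorHom_comp_tensorHom_assoc, Category.id_comp]
  simp only [key]
  rw [Finset.sum_comm, hw.sum_sum (fun s t f => dag (p s).evaluation' ≫
    (f ⊗ₘ (dag (v s) ≫ F ≫ v t)) ≫ (p t).evaluation') (fun s t => by simp)]
  simp

end DirectSum

end Standard

/-! ### Existence and uniqueness of standard pairings, and the trace. -/

section Standard

variable {C : Type u} [Category.{v} C] [Preadditive C] [Linear ℂ C] [StarCategory C]
  [MonoidalCategory C] [IsCStarTensorCategory C]

open IsCStarTensorCategory

/-- Endomorphisms of a simple object are scalars. -/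
theorem exists_smul_id {X : C} (hX : Module.finrank ℂ (X ⟶ X) = 1) (f : X ⟶ X) :
    ∃ c : ℂ, f = c • 𝟙 X := by
  have h0 : 𝟙 X ≠ 0 := by
    intro h
    have : Subsingleton (X ⟶ X) := ⟨fun f g => by
      rw [← Category.comp_id f, ← Category.comp_id g, h, Limits.comp_zero, Limits.comp_zero]⟩
    rw [Module.finrank_zero_of_subsingleton] at hX
    exact absurd hX (by norm_num)
  obtain ⟨c, hc⟩ := (finrank_eq_one_iff_of_nonzero' _ h0).1 hX f
  exact ⟨c, hc.symm⟩

theorem id_ne_zero_of_finrank {X : C} (hX : Module.finrank ℂ (X ⟶ X) = 1) : 𝟙 X ≠ 0 := by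
  intro h
  have : Subsingleton (X ⟶ X) := ⟨fun f g => by
    rw [← Category.comp_id f, ← Category.comp_id g, h, Limits.comp_zero, Limits.comp_zero]⟩
  rw [Module.finrank_zero_of_subsingleton] at hX
  exact absurd hX (by norm_num)

theorem trL_id_pos {X Y : C} (p : ExactPairing X Y) (hX : 𝟙 X ≠ 0) : 0 < trL p (𝟙 X) := by
  have h1 := trL_nonneg p (𝟙 X)
  have h2 : trL p (𝟙 X ≫ dag (𝟙 X)) ≠ 0 := fun h => hX (trL_faithful p h)
  rw [dag_id, Category.comp_id] at h1 h2
  exact lt_of_le_of_ne h1 h2.symm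

theorem trR_eq_trL_dagPairing {X Y : C} (p : ExactPairing X Y) :
    trR p (𝟙 X) = trL (dagPairing p) (𝟙 Y) := by
  rw [trL_dagPairing, trR_apply]; simp

/-- Multiplication by a nonzero scalar. -/
noncomputable abbrev smulIso {c : ℂ} (hc : c ≠ 0) (X : C) : X ≅ X where
  hom := c • 𝟙 X
  inv := c⁻¹ • 𝟙 X
  hom_inv_id := by
    rw [Linear.smul_comp, Linear.comp_smul, smul_smul, mul_inv_cancel₀ hc, one_smul, Category.comp_id]
  inv_hom_id := by
    rw [Linear.smul_comp, Linear.comp_smul, smul_smul, inv_mul_cancel₀ hc, one_smul, Category.comp_id]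

theorem id_dual_ne_zero {X Y : C} (p : ExactPairing X Y) (hX : 𝟙 X ≠ 0) : 𝟙 Y ≠ 0 := by
  intro h
  apply hX
  rw [eq_of_whiskerLeft_ev p (𝟙 X)]
  have : (Y ◁ 𝟙 X ≫ p.evaluation') = 0 := by
    rw [MonoidalCategory.whiskerLeft_id, ← id_whiskerRight, h]; simp
  rw [this]; simp

theorem exists_standard_of_simple {X Y : C} (p : ExactPairing X Y)
    (hX : Module.finrank ℂ (X ⟶ X) = 1) : ∃ q : ExactPairing X Y, IsStandard q := by
  have h0 := id_ne_zero_of_finrank hX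
  obtain ⟨ha, ha'⟩ := Complex.pos_iff.1 (trL_id_pos p h0)
  obtain ⟨hb, hb'⟩ := Complex.pos_iff.1 (trL_id_pos (dagPairing p) (id_dual_ne_zero p h0))
  rw [← trR_eq_trL_dagPairing] at hb hb'
  set a := (trL p (𝟙 X)).re
  set b := (trR p (𝟙 X)).re
  have ea : trL p (𝟙 X) = (a : ℂ) := Complex.ext rfl (by simpa using ha'.symm)
  have eb : trR p (𝟙 X) = (b : ℂ) := Complex.ext rfl (by simpa using hb'.symm)
  -- On a simple object the two traces are determined by their values `a`, `b` at the identity.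
  -- Rescaling the pairing by `c` multiplies them by `c⁻²` and `c²`, so they agree when `c⁴ = a /
  -- b`.
  set c : ℝ := Real.sqrt (Real.sqrt (a / b)) with hc
  have hcpos : 0 < c := Real.sqrt_pos.2 (Real.sqrt_pos.2 (div_pos ha hb))
  have hc4 : c ^ 4 = a / b := by
    have h1 : c ^ 2 = Real.sqrt (a / b) := Real.sq_sqrt (Real.sqrt_nonneg _)
    calc c ^ 4 = (c ^ 2) ^ 2 := by ring
      _ = a / b := by rw [h1, Real.sq_sqrt (div_pos ha hb).le]
  have hcc : (c : ℂ) ≠ 0 := by exact_mod_cast hcpos.ne'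
  refine ⟨congrPairing p (smulIso hcc X), ?_⟩
  have h1 : ∀ F, trL (congrPairing p (smulIso hcc X)) F = ((c : ℂ)⁻¹ * (c : ℂ)⁻¹) * trL p F := by
    intro F
    rw [trL_apply, congrPairing_coev, trL_apply]
    simp [dag_smul, mul_assoc]
  have h2 : ∀ F, trR (congrPairing p (smulIso hcc X)) F = ((c : ℂ) * (c : ℂ)) * trR p F := by
    intro F
    rw [trR_apply, congrPairing_ev, trR_apply]
    simp [-Complex.coe_smul, dag_smul, mul_assoc]
  rw [isStandard_iff]
  ext F
  obtain ⟨z, rfl⟩ := exists_smul_id hX F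
  rw [map_smul, map_smul, h1, h2, ea, eb]
  have h3 : ((c : ℂ)⁻¹ * (c : ℂ)⁻¹) * (a : ℂ) = ((c : ℂ) * (c : ℂ)) * (b : ℂ) := by
    have : (c : ℂ) ^ 4 = (a : ℂ) / b := by exact_mod_cast hc4
    have hbb : (b : ℂ) ≠ 0 := by exact_mod_cast hb.ne'
    rw [eq_div_iff hbb] at this
    rw [← this]
    field_simp
  rw [h3]

theorem IsOrthogonalSum.exists_standard {J : Type*} [Fintype J] {X : C} {W : J → C}
    {v : ∀ s, X ⟶ W s} (hv : IsOrthogonalSum v) {V : J → C} (p : ∀ s, ExactPairing (W s) (V s))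
    (hp : ∀ s, IsStandard (p s)) : ∃ (Y : C) (q : ExactPairing X Y), IsStandard q ∧
      ∀ F, trL q F = ∑ s, trL (p s) (dag (v s) ≫ F ≫ v s) := by
  obtain ⟨Y, w, hw⟩ := exists_orthogonalSum V
  refine ⟨Y, sumPairing hv hw p, ?_, trL_sumPairing hv hw p⟩
  rw [isStandard_iff]
  ext F
  rw [trL_sumPairing, trR_sumPairing]
  exact Finset.sum_congr rfl fun s _ => DFunLike.congr_fun ((isStandard_iff _).1 (hp s)) _

theorem exists_standard (hC : IsRigid C) (X : C) :
    ∃ (Y : C) (p : ExactPairing X Y), IsStandard p := by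
  obtain ⟨J, _, W, v, hv, hs⟩ := exists_decomposition hC X
  have h : ∀ s, ∃ (Y : C) (p : ExactPairing (W s) Y), IsStandard p := fun s => by
    obtain ⟨Y, ⟨p⟩⟩ := hC (W s)
    obtain ⟨q, hq⟩ := exists_standard_of_simple p (hs s)
    exact ⟨Y, q, hq⟩
  choose V p hp using h
  obtain ⟨Y, q, hq, -⟩ := hv.exists_standard p hp
  exact ⟨Y, q, hq⟩

/-! ### Uniqueness of standard pairings -/

/-- Let `k = u ≫ dag u`, with inverse `k'`. Standardness of `p` and `p'` makes the trace of `k` and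
the trace of `k⁻¹` on `Y` both equal to the dimension computed from `p'`. With `g = √k`, positivity
of the trace of `(g - g⁻¹)²`, which is that of `k + k⁻¹ - 2`, gives the inequality; equality forces
`g = g⁻¹`, that is `k = 1`. -/
theorem IsStandard.comparison (hC : IsRigid C) {X Y Y' : C} {p : ExactPairing X Y}
    {p' : ExactPairing X Y'} (h : IsStandard p) (h' : IsStandard p') {u : Y ⟶ Y'} {w : Y' ⟶ Y}
    (huw : u ≫ w = 𝟙 Y) (hwu : w ≫ u = 𝟙 Y')
    (hu : p.coevaluation' ≫ X ◁ u = p'.coevaluation')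
    (hw : w ▷ X ≫ p.evaluation' = p'.evaluation') :
    trL p (𝟙 X) ≤ trL p' (𝟙 X) ∧ (trL p (𝟙 X) = trL p' (𝟙 X) → u ≫ dag u = 𝟙 Y) := by
  have hd := (isStandard_iff _).1 h.adjoint
  have hs' := (isStandard_iff _).1 h'
  set k := u ≫ dag u with hk
  set k' := dag w ≫ w with hk'
  have hkk' : k ≫ k' = 𝟙 Y := by
    rw [hk, hk', Category.assoc, ← Category.assoc (dag u), ← dag_comp, hwu]
    simp [huw]
  have hk'k : k' ≫ k = 𝟙 Y := by
    rw [hk, hk', Category.assoc, ← Category.assoc w, hwu, Category.id_comp, ← dag_comp, huw, dag_id]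
  have hk'd : dag k' = k' := by rw [hk', dag_comp, dag_dag]
  have e1 : trL p' (𝟙 X) = trL (dagPairing p) k := by
    rw [hd, trR_dagPairing, trL_apply, ← hu]
    simp [hk, dag_comp, dag_whiskerLeft]
  have e2 : trL p' (𝟙 X) = trL (dagPairing p) k' := by
    rw [hs', trL_dagPairing, trR_apply, ← hw]
    simp [hk', dag_comp, dag_whiskerRight]
  have e3 : trL p (𝟙 X) = trL (dagPairing p) (𝟙 Y) := by
    rw [(isStandard_iff _).1 h, trR_eq_trL_dagPairing]
  obtain ⟨g, hg1, hg2⟩ := exists_sqrt_comp_dag hC u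
  rw [← hk] at hg2
  have hgl : (k' ≫ g) ≫ g = 𝟙 Y := by rw [Category.assoc, hg2, hk'k]
  have hgr : g ≫ (g ≫ k') = 𝟙 Y := by rw [← Category.assoc, hg2, hkk']
  have hg' : k' ≫ g = g ≫ k' := by
    calc k' ≫ g = (k' ≫ g) ≫ (g ≫ (g ≫ k')) := by rw [hgr, Category.comp_id]
      _ = g ≫ k' := by rw [← Category.assoc, hgl, Category.id_comp]
  set g' := g ≫ k' with hgd
  have hg'd : dag g' = g' := by rw [hgd, dag_comp, hk'd, hg1, hg']
  have hg'2 : g' ≫ g' = k' := by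
    calc g' ≫ g' = (k' ≫ g) ≫ g' := by rw [hg']
      _ = k' := by rw [Category.assoc, hgr, Category.comp_id]
  have hgg' : g' ≫ g = 𝟙 Y := by rw [← hg', hgl]
  have hdiff : (g - g') ≫ dag (g - g') = k + k' - (2 : ℂ) • 𝟙 Y := by
    rw [dag_sub, hg1, hg'd]
    simp only [Preadditive.sub_comp, Preadditive.comp_sub, hg2, hg'2, hgr, hgg', two_smul]
    abel
  have hpos := trL_nonneg (dagPairing p) (g - g')
  rw [hdiff, map_sub, map_add, map_smul, ← e1, ← e2, ← e3, smul_eq_mul, ← two_mul, ← mul_sub] at hpos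
  constructor
  · have h2 : (0 : ℂ) ≤ 2⁻¹ := by simp
    have h3 := mul_nonneg h2 hpos
    rw [inv_mul_cancel_left₀ two_ne_zero] at h3
    exact sub_nonneg.1 h3
  · intro heq
    have h0 : trL (dagPairing p) ((g - g') ≫ dag (g - g')) = 0 := by
      rw [hdiff, map_sub, map_add, map_smul, ← e1, ← e2, ← e3, smul_eq_mul, ← two_mul, ← mul_sub, heq]
      simp
    have := sub_eq_zero.1 (trL_faithful _ h0)
    rw [← hg2]
    nth_rw 1 [this]
    exact hgg'

/-- Standard pairings are unique up to a unitary. -/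
theorem IsStandard.exists_unitary (hC : IsRigid C) {X Y Y' : C} {p : ExactPairing X Y}
    {p' : ExactPairing X Y'} (h : IsStandard p) (h' : IsStandard p') :
    ∃ u : Y ⟶ Y', u ≫ dag u = 𝟙 Y ∧ dag u ≫ u = 𝟙 Y' ∧
      p.coevaluation' ≫ X ◁ u = p'.coevaluation' ∧ u ▷ X ≫ p'.evaluation' = p.evaluation' := by
  obtain ⟨u, w, huw, hwu, h1, h2, h3, h4⟩ := exists_dual_iso p p'
  -- Used in both directions, the comparison makes the two dimensions equal, which is the case of
  -- equality.
  have c1 := h.comparison hC h' huw hwu h1 h4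
  have c2 := h'.comparison hC h hwu huw h3 h2
  have hu := c1.2 (le_antisymm c1.1 c2.1)
  have hw : dag u = w := by
    calc dag u = (w ≫ u) ≫ dag u := by rw [hwu, Category.id_comp]
      _ = w := by rw [Category.assoc, hu, Category.comp_id]
  exact ⟨u, hu, by rw [hw, hwu], h1, h2⟩

theorem IsStandard.trL_eq (hC : IsRigid C) {X Y Y' : C} {p : ExactPairing X Y}
    {p' : ExactPairing X Y'} (h : IsStandard p) (h' : IsStandard p') : trL p = trL p' := by
  obtain ⟨u, h1, -, h3, -⟩ := h.exists_unitary hC h'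
  ext F
  rw [trL_apply, trL_apply, ← h3, dag_comp, dag_whiskerLeft, Category.assoc,
    whisker_exchange_assoc, ← MonoidalCategory.whiskerLeft_comp_assoc, h1]
  simp

/-! ### The trace -/

/-- Transporting a standard pairing along a unitary keeps it standard and conjugates its trace,
while the trace of a standard pairing is unique. -/
theorem IsStandard.conj_unitary (hC : IsRigid C) {X Y : C} {p : ExactPairing X Y}
    (h : IsStandard p) {g : X ⟶ X} (h1 : g ≫ dag g = 𝟙 X) (h2 : dag g ≫ g = 𝟙 X) (F : X ⟶ X) :
    trL p (g ≫ F ≫ dag g) = trL p F := by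
  let i : X ≅ X := ⟨dag g, g, h2, h1⟩
  have eL : ∀ F, trL (congrPairing p i) F = trL p (g ≫ F ≫ dag g) := by
    intro F
    rw [trL_apply, congrPairing_coev, trL_apply]
    simp [dag_comp, dag_whiskerRight, i]
  have eR : ∀ F, trR (congrPairing p i) F = trR p (g ≫ F ≫ dag g) := by
    intro F
    rw [trR_apply, congrPairing_ev, trR_apply]
    simp [dag_comp, dag_whiskerLeft, dag_dag, i]
  have hst : IsStandard (congrPairing p i) := by
    rw [isStandard_iff]
    ext F
    rw [eL, eR, (isStandard_iff _).1 h]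
  rw [← eL, hst.trL_eq hC h]

/-- By linearity and the spectral theorem `G` may be taken to be a projection `e`. Invariance under
the selfadjoint unitary `1 - 2e` gives `tr (eF) + tr (Fe) = 2 tr (eFe)`; replacing `F` by `eF` and
by `Fe` shows that `tr (eF)` and `tr (Fe)` both equal `tr (eFe)`. -/
theorem IsStandard.tracial (hC : IsRigid C) {X Y : C} {p : ExactPairing X Y}
    (h : IsStandard p) (F G : X ⟶ X) : trL p (F ≫ G) = trL p (G ≫ F) := by
  have := finiteDimensional_hom hC X X
  have hG := (trL_state p).mem_span G
  induction hG using Submodule.span_induction with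
  | zero => simp
  | add a b _ _ ha hb => simp [ha, hb]
  | smul c a _ ha => simp [ha]
  | mem e he =>
    obtain ⟨he1, he2⟩ := he
    set g : X ⟶ X := 𝟙 X - (2 : ℂ) • e with hg
    have hgd : dag g = g := by
      rw [hg, dag_sub, dag_smul, he1, dag_id, Complex.conj_ofNat]
    have hgg : g ≫ g = 𝟙 X := by
      simp only [hg, Preadditive.sub_comp, Preadditive.comp_sub, Category.id_comp,
        Category.comp_id, Linear.smul_comp, Linear.comp_smul, he2]
      module
    have key : ∀ F, trL p (e ≫ F) + trL p (F ≫ e) = 2 * trL p (e ≫ F ≫ e) := by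
      intro F
      have h1 := h.conj_unitary hC (by rw [hgd, hgg]) (by rw [hgd, hgg]) F
      rw [hgd] at h1
      simp only [hg, Preadditive.sub_comp, Preadditive.comp_sub, Category.id_comp,
        Category.comp_id, Linear.smul_comp, Linear.comp_smul, map_sub, map_smul, smul_eq_mul] at h1
      linear_combination (-1 / 2 : ℂ) * h1
    have k1 := key (e ≫ F)
    have k2 := key (F ≫ e)
    rw [← Category.assoc e e F, he2, ← Category.assoc e (e ≫ F) e, ← Category.assoc e e F, he2,
      Category.assoc] at k1
    simp only [Category.assoc, he2] at k2
    linear_combination k2 - k1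

/-- The trace on endomorphisms given by a choice of standard pairings. -/
noncomputable def tr (hC : IsRigid C) (X : C) : (X ⟶ X) →ₗ[ℂ] ℂ :=
  trL (exists_standard hC X).choose_spec.choose

theorem tr_eq (hC : IsRigid C) {X Y : C} {p : ExactPairing X Y} (h : IsStandard p) (F : X ⟶ X) :
    tr hC X F = trL p F :=
  DFunLike.congr_fun ((exists_standard hC X).choose_spec.choose_spec.trL_eq hC h) F

theorem tr_id_ne_zero (hC : IsRigid C) {X : C} (hX : 𝟙 X ≠ 0) : tr hC X (𝟙 X) ≠ 0 :=
  (trL_id_pos _ hX).ne'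

/-- The trace property. -/
theorem tr_comm (hC : IsRigid C) {X Z : C} (f : X ⟶ Z) (g : Z ⟶ X) :
    tr hC X (f ≫ g) = tr hC Z (g ≫ f) := by
  obtain ⟨Y, p, hp⟩ := exists_standard hC X
  obtain ⟨Y', p', hp'⟩ := exists_standard hC Z
  -- The morphisms `f` and `g` become off-diagonal endomorphisms of an orthogonal sum of `X` and
  -- `Z`, where the trace of endomorphisms is already known to be cyclic.
  let W : Bool → C := fun b => cond b X Z
  let V : Bool → C := fun b => cond b Y Y'
  obtain ⟨S, v, hv⟩ := exists_orthogonalSum W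
  let q : ∀ b, ExactPairing (W b) (V b) := fun b => match b with
    | true => p
    | false => p'
  have hq : ∀ b, IsStandard (q b) := fun b => match b with
    | true => hp
    | false => hp'
  obtain ⟨T, r, hr, hF⟩ := hv.exists_standard q hq
  let x : S ⟶ X := v true
  let z : S ⟶ Z := v false
  have hx : dag x ≫ x = 𝟙 X := hv.isometry true
  have hz : dag z ≫ z = 𝟙 Z := hv.isometry false
  have hxz : dag x ≫ z = 0 := hv.orthogonal true false (by simp)
  have hzx : dag z ≫ x = 0 := hv.orthogonal false true (by simp)
  have hF' : ∀ F, trL r F = trL p (dag x ≫ F ≫ x) + trL p' (dag z ≫ F ≫ z) := fun F => by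
    rw [hF, Fintype.sum_bool]
  have h := hr.tracial hC (x ≫ f ≫ dag z) (z ≫ g ≫ dag x)
  rw [hF', hF'] at h
  simp only [Category.assoc, reassoc_of% hx, reassoc_of% hz, hx, hz, hxz, hzx, Limits.comp_zero,
    map_zero, add_zero, zero_add,
    Category.comp_id] at h
  rw [tr_eq hC hp, tr_eq hC hp', h]

end Standard

/-! ### The canonical twist -/

section CanonicalTwist

variable {C : Type u} [Category.{v} C] [Preadditive C] [Linear ℂ C] [StarCategory C]
  [MonoidalCategory C] [BraidedCategory C] [IsBraidedCStarTensorCategory C]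

open IsCStarTensorCategory IsBraidedCStarTensorCategory

theorem dag_braiding_inv (X Y : C) : dag (β_ X Y).inv = (β_ X Y).hom := by
  rw [← dag_braiding, dag_dag]

/-- `θ` turns the braided evaluation into the adjoint of the coevaluation. -/
def IsTwistFor {X Y : C} (p : ExactPairing X Y) (θ : X ⟶ X) : Prop :=
  θ ▷ Y ≫ (β_ X Y).hom ≫ p.evaluation' = dag p.coevaluation'

/-- The braided pairing. -/
abbrev swapPairing {X Y : C} (p : ExactPairing X Y) : ExactPairing Y X :=
  BraidedCategory.exactPairing_swap X Y

/-- Unitary braidings cancel in a closed loop, so the traces of the swapped pairing are those of the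
adjoint pairing with left and right exchanged. -/
theorem IsStandard.swap {X Y : C} {p : ExactPairing X Y} (h : IsStandard p) :
    IsStandard (swapPairing p) := by
  rw [isStandard_iff]
  ext K
  have h1 : trL (swapPairing p) K = trR (dagPairing p) K := by
    rw [trR_dagPairing]
    change sc C ((p.coevaluation' ≫ (β_ Y X).inv) ≫ K ▷ X ≫
      dag (p.coevaluation' ≫ (β_ Y X).inv)) = _
    rw [dag_comp, dag_braiding_inv]
    simp
  have h2 : trR (swapPairing p) K = trL (dagPairing p) K := by
    rw [trL_dagPairing]
    change sc C (dag ((β_ X Y).hom ≫ p.evaluation') ≫ X ◁ K ≫ (β_ X Y).hom ≫ p.evaluation') = _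
    rw [dag_comp, dag_braiding]
    simp
  rw [h1, h2, (isStandard_iff _).1 h.adjoint]

/-- The adjoint and the swap of `p` are two standard pairings of `Y` with the same dual `X`; the
unitary of `X` comparing them is the twist. -/
theorem IsStandard.exists_twist (hC : IsRigid C) {X Y : C} {p : ExactPairing X Y}
    (h : IsStandard p) : ∃ θ : X ⟶ X, IsUnitary θ ∧ IsTwistFor p θ := by
  obtain ⟨u, h1, h2, -, h4⟩ := h.adjoint.exists_unitary hC h.swap
  exact ⟨u, ⟨h1, h2⟩, h4⟩

theorem IsTwistFor.unique {X Y : C} {p : ExactPairing X Y} {θ θ' : X ⟶ X} (h : IsTwistFor p θ)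
    (h' : IsTwistFor p θ') : θ = θ' :=
  whiskerRight_ev_cancel (swapPairing p) (h.trans h'.symm)

/-- Once the adjoint coevaluation is replaced by the twisted braided evaluation, `θ` slides through
the self-braiding to the input. What remains is a cup pulled across a strand and then a zigzag. -/
theorem IsTwistFor.twistRight_eq {X Y : C} {p : ExactPairing X Y} {θ : X ⟶ X}
    (h : IsTwistFor p θ) : twistRight p = θ := by
  have hz := p.evaluation_coevaluation'
  unfold IsTwistFor at h
  have hb : X ◁ p.coevaluation' ≫ (α_ X X Y).inv ≫ (β_ X X).hom ▷ Y ≫ (α_ X X Y).hom ≫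
      X ◁ (β_ X Y).hom ≫ (α_ X Y X).inv = (β_ X (𝟙_ C)).hom ≫ p.coevaluation' ▷ X := by
    rw [← BraidedCategory.braiding_naturality_right, BraidedCategory.braiding_tensor_right_hom]
  have h1 : X ◁ p.coevaluation' ≫ (α_ X X Y).inv ≫ (β_ X X).hom ▷ Y ≫ (α_ X X Y).hom ≫
      X ◁ (β_ X Y).hom ≫ X ◁ p.evaluation' = (ρ_ X).hom ≫ (ρ_ X).inv := by
    have := hb =≫ ((α_ X Y X).hom ≫ X ◁ p.evaluation')
    simp only [Category.assoc, Iso.inv_hom_id_assoc] at this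
    rw [this, hz]
    simp
  have h2 : (β_ X X).hom ▷ Y ≫ (α_ X X Y).hom ≫ X ◁ θ ▷ Y =
      θ ▷ X ▷ Y ≫ (β_ X X).hom ▷ Y ≫ (α_ X X Y).hom := by
    rw [← associator_naturality_middle, ← comp_whiskerRight_assoc,
      ← BraidedCategory.braiding_naturality_left, comp_whiskerRight_assoc]
  have h3 : X ◁ p.coevaluation' ≫ (α_ X X Y).inv ≫ θ ▷ X ▷ Y =
      θ ▷ 𝟙_ C ≫ X ◁ p.coevaluation' ≫ (α_ X X Y).inv := by
    rw [← whisker_exchange_assoc]; simp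
  rw [twistRight, ← h]
  simp only [MonoidalCategory.whiskerLeft_comp, Category.assoc]
  rw [reassoc_of% h2, reassoc_of% h3, reassoc_of% h1]
  simp

/-- Here the defining relation has to be solved for the adjoint of the evaluation, and this
inversion is where unitarity of `θ` enters. -/
theorem IsTwistFor.twistLeft_eq {X Y : C} {p : ExactPairing X Y} {θ : X ⟶ X}
    (h : IsTwistFor p θ) (hθ : IsUnitary θ) : twistLeft p = θ := by
  have hz := p.evaluation_coevaluation'
  unfold IsTwistFor at h
  have hd : dag p.evaluation' = p.coevaluation' ≫ θ ▷ Y ≫ (β_ X Y).hom := by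
    have h1 := congrArg dag h
    rw [dag_dag, dag_comp, dag_comp, dag_whiskerRight, dag_braiding] at h1
    rw [← h1]
    simp only [Category.assoc]
    rw [← comp_whiskerRight_assoc, hθ.2]
    simp
  have h1 : (β_ X Y).hom ▷ X ≫ (α_ Y X X).hom ≫ Y ◁ (β_ X X).hom ≫ (α_ Y X X).inv ≫
      p.evaluation' ▷ X = (α_ X Y X).hom ≫ X ◁ p.evaluation' ≫ (β_ X (𝟙_ C)).hom := by
    rw [BraidedCategory.braiding_naturality_right, BraidedCategory.braiding_tensor_right_hom]
    simp
  have h2 : (p.coevaluation' ≫ θ ▷ Y) ▷ X ≫ (α_ X Y X).hom ≫ X ◁ p.evaluation' =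
      (λ_ X).hom ≫ θ ≫ (ρ_ X).inv := by
    rw [comp_whiskerRight, Category.assoc, associator_naturality_left_assoc, ← whisker_exchange,
      reassoc_of% hz]
    simp
  rw [twistLeft, hd]
  simp only [comp_whiskerRight, Category.assoc]
  simp only [comp_whiskerRight, Category.assoc] at h2
  rw [reassoc_of% h1, reassoc_of% h2]
  simp

theorem IsTwistFor.transport {X Y Y' : C} {p : ExactPairing X Y} {p' : ExactPairing X Y'}
    {θ : X ⟶ X} (h : IsTwistFor p θ) {u : Y ⟶ Y'} (h2 : dag u ≫ u = 𝟙 Y')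
    (hc : p.coevaluation' ≫ X ◁ u = p'.coevaluation')
    (he : u ▷ X ≫ p'.evaluation' = p.evaluation') : IsTwistFor p' θ := by
  unfold IsTwistFor at *
  rw [← hc, dag_comp, dag_whiskerLeft, ← h, ← he, whisker_exchange_assoc,
    BraidedCategory.braiding_naturality_right_assoc, ← comp_whiskerRight_assoc, h2]
  simp

theorem IsTwistFor.isUnitary (hC : IsRigid C) {X Y : C} {p : ExactPairing X Y} (hp : IsStandard p)
    {θ : X ⟶ X} (h : IsTwistFor p θ) : IsUnitary θ := by
  obtain ⟨θ', h1, h2⟩ := hp.exists_twist hC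
  rwa [h.unique h2]

/-- The relation for one standard pairing transports to every other by the unitary between the
duals, and for each of them it yields both twist formulas. -/
theorem IsTwistFor.isCanonicalTwistAt (hC : IsRigid C) {X Y : C} {p : ExactPairing X Y}
    (hp : IsStandard p) {θ : X ⟶ X} (h : IsTwistFor p θ) : IsCanonicalTwistAt X θ := by
  refine ⟨⟨Y, p, hp⟩, fun Y' p' hp' => ?_⟩
  obtain ⟨u, -, h2, h3, h4⟩ := hp.exists_unitary hC hp'
  have h' := h.transport h2 h3 h4
  exact ⟨(h'.twistLeft_eq (h.isUnitary hC hp)).symm, h'.twistRight_eq.symm⟩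

theorem IsCanonicalTwistAt.isTwistFor (hC : IsRigid C) {X Y : C} {p : ExactPairing X Y}
    (hp : IsStandard p) {θ : X ⟶ X} (h : IsCanonicalTwistAt X θ) : IsTwistFor p θ := by
  obtain ⟨θ', h1, h2⟩ := hp.exists_twist hC
  rwa [(h.2 Y p hp).2, h2.twistRight_eq]

theorem isStandard_unit : IsStandard (exactPairingUnit : ExactPairing (𝟙_ C) (𝟙_ C)) := by
  intro F
  change (ρ_ _).inv ≫ F ▷ 𝟙_ C ≫ dag (ρ_ _).inv = dag (ρ_ _).hom ≫ 𝟙_ C ◁ F ≫ (ρ_ _).hom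
  have h1 : F ▷ 𝟙_ C ≫ (ρ_ _).hom = (ρ_ _).hom ≫ F := rightUnitor_naturality F
  have h2 : 𝟙_ C ◁ F ≫ (ρ_ _).hom = (ρ_ _).hom ≫ F := by
    rw [← unitors_equal]; exact leftUnitor_naturality F
  rw [dag_rightUnitor, dag_rightUnitor_inv, h1, h2]

theorem isCanonicalTwistAt_unit (hC : IsRigid C) : IsCanonicalTwistAt (𝟙_ C) (𝟙 (𝟙_ C)) := by
  refine IsTwistFor.isCanonicalTwistAt hC isStandard_unit ?_
  change 𝟙 (𝟙_ C) ▷ 𝟙_ C ≫ (β_ (𝟙_ C) (𝟙_ C)).hom ≫ (ρ_ (𝟙_ C)).hom = dag (ρ_ (𝟙_ C)).inv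
  have h1 : (β_ (𝟙_ C) (𝟙_ C)).hom ≫ (ρ_ (𝟙_ C)).hom = (λ_ (𝟙_ C)).hom :=
    braiding_rightUnitor _
  rw [dag_rightUnitor_inv, h1, id_whiskerRight, Category.id_comp, unitors_equal]

theorem IsCanonicalTwistAt.unique {X : C} {θ θ' : X ⟶ X} (h : IsCanonicalTwistAt X θ)
    (h' : IsCanonicalTwistAt X θ') : θ = θ' := by
  obtain ⟨⟨Y, p, hp⟩, h1⟩ := h
  rw [(h1 Y p hp).1, ← (h'.2 Y p hp).1]

end CanonicalTwist

/-! ### Unitary tensor products of single-valued modules -/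

section Existence

variable {C : Type u} [Category.{v} C] [Preadditive C] [Linear ℂ C] [StarCategory C]
  [MonoidalCategory C] [BraidedCategory C] [IsBraidedCStarTensorCategory C] {A : C} [MonObj A]

open IsCStarTensorCategory IsBraidedCStarTensorCategory

/-- No compatibility of `f` with the action is needed, so the same lemma serves images of
projections and summands of direct sums. -/
theorem IsUnitaryLeft.compress {Y Z : C} {b : A ⊗ Z ⟶ Z} (hb : IsUnitaryLeft A b) (f : Y ⟶ Z) :
    IsUnitaryLeft A (A ◁ f ≫ b ≫ dag f) := by
  unfold IsUnitaryLeft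
  conv_lhs => rw [hb]
  simp only [dag_comp, dag_dag, dag_whiskerLeft, MonoidalCategory.whiskerLeft_comp, Category.assoc]
  rw [associator_inv_naturality_right_assoc, whisker_exchange_assoc, leftUnitor_naturality]

/-- The image of a projection commuting with a unitary left action, as a module. -/
def RepU.ofProjection {M Y : C} (a : A ⊗ M ⟶ M) (one_act : η[A] ▷ M ≫ a = (λ_ M).hom)
    (assoc : μ[A] ▷ M ≫ a = (α_ A A M).hom ≫ A ◁ a ≫ a) (unitary : IsUnitaryLeft A a)
    (q : M ⟶ Y) (hq : dag q ≫ q = 𝟙 Y) (hl : A ◁ (q ≫ dag q) ≫ a = a ≫ q ≫ dag q)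
    (hs : (β_ A M).hom ≫ (β_ M A).hom ≫ a ≫ q = a ≫ q) : RepU A where
  obj := Y
  act := A ◁ dag q ≫ a ≫ q
  one_act := by
    rw [← whisker_exchange_assoc, reassoc_of% one_act, leftUnitor_naturality_assoc, hq,
      Category.comp_id]
  assoc := by
    have h : A ◁ q ≫ A ◁ dag q ≫ a ≫ q = a ≫ q := by
      rw [← MonoidalCategory.whiskerLeft_comp_assoc, reassoc_of% hl, hq, Category.comp_id]
    simp only [MonoidalCategory.whiskerLeft_comp, Category.assoc]
    rw [h, ← whisker_exchange_assoc, reassoc_of% assoc]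
    simp
  unitary := by simpa [dag_dag] using unitary.compress (dag q)
  singleValued := by
    rw [← BraidedCategory.braiding_naturality_left_assoc,
      ← BraidedCategory.braiding_naturality_right_assoc, hs]

/-- A projection commuting with a unitary left action splits over a single-valued module. -/
theorem RepU.exists_split {M : C} {a : A ⊗ M ⟶ M} (one_act : η[A] ▷ M ≫ a = (λ_ M).hom)
    (assoc : μ[A] ▷ M ≫ a = (α_ A A M).hom ≫ A ◁ a ≫ a) (unitary : IsUnitaryLeft A a)
    {e : M ⟶ M} (he : e ≫ e = e) (hd : dag e = e) (hl : A ◁ e ≫ a = a ≫ e)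
    (hs : (β_ A M).hom ≫ (β_ M A).hom ≫ a ≫ e = a ≫ e) :
    ∃ (P : RepU A) (q : M ⟶ P.obj), dag q ≫ q = 𝟙 P.obj ∧ q ≫ dag q = e ∧
      A ◁ q ≫ P.act = a ≫ q := by
  obtain ⟨Y, q, hq, hqq⟩ := exists_subobject M e he hd
  have heq : e ≫ q = q := by rw [← hqq, Category.assoc, hq, Category.comp_id]
  rw [← hqq] at hl
  refine ⟨RepU.ofProjection a one_act assoc unitary q hq hl ?_, q, hq, hqq, ?_⟩
  · have := hs =≫ q
    simpa [heq] using this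
  · change A ◁ q ≫ A ◁ dag q ≫ a ≫ q = a ≫ q
    rw [← MonoidalCategory.whiskerLeft_comp_assoc, reassoc_of% hl, hq, Category.comp_id]

namespace RepU

variable [IsQSystem A] [IsCommMonObj A]

theorem act_dag_act (X : RepU A) :
    A ◁ dag X.act ≫ (α_ A A X.obj).inv ≫ μ[A] ▷ X.obj = X.act ≫ dag X.act :=
  dag_linear (tensor_unitaryLeft (unitObj (A := A)).unitary X.obj) X.unitary (f := X.act) (by
    rw [Category.assoc, X.assoc, Iso.inv_hom_id_assoc])

/-- This repeats `dag_act_act` without a choice of tensor products, as it is needed to construct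
one. -/
theorem dag_act_comp_act (X : RepU A) : dag X.act ≫ X.act = dA A • 𝟙 X.obj := by
  rw [dag_act X.unitary]
  simp only [Category.assoc]
  rw [← X.assoc, ← comp_whiskerRight_assoc, Category.assoc, dag_mul_mul]
  simp [X.one_act]

theorem dag_actR_comp_actR (X : RepU A) : dag X.actR ≫ X.actR = dA A • 𝟙 X.obj := by
  rw [actR, dag_comp, dag_braiding]
  simp [dag_act_comp_act]

theorem dag_actR (X : RepU A) : dag X.actR =
    (ρ_ X.obj).inv ≫ X.obj ◁ (η[A] ≫ dag μ[A]) ≫ (α_ X.obj A A).inv ≫ X.actR ▷ A := by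
  have h : X.actR = dag X.actR ▷ A ≫ (α_ X.obj A A).hom ≫ X.obj ◁ evA A ≫ (ρ_ X.obj).hom :=
    X.bim.unitaryR
  conv_lhs => rw [h]
  simp [evA, dag_comp, dag_whiskerLeft, dag_whiskerRight, dag_associator, dag_rightUnitor,
    dag_dag]

/-- The multiple `d` of the projection of `X ⊗ Y` onto `X ⊗_A Y`. -/
def balancing (X Y : RepU A) : X.obj ⊗ Y.obj ⟶ X.obj ⊗ Y.obj :=
  dag X.actR ▷ Y.obj ≫ (α_ X.obj A Y.obj).hom ≫ X.obj ◁ Y.act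

/-- By unitarity both adjoint actions consist of a cup of two `A`-strands followed by an action, so
`balancing` and its adjoint are the same diagram: a cup with one leg absorbed by each module. -/
theorem dag_balancing (X Y : RepU A) : dag (balancing X Y) = balancing X Y := by
  have h : dag (balancing X Y) = X.obj ◁ dag Y.act ≫ (α_ X.obj A Y.obj).inv ≫
      X.actR ▷ Y.obj := by
    simp [balancing, dag_comp, dag_whiskerLeft, dag_whiskerRight, dag_associator, dag_dag]
  rw [h, balancing, dag_actR, dag_act Y.unitary]
  calc X.obj ◁ ((λ_ Y.obj).inv ≫ (η[A] ≫ dag μ[A]) ▷ Y.obj ≫ (α_ A A Y.obj).hom ≫ A ◁ Y.act) ≫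
        (α_ X.obj A Y.obj).inv ≫ X.actR ▷ Y.obj
      = 𝟙 _ ⊗≫ X.obj ◁ (η[A] ≫ dag μ[A]) ▷ Y.obj ⊗≫
          ((X.obj ⊗ A) ◁ Y.act ≫ X.actR ▷ Y.obj) ⊗≫ 𝟙 _ := by monoidal
    _ = 𝟙 _ ⊗≫ X.obj ◁ (η[A] ≫ dag μ[A]) ▷ Y.obj ⊗≫
          (X.actR ▷ (A ⊗ Y.obj) ≫ X.obj ◁ Y.act) ⊗≫ 𝟙 _ := by rw [whisker_exchange]
    _ = _ := by monoidal

theorem balancing_eq (X Y : RepU A) : balancing X Y =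
    X.obj ◁ dag Y.act ≫ (α_ X.obj A Y.obj).inv ≫ X.actR ▷ Y.obj := by
  rw [← dag_balancing]
  simp [balancing, dag_comp, dag_whiskerLeft, dag_whiskerRight, dag_associator, dag_dag]

theorem balanced_balancing (X Y : RepU A) : X.actR ▷ Y.obj ≫ balancing X Y =
    (α_ X.obj A Y.obj).hom ≫ X.obj ◁ Y.act ≫ balancing X Y := by
  have h : X.actR ▷ A ≫ X.actR = (α_ X.obj A A).hom ≫ X.obj ◁ μ[A] ≫ X.actR := X.bim.assocR
  rw [balancing_eq, ← MonoidalCategory.whiskerLeft_comp_assoc, ← act_dag_act]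
  calc X.actR ▷ Y.obj ≫ X.obj ◁ dag Y.act ≫ (α_ X.obj A Y.obj).inv ≫ X.actR ▷ Y.obj
      = (X.obj ⊗ A) ◁ dag Y.act ⊗≫ (X.actR ▷ A ≫ X.actR) ▷ Y.obj := by
        rw [← whisker_exchange_assoc]; monoidal
    _ = _ := by rw [h]; monoidal

theorem balancing_comp (X Y : RepU A) {Z : C} (f : X.obj ⊗ Y.obj ⟶ Z)
    (h : X.actR ▷ Y.obj ≫ f = (α_ X.obj A Y.obj).hom ≫ X.obj ◁ Y.act ≫ f) :
    balancing X Y ≫ f = dA A • f := by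
  rw [balancing, Category.assoc, Category.assoc, ← h, ← comp_whiskerRight_assoc,
    dag_actR_comp_actR]
  simp

theorem balancing_linear (X Y : RepU A) :
    A ◁ balancing X Y ≫ (α_ A X.obj Y.obj).inv ≫ X.act ▷ Y.obj =
      ((α_ A X.obj Y.obj).inv ≫ X.act ▷ Y.obj) ≫ balancing X Y := by
  have h : A ◁ dag X.actR ≫ (α_ A X.obj A).inv ≫ X.act ▷ A = X.act ≫ dag X.actR :=
    dag_linear (tensor_unitaryLeft X.unitary A) X.unitary (f := X.actR) (by
      rw [Category.assoc, X.actR_assocM, Iso.inv_hom_id_assoc])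
  calc A ◁ balancing X Y ≫ (α_ A X.obj Y.obj).inv ≫ X.act ▷ Y.obj
      = 𝟙 _ ⊗≫ A ◁ dag X.actR ▷ Y.obj ⊗≫ ((A ⊗ X.obj) ◁ Y.act ≫ X.act ▷ Y.obj) ⊗≫ 𝟙 _ := by
        rw [balancing]; monoidal
    _ = 𝟙 _ ⊗≫ (A ◁ dag X.actR ≫ (α_ A X.obj A).inv ≫ X.act ▷ A) ▷ Y.obj ⊗≫
          X.obj ◁ Y.act ⊗≫ 𝟙 _ := by rw [whisker_exchange]; monoidal
    _ = _ := by rw [h, balancing]; monoidal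

/-- Balancedness lets the `A`-strand act on either factor, so its winding around `X` and its winding
around `Y` are absorbed by single-valuedness of each factor in turn. -/
theorem tensor_singleValued (X Y : RepU A) {Z : C} (f : X.obj ⊗ Y.obj ⟶ Z)
    (h : X.actR ▷ Y.obj ≫ f = (α_ X.obj A Y.obj).hom ≫ X.obj ◁ Y.act ≫ f) :
    (β_ A (X.obj ⊗ Y.obj)).hom ≫ (β_ (X.obj ⊗ Y.obj) A).hom ≫
      ((α_ A X.obj Y.obj).inv ≫ X.act ▷ Y.obj) ≫ f =
        ((α_ A X.obj Y.obj).inv ≫ X.act ▷ Y.obj) ≫ f := by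
  have h1 : (β_ X.obj A).hom ▷ Y.obj ≫ X.act ▷ Y.obj = X.actR ▷ Y.obj := by
    rw [← comp_whiskerRight]; rfl
  have h2 : X.obj ◁ (β_ A Y.obj).hom ≫ X.obj ◁ (β_ Y.obj A).hom ≫ X.obj ◁ Y.act =
      X.obj ◁ Y.act := by
    rw [← MonoidalCategory.whiskerLeft_comp, ← MonoidalCategory.whiskerLeft_comp, Y.singleValued]
  have h3 : (β_ A X.obj).hom ▷ Y.obj ≫ X.actR ▷ Y.obj = X.act ▷ Y.obj := by
    rw [← comp_whiskerRight]; exact congrArg (· ▷ Y.obj) X.singleValued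
  rw [BraidedCategory.braiding_tensor_right_hom, BraidedCategory.braiding_tensor_left_hom]
  simp only [Category.assoc, Iso.hom_inv_id_assoc, Iso.inv_hom_id_assoc]
  rw [reassoc_of% h1, h, Iso.inv_hom_id_assoc, reassoc_of% h2, ← h, reassoc_of% h3]

theorem tensor_actR (X Y : RepU A) {Z : C} (f : X.obj ⊗ Y.obj ⟶ Z)
    (h : X.actR ▷ Y.obj ≫ f = (α_ X.obj A Y.obj).hom ≫ X.obj ◁ Y.act ≫ f) :
    (β_ (X.obj ⊗ Y.obj) A).hom ≫ (α_ A X.obj Y.obj).inv ≫ X.act ▷ Y.obj ≫ f =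
      (α_ X.obj Y.obj A).hom ≫ X.obj ◁ Y.actR ≫ f := by
  have h1 : (β_ X.obj A).hom ▷ Y.obj ≫ X.act ▷ Y.obj = X.actR ▷ Y.obj := by
    rw [← comp_whiskerRight]; rfl
  have h2 : X.obj ◁ (β_ Y.obj A).hom ≫ X.obj ◁ Y.act = X.obj ◁ Y.actR := by
    rw [← MonoidalCategory.whiskerLeft_comp]; rfl
  rw [BraidedCategory.braiding_tensor_left_hom]
  simp only [Category.assoc, Iso.hom_inv_id_assoc]
  rw [reassoc_of% h1, h, Iso.inv_hom_id_assoc, reassoc_of% h2]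

theorem exists_dA_sqrt : ∃ r : ℂ, r ≠ 0 ∧ (starRingEnd ℂ) r = r ∧ r * r = dA A := by
  have h := (IsQSystem.special (A := A)).choose_spec.1
  refine ⟨Real.sqrt (IsQSystem.special (A := A)).choose, ?_, Complex.conj_ofReal _, ?_⟩
  · exact_mod_cast (Real.sqrt_pos.2 h).ne'
  · rw [dA, ← Complex.ofReal_mul, Real.mul_self_sqrt h.le]

theorem exists_tensorProduct (X Y : RepU A) : ∃ (P : RepU A) (m : X.obj ⊗ Y.obj ⟶ P.obj),
    IsUnitaryTensorProduct X.bim Y.bim P.bim m := by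
  have hd := dA_ne (A := A)
  have hdr : (starRingEnd ℂ) (dA A) = dA A := by simp [dA]
  have hb := balanced_balancing X Y
  obtain ⟨P, q, hq, hqq, hl⟩ := RepU.exists_split (a := (α_ A X.obj Y.obj).inv ≫ X.act ▷ Y.obj)
    (e := (dA A)⁻¹ • balancing X Y)
    (by
      have h := congrArg (· ▷ Y.obj) X.one_act
      simp only [comp_whiskerRight] at h
      rw [associator_inv_naturality_left_assoc, h]; simp)
    (by
      have h := congrArg (· ▷ Y.obj) X.assoc
      simp only [comp_whiskerRight] at h
      rw [associator_inv_naturality_left_assoc, h]; monoidal)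
    (tensor_unitaryLeft X.unitary _)
    (by rw [Linear.smul_comp, Linear.comp_smul, balancing_comp X Y _ hb, inv_smul_smul₀ hd])
    (by rw [dag_smul, dag_balancing, map_inv₀, hdr])
    (by rw [MonoidalLinear.whiskerLeft_smul, Linear.smul_comp, Linear.comp_smul, balancing_linear])
    (by rw [Linear.comp_smul, Linear.comp_smul, Linear.comp_smul, tensor_singleValued X Y _ hb])
  have hq' : balancing X Y ≫ q = dA A • q := by
    have h : ((dA A)⁻¹ • balancing X Y) ≫ q = q := by rw [← hqq, Category.assoc, hq]; simp
    rw [Linear.smul_comp, inv_smul_eq_iff₀ hd] at h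
    exact h
  have hqb : X.actR ▷ Y.obj ≫ q = (α_ X.obj A Y.obj).hom ≫ X.obj ◁ Y.act ≫ q := by
    have h := hb =≫ q
    simp only [Category.assoc, hq', Linear.comp_smul] at h
    exact smul_right_injective _ hd h
  have hr : q ▷ A ≫ P.actR = (α_ X.obj Y.obj A).hom ≫ X.obj ◁ Y.actR ≫ q := by
    rw [actR, BraidedCategory.braiding_naturality_left_assoc, hl, Category.assoc,
      tensor_actR X Y q hqb]
  -- The isometric splitting has `q ≫ dag q = d⁻¹ • balancing`; the factor `r = √d` gives the
  -- required `m ≫ dag m = balancing`.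
  obtain ⟨r, hr0', hrc, hrr⟩ := exists_dA_sqrt (A := A)
  refine ⟨P, r • q, ?_, ?_, ?_, ?_, ?_⟩
  · change A ◁ (r • q) ≫ P.act = (α_ A X.obj Y.obj).inv ≫ X.act ▷ Y.obj ≫ (r • q)
    rw [MonoidalLinear.whiskerLeft_smul, Linear.smul_comp, hl]
    simp
  · change (r • q) ▷ A ≫ P.actR = (α_ X.obj Y.obj A).hom ≫ X.obj ◁ Y.actR ≫ (r • q)
    rw [MonoidalLinear.smul_whiskerRight, Linear.smul_comp, hr]
    simp
  · change X.actR ▷ Y.obj ≫ (r • q) =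
      (α_ X.obj A Y.obj).hom ≫ X.obj ◁ Y.act ≫ (r • q)
    rw [Linear.comp_smul, hqb]
    simp
  · suffices H : ∀ (K : UnitaryBimodule A) (f : X.obj ⊗ Y.obj ⟶ K.obj),
        A ◁ f ≫ K.actL = (α_ A X.obj Y.obj).inv ≫ X.act ▷ Y.obj ≫ f →
        f ▷ A ≫ K.actR = (α_ X.obj Y.obj A).hom ≫ X.obj ◁ Y.actR ≫ f →
        X.actR ▷ Y.obj ≫ f = (α_ X.obj A Y.obj).hom ≫ X.obj ◁ Y.act ≫ f →
        ∃! g : P.obj ⟶ K.obj, A ◁ g ≫ K.actL = P.act ≫ g ∧ g ▷ A ≫ K.actR = P.actR ≫ g ∧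
          (r • q) ≫ g = f from H
    intro K f h1' h2' h3'
    have hE : IsSplitEpi q := ⟨⟨⟨dag q, hq⟩⟩⟩
    have hE1 : IsSplitEpi (A ◁ q) := isSplitEpi_whiskerLeft A q
    have hE2 : IsSplitEpi (q ▷ A) := isSplitEpi_whiskerRight A q
    -- A balanced `f` factors through the image of the balancing projection, and the factor is
    -- unique because `q` is split epi.
    have hqf : q ≫ (r⁻¹ • (dag q ≫ f)) = r⁻¹ • f := by
      rw [Linear.comp_smul, reassoc_of% hqq, Linear.smul_comp, balancing_comp X Y f h3',
        inv_smul_smul₀ hd]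
    refine ⟨r⁻¹ • (dag q ≫ f), ⟨?_, ?_, ?_⟩, ?_⟩
    · rw [← cancel_epi (A ◁ q), ← MonoidalCategory.whiskerLeft_comp_assoc, hqf, reassoc_of% hl,
        hqf, MonoidalLinear.whiskerLeft_smul, Linear.smul_comp, h1']
      simp
    · rw [← cancel_epi (q ▷ A), ← comp_whiskerRight_assoc, hqf, reassoc_of% hr,
        hqf, MonoidalLinear.smul_whiskerRight, Linear.smul_comp, h2']
      simp
    · rw [Linear.smul_comp, hqf, smul_inv_smul₀ hr0']
    · rintro g ⟨-, -, hg⟩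
      rw [← cancel_epi q, hqf, ← hg, Linear.smul_comp, inv_smul_smul₀ hr0']
  · change (r • q) ≫ dag (r • q) = balancing X Y
    rw [dag_smul, Linear.smul_comp, Linear.comp_smul, hqq, smul_smul, smul_smul, hrc,
      hrr, mul_inv_cancel₀ hd, one_smul]

variable (A) in
theorem nonempty_unitaryTensorSystem : Nonempty (UnitaryTensorSystem A) := by
  choose P m h using exists_tensorProduct (A := A)
  exact ⟨⟨P, m, h⟩⟩

end RepU

end Existence

/-! ### The C*-structure of the category of modules -/

theorem exists_limit_of_finiteDimensional {V : Type*} [AddCommGroup V] [Module ℂ V]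
    [FiniteDimensional ℂ V] (p : Seminorm ℂ V) (hp : ∀ x, p x = 0 → x = 0) (s : ℕ → V)
    (hs : ∀ ε > 0, ∃ n, ∀ i ≥ n, ∀ j ≥ n, p (s i - s j) < ε) :
    ∃ x, ∀ ε > 0, ∃ n, ∀ i ≥ n, p (s i - x) < ε := by
  let _ : NormedAddCommGroup V := AddGroupNorm.toNormedAddCommGroup
    { p.toAddGroupSeminorm with eq_zero_of_map_eq_zero' := hp }
  let _ : NormedSpace ℂ V := ⟨fun c x => (map_smul_eq_mul p c x).le⟩
  have hc : CompleteSpace V := FiniteDimensional.complete ℂ V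
  have h : CauchySeq s := by
    rw [Metric.cauchySeq_iff]
    intro ε hε
    obtain ⟨n, hn⟩ := hs ε hε
    refine ⟨n, fun i hi j hj => ?_⟩
    rw [dist_eq_norm]
    exact hn i hi j hj
  obtain ⟨x, hx⟩ := cauchySeq_tendsto_of_complete h
  refine ⟨x, fun ε hε => ?_⟩
  obtain ⟨n, hn⟩ := Metric.tendsto_atTop.1 hx ε hε
  refine ⟨n, fun i hi => ?_⟩
  have := hn i hi
  rw [dist_eq_norm] at this
  exact this

section ModuleCStar

variable {C : Type u} [Category.{v} C] [Preadditive C] [Linear ℂ C] [StarCategory C]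
  [MonoidalCategory C] [BraidedCategory C] [IsBraidedCStarTensorCategory C] {A : C} [MonObj A]

open IsCStarTensorCategory IsBraidedCStarTensorCategory

namespace RepU

/-- The underlying morphism, as a linear map. -/
def homLinear (X Y : RepU A) : (X ⟶ Y) →ₗ[ℂ] (X.obj ⟶ Y.obj) where
  toFun f := f.hom
  map_add' _ _ := rfl
  map_smul' _ _ := rfl

theorem homLinear_injective (X Y : RepU A) : Function.Injective (homLinear X Y) :=
  fun _ _ h => hom_ext h

@[simp] theorem zero_hom (X Y : RepU A) : (0 : X ⟶ Y).hom = 0 := rfl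
@[simp] theorem add_hom {X Y : RepU A} (f g : X ⟶ Y) : (f + g).hom = f.hom + g.hom := rfl
@[simp] theorem smul_hom {X Y : RepU A} (c : ℂ) (f : X ⟶ Y) : (c • f).hom = c • f.hom := rfl
@[simp] theorem dag_hom {X Y : RepU A} (f : X ⟶ Y) : (dag f).hom = dag f.hom := rfl
@[simp] theorem sum_hom {J : Type*} (s : Finset J) {X Y : RepU A} (f : J → (X ⟶ Y)) :
    (∑ i ∈ s, f i).hom = ∑ i ∈ s, (f i).hom := map_sum (homLinear X Y) f s

theorem finiteDimensional_hom (hC : IsRigid C) (X Y : RepU A) : FiniteDimensional ℂ (X ⟶ Y) :=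
  have := CStarRep.finiteDimensional_hom hC X.obj Y.obj
  FiniteDimensional.of_injective (homLinear X Y) (homLinear_injective X Y)

theorem isCStarCategory (hC : IsRigid C) : IsCStarCategory (RepU A) where
  exists_norm := by
    obtain ⟨N, h1, h2, h3, -⟩ := IsCStarCategory.exists_norm (C := C)
    refine ⟨fun X Y => (N X.obj Y.obj).comp (homLinear X Y), fun f hf => hom_ext (h1 f.hom hf),
      fun f g => h2 f.hom g.hom, fun f => h3 f.hom, fun {X Y} s hs => ?_⟩
    have := finiteDimensional_hom hC X Y
    exact exists_limit_of_finiteDimensional _ (fun f hf => hom_ext (h1 f.hom hf)) s hs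
  exists_sqrt {X Y} f := by
    obtain ⟨Z, ⟨p⟩⟩ := hC X.obj
    have := finiteDimensional_hom hC X X
    -- The square root has to be a module morphism, so the spectral theorem is applied to module
    -- endomorphisms, with the functional restricted from `C`.
    have hφ : IsFaithfulState (trL p ∘ₗ homLinear X X) :=
      ⟨fun a => trL_nonneg p a.hom, fun a h => hom_ext (trL_faithful p (a := a.hom) h)⟩
    obtain ⟨g, h1, h2⟩ := hφ.exists_sqrt (h := f ≫ dag f) (by rw [dag_comp, dag_dag]) (fun a => by
      have h := trL_nonneg p (a.hom ≫ f.hom)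
      simp only [dag_comp, Category.assoc] at h ⊢
      exact h)
    exact ⟨g, by rw [h1, h2]⟩

theorem isUnitaryLeft_sum {J : Type*} (s : Finset J) {X : C} {a : J → (A ⊗ X ⟶ X)}
    (h : ∀ i, IsUnitaryLeft A (a i)) : IsUnitaryLeft A (∑ i ∈ s, a i) := by
  unfold IsUnitaryLeft
  rw [dag_sum, whiskerLeft_sum', Preadditive.sum_comp]
  exact Finset.sum_congr rfl fun i _ => h i

theorem exists_directSum {J : Type*} [Fintype J] (W : J → RepU A) :
    ∃ (X : RepU A) (v : ∀ s, X ⟶ W s), IsOrthogonalSum v := by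
  obtain ⟨X, v, hv⟩ := exists_orthogonalSum fun s => (W s).obj
  let a : A ⊗ X ⟶ X := ∑ s, A ◁ v s ≫ (W s).act ≫ dag (v s)
  have ha : ∀ t, a ≫ v t = A ◁ v t ≫ (W t).act := by
    intro t
    rw [Preadditive.sum_comp, Finset.sum_eq_single t]
    · simp [hv.isometry]
    · intro s _ hs
      simp [hv.orthogonal s t hs]
    · simp
  have hext : ∀ {Z : C} {f g : Z ⟶ X}, (∀ t, f ≫ v t = g ≫ v t) → f = g := by
    intro Z f g h
    rw [← Category.comp_id f, ← Category.comp_id g, ← hv.sum, Preadditive.comp_sum,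
      Preadditive.comp_sum]
    exact Finset.sum_congr rfl fun t _ => by rw [reassoc_of% (h t)]
  let M : RepU A :=
    { obj := X
      act := a
      one_act := hext fun t => by
        rw [Category.assoc, ha, ← whisker_exchange_assoc, (W t).one_act, leftUnitor_naturality]
      assoc := hext fun t => by
        simp only [Category.assoc]
        rw [ha, ← MonoidalCategory.whiskerLeft_comp_assoc, ha, ← whisker_exchange_assoc,
          (W t).assoc]
        simp
      unitary := isUnitaryLeft_sum _ fun s => (W s).unitary.compress (v s)
      singleValued := hext fun t => by
        simp only [Category.assoc]
        rw [ha, ← BraidedCategory.braiding_naturality_left_assoc,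
          ← BraidedCategory.braiding_naturality_right_assoc, (W t).singleValued] }
  refine ⟨M, fun s => ⟨v s, (ha s).symm⟩, fun s => hom_ext (hv.isometry s),
    fun s t h => hom_ext (hv.orthogonal s t h), hom_ext ?_⟩
  rw [sum_hom]
  exact hv.sum

theorem exists_subobject (X : RepU A) (e : X ⟶ X) (he : e ≫ e = e) (hd : dag e = e) :
    ∃ (Y : RepU A) (p : X ⟶ Y), dag p ≫ p = 𝟙 Y ∧ p ≫ dag p = e := by
  obtain ⟨P, q, h1, h2, h3⟩ := exists_split X.one_act X.assoc X.unitary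
    (e := e.hom) (congrArg Hom.hom he) (congrArg Hom.hom hd) e.comm
    (by rw [reassoc_of% X.singleValued])
  exact ⟨P, ⟨q, h3⟩, hom_ext h1, hom_ext h2⟩

variable [IsQSystem A] [IsCommMonObj A]

theorem conj_dA : (starRingEnd ℂ) (dA A) = dA A := by simp [dA]

theorem unit_point_injective {X : RepU A} {f g : unitObj (A := A) ⟶ X}
    (h : η[A] ≫ f.hom = η[A] ≫ g.hom) : f = g := by
  have key : ∀ k : unitObj (A := A) ⟶ X, k.hom = (ρ_ A).inv ≫ A ◁ (η[A] ≫ k.hom) ≫ X.act := by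
    intro k
    have hk : A ◁ k.hom ≫ X.act = μ[A] ≫ k.hom := k.comm
    rw [MonoidalCategory.whiskerLeft_comp, Category.assoc, hk, ← Category.assoc (A ◁ η[A]),
      MonObj.mul_one]
    simp
  exact hom_ext (by rw [key f, key g, h])

/-- The module morphism `A ⟶ X` attached to a morphism `𝟙 ⟶ X`. -/
def ofPoint {X : RepU A} (x : 𝟙_ C ⟶ X.obj) : unitObj (A := A) ⟶ X where
  hom := (ρ_ A).inv ≫ A ◁ x ≫ X.act
  comm := by
    have h := X.assoc
    calc A ◁ ((ρ_ A).inv ≫ A ◁ x ≫ X.act) ≫ X.act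
        = (ρ_ (A ⊗ A)).inv ≫ (A ⊗ A) ◁ x ≫ (α_ A A X.obj).hom ≫ A ◁ X.act ≫ X.act := by simp
      _ = (ρ_ (A ⊗ A)).inv ≫ ((A ⊗ A) ◁ x ≫ μ[A] ▷ X.obj) ≫ X.act := by rw [← h]; simp
      _ = _ := by rw [whisker_exchange]; simp

theorem point_ofPoint {X : RepU A} (x : 𝟙_ C ⟶ X.obj) : η[A] ≫ (ofPoint x).hom = x := by
  have h := X.one_act
  change η[A] ≫ (ρ_ A).inv ≫ A ◁ x ≫ X.act = x
  rw [rightUnitor_inv_naturality_assoc, ← whisker_exchange_assoc, h, leftUnitor_naturality,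
    unitors_equal, Iso.inv_hom_id_assoc]

/-- `Hom_A(A, X) = Hom(𝟙, X)`. -/
noncomputable def pointEquiv (X : RepU A) : (unitObj (A := A) ⟶ X) ≃ₗ[ℂ] (𝟙_ C ⟶ X.obj) :=
  LinearEquiv.ofBijective
    { toFun := fun f => η[A] ≫ f.hom
      map_add' := fun f g => by simp
      map_smul' := fun c f => by simp }
    ⟨fun _ _ h => unit_point_injective h, fun x => ⟨ofPoint x, point_ofPoint x⟩⟩

variable [T : UnitaryTensorSystem A]

@[simp] theorem m_whiskerLeft (X : RepU A) {Y Y' : RepU A} (g : Y ⟶ Y') :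
    m X Y ≫ (X ◁ g).hom = X.obj ◁ g.hom ≫ m X Y' := m_wL X g

@[simp] theorem m_whiskerRight {X X' : RepU A} (f : X ⟶ X') (Y : RepU A) :
    m X Y ≫ (f ▷ Y).hom = f.hom ▷ Y.obj ≫ m X' Y := m_wR f Y

/-- This form exhibits a structure morphism as a compression of one of `C`, so that its adjoint can
be read off. -/
theorem eq_of_m_comp {X Y : RepU A} {Z : C} {f : (T.prod X Y).obj ⟶ Z}
    {g : X.obj ⊗ Y.obj ⟶ Z} (h : m X Y ≫ f = g) : f = (dA A)⁻¹ • (dag (m X Y) ≫ g) := by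
  rw [← h, ← Category.assoc, dag_m_m, Linear.smul_comp, Category.id_comp,
    inv_smul_smul₀ (dA_ne (A := A))]

theorem dag_mL_mL (X Y Z : RepU A) : dag (mL X Y Z) ≫ mL X Y Z = (dA A * dA A) • 𝟙 _ := by
  rw [mL, dag_comp, dag_whiskerRight, Category.assoc, ← comp_whiskerRight_assoc, dag_m_m]
  simp [dag_m_m, smul_smul]

theorem dag_mR_mR (X Y Z : RepU A) : dag (mR X Y Z) ≫ mR X Y Z = (dA A * dA A) • 𝟙 _ := by
  rw [mR, dag_comp, dag_whiskerLeft, Category.assoc, ← MonoidalCategory.whiskerLeft_comp_assoc,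
    dag_m_m]
  simp [dag_m_m, smul_smul]

theorem dag_eq_inv {X Y : RepU A} (e : X ≅ Y) (h : dag e.hom ≫ e.hom = 𝟙 Y) :
    dag e.hom = e.inv := by
  rw [← Category.comp_id (dag e.hom), ← e.hom_inv_id, reassoc_of% h]

instance : MonoidalPreadditive (RepU A) where
  whiskerLeft_zero := prod_ext (by simp)
  zero_whiskerRight := prod_ext (by simp)
  whiskerLeft_add _ _ := prod_ext (by simp)
  add_whiskerRight _ _ := prod_ext (by simp)

instance : MonoidalLinear ℂ (RepU A) where
  whiskerLeft_smul _ _ _ _ _ := prod_ext (by simp)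
  smul_whiskerRight _ _ _ _ _ := prod_ext (by simp)

theorem dag_assoc_hom (X Y Z : RepU A) : dag (α_ X Y Z).hom = (α_ X Y Z).inv := by
  apply hom_ext
  have h1 : (α_ X Y Z).hom.hom = (dA A * dA A)⁻¹ • (dag (mL X Y Z) ≫ (α_ _ _ _).hom ≫
      mR X Y Z) := by
    have h := mL_assocHom X Y Z
    rw [← h, ← Category.assoc, dag_mL_mL, Linear.smul_comp, Category.id_comp,
      inv_smul_smul₀ (mul_ne_zero dA_ne dA_ne)]
    rfl
  have h2 : (α_ X Y Z).inv.hom = (dA A * dA A)⁻¹ • (dag (mR X Y Z) ≫ (α_ _ _ _).inv ≫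
      mL X Y Z) := by
    have h := mR_assocInv X Y Z
    rw [← h, ← Category.assoc, dag_mR_mR, Linear.smul_comp, Category.id_comp,
      inv_smul_smul₀ (mul_ne_zero dA_ne dA_ne)]
    rfl
  rw [dag_hom, h1, h2, dag_smul, dag_comp, dag_comp, dag_dag, dag_associator, Category.assoc]
  simp [conj_dA]

theorem isCStarTensorCategory (hC : IsRigid C) (hA : IsHaploid A) :
    IsCStarTensorCategory (RepU A) where
  toIsCStarCategory := isCStarCategory hC
  dag_whiskerLeft X {Y Z} f := by
    apply hom_ext
    rw [dag_hom, eq_of_m_comp (m_whiskerLeft X f), eq_of_m_comp (m_whiskerLeft X (dag f))]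
    simp [dag_smul, dag_comp, dag_dag, dag_whiskerLeft, conj_dA]
  dag_whiskerRight {Y Z} f X := by
    apply hom_ext
    rw [dag_hom, eq_of_m_comp (m_whiskerRight f X), eq_of_m_comp (m_whiskerRight (dag f) X)]
    simp [dag_smul, dag_comp, dag_dag, dag_whiskerRight, conj_dA]
  dag_associator X Y Z := dag_assoc_hom X Y Z
  dag_leftUnitor X := dag_eq_inv _ (hom_ext (by
    have h : (λ_ X).hom.hom = (dA A)⁻¹ • (dag (m unitObj X) ≫ X.act) := rfl
    rw [comp_hom, dag_hom, h, dag_smul, dag_comp, dag_dag, Linear.smul_comp, Linear.comp_smul,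
      Category.assoc, m_dag_balanced unitObj X X.act (by rw [unit_actR]; exact X.assoc)]
    simp [conj_dA, dag_act_act, smul_smul, dA_ne]))
  dag_rightUnitor X := dag_eq_inv _ (hom_ext (by
    have h : (ρ_ X).hom.hom = (dA A)⁻¹ • (dag (m X unitObj) ≫ X.actR) := rfl
    rw [comp_hom, dag_hom, h, dag_smul, dag_comp, dag_dag, Linear.smul_comp, Linear.comp_smul,
      Category.assoc, m_dag_balanced X unitObj X.actR X.bim.assocR]
    simp [conj_dA, dag_actR_actR, smul_smul, dA_ne]))
  simple_unit := by
    rw [← hA]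
    exact (pointEquiv (unitObj (A := A))).finrank_eq
  exists_directSum n W := by
    obtain ⟨X, v, hv⟩ := exists_directSum W
    exact ⟨X, v, hv.isometry, hv.orthogonal, hv.sum⟩
  exists_subobject := exists_subobject

theorem isBraidedCStarTensorCategory (hC : IsRigid C) (hA : IsHaploid A) :
    IsBraidedCStarTensorCategory (RepU A) where
  toIsCStarTensorCategory := isCStarTensorCategory hC hA
  dag_braiding X Y := by
    apply hom_ext
    have h1 : (β_ X Y).hom.hom = (dA A)⁻¹ • (dag (m X Y) ≫ (β_ X.obj Y.obj).hom ≫ m Y X) := rfl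
    have h2 : (β_ X Y).inv.hom = (dA A)⁻¹ • (dag (m Y X) ≫ (β_ X.obj Y.obj).inv ≫ m X Y) := rfl
    rw [dag_hom, h1, h2]
    simp [dag_smul, dag_comp, dag_dag, dag_braiding, conj_dA]

end RepU

end ModuleCStar

/-! ### Unitarization of modules -/

section Unitarize

variable {C : Type u} [Category.{v} C] [Preadditive C] [Linear ℂ C] [StarCategory C]
  [MonoidalCategory C] [BraidedCategory C] [IsBraidedCStarTensorCategory C] {A : C} [MonObj A]

open IsCStarTensorCategory IsBraidedCStarTensorCategory

/-- The coaction attached to an action through the Frobenius structure. -/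
def coact {M : C} (a : A ⊗ M ⟶ M) : M ⟶ A ⊗ M :=
  (λ_ M).inv ≫ (η[A] ≫ dag μ[A]) ▷ M ≫ (α_ A A M).hom ≫ A ◁ a

/-- Unitarity says that the adjoint coaction agrees with the one built algebraically from the
Frobenius form; the latter makes sense for any action. -/
theorem isUnitaryLeft_iff {M : C} (a : A ⊗ M ⟶ M) : IsUnitaryLeft A a ↔ dag a = coact a := by
  refine ⟨fun h => dag_act h, fun h => ?_⟩
  have h' := congrArg dag h
  rw [dag_dag] at h'
  unfold IsUnitaryLeft
  conv_lhs => rw [h']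
  simp [coact, evA, dag_comp, dag_whiskerLeft, dag_whiskerRight, dag_associator, dag_leftUnitor_inv,
    dag_dag]

variable [IsQSystem A]

theorem cup_mul : (λ_ A).inv ≫ (η[A] ≫ dag μ[A]) ▷ A ≫ (α_ A A A).hom ≫ A ◁ μ[A] = dag μ[A] := by
  have h := IsQSystem.frobenius (A := A)
  rw [comp_whiskerRight, Category.assoc, h, MonObj.one_mul_assoc]
  simp

theorem mul_cup : (ρ_ A).inv ≫ A ◁ (η[A] ≫ dag μ[A]) ≫ (α_ A A A).inv ≫ μ[A] ▷ A = dag μ[A] := by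
  have h : A ◁ dag μ[A] ≫ (α_ A A A).inv ≫ μ[A] ▷ A = μ[A] ≫ dag μ[A] := by
    have := congrArg dag (IsQSystem.frobenius (A := A))
    simpa [dag_comp, dag_whiskerLeft, dag_whiskerRight, dag_associator, dag_dag] using this
  rw [MonoidalCategory.whiskerLeft_comp, Category.assoc, h, MonObj.mul_one_assoc]
  simp

theorem dag_mul_coassoc : dag μ[A] ≫ A ◁ dag μ[A] =
    dag μ[A] ≫ dag μ[A] ▷ A ≫ (α_ A A A).hom := by
  have h := congrArg dag (MonObj.mul_assoc A)
  simp only [dag_comp, dag_whiskerLeft, dag_whiskerRight, dag_associator, Category.assoc] at h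
  rw [reassoc_of% h]
  simp

variable {M : C} {a : A ⊗ M ⟶ M}

theorem act_coact (h : μ[A] ▷ M ≫ a = (α_ A A M).hom ≫ A ◁ a ≫ a) :
    a ≫ coact a = dag μ[A] ▷ M ≫ (α_ A A M).hom ≫ A ◁ a := by
  calc a ≫ coact a
      = 𝟙 _ ⊗≫ ((𝟙_ C) ◁ a ≫ (η[A] ≫ dag μ[A]) ▷ M) ⊗≫ A ◁ a := by rw [coact]; monoidal
    _ = 𝟙 _ ⊗≫ (η[A] ≫ dag μ[A]) ▷ (A ⊗ M) ⊗≫ A ◁ ((α_ A A M).hom ≫ A ◁ a ≫ a) := by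
        rw [whisker_exchange]; monoidal
    _ = ((λ_ A).inv ≫ (η[A] ≫ dag μ[A]) ▷ A ≫ (α_ A A A).hom ≫ A ◁ μ[A]) ▷ M ⊗≫ A ◁ a := by
        rw [← h]; monoidal
    _ = _ := by rw [cup_mul]; monoidal

theorem coact_mul : A ◁ coact a ≫ (α_ A A M).inv ≫ μ[A] ▷ M =
    dag μ[A] ▷ M ≫ (α_ A A M).hom ≫ A ◁ a := by
  calc A ◁ coact a ≫ (α_ A A M).inv ≫ μ[A] ▷ M
      = 𝟙 _ ⊗≫ A ◁ (η[A] ≫ dag μ[A]) ▷ M ⊗≫ ((A ⊗ A) ◁ a ≫ μ[A] ▷ M) := by rw [coact]; monoidal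
    _ = ((ρ_ A).inv ≫ A ◁ (η[A] ≫ dag μ[A]) ≫ (α_ A A A).inv ≫ μ[A] ▷ A) ▷ M ⊗≫ A ◁ a := by
        rw [whisker_exchange]; monoidal
    _ = _ := by rw [mul_cup]; monoidal

theorem coact_act (h₁ : η[A] ▷ M ≫ a = (λ_ M).hom)
    (h : μ[A] ▷ M ≫ a = (α_ A A M).hom ≫ A ◁ a ≫ a) : coact a ≫ a = RepU.dA A • 𝟙 M := by
  rw [coact]
  simp only [Category.assoc]
  rw [← h, ← comp_whiskerRight_assoc, Category.assoc, RepU.dag_mul_mul]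
  simp [h₁]

theorem coact_coassoc (h : μ[A] ▷ M ≫ a = (α_ A A M).hom ≫ A ◁ a ≫ a) :
    coact a ≫ A ◁ coact a = coact a ≫ dag μ[A] ▷ M ≫ (α_ A A M).hom := by
  have h1 := act_coact h
  calc coact a ≫ A ◁ coact a
      = 𝟙 _ ⊗≫ (η[A] ≫ dag μ[A]) ▷ M ⊗≫ A ◁ (a ≫ coact a) := by
        conv_lhs => enter [1]; rw [coact]
        monoidal
    _ = 𝟙 _ ⊗≫ (η[A] ≫ (dag μ[A] ≫ A ◁ dag μ[A])) ▷ M ⊗≫ A ◁ A ◁ a := by rw [h1]; monoidal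
    _ = 𝟙 _ ⊗≫ (η[A] ≫ dag μ[A]) ▷ M ⊗≫ (dag μ[A] ▷ (A ⊗ M) ≫ (A ⊗ A) ◁ a) ⊗≫ 𝟙 _ := by
        rw [dag_mul_coassoc]; monoidal
    _ = _ := by rw [← whisker_exchange, coact]; monoidal

/-- Every module is isomorphic to a unitary one. -/
theorem exists_unitarization (hC : IsRigid C) (h₁ : η[A] ▷ M ≫ a = (λ_ M).hom)
    (h : μ[A] ▷ M ≫ a = (α_ A A M).hom ≫ A ◁ a ≫ a) :
    ∃ g : M ≅ M, IsUnitaryLeft A (A ◁ g.inv ≫ a ≫ g.hom) := by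
  -- `g` is the square root of the positive operator `H = coact a ≫ dag (coact a)`. It is injective
  -- because `coact a ≫ a = d`, hence invertible in finite dimension.
  obtain ⟨g, hg, hgg⟩ := exists_sqrt_comp_dag hC (coact a)
  have hinj : ∀ x : M ⟶ M, x ≫ g = 0 → x = 0 := by
    intro x hx
    have h0 : (x ≫ coact a) ≫ dag (x ≫ coact a) = 0 := by
      rw [dag_comp, Category.assoc, ← Category.assoc (coact a), ← hgg]
      simp [reassoc_of% hx]
    have h2 : (x ≫ coact a) ≫ a = 0 := by rw [eq_zero_of_comp_dag h0]; simp
    rw [Category.assoc, coact_act h₁ h, Linear.comp_smul, Category.comp_id] at h2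
    exact (smul_eq_zero.1 h2).resolve_left RepU.dA_ne
  have := finiteDimensional_hom hC M M
  let L : (M ⟶ M) →ₗ[ℂ] (M ⟶ M) := Linear.rightComp ℂ M g
  have hL : Function.Injective L := by
    rw [← LinearMap.ker_eq_bot, LinearMap.ker_eq_bot']
    exact fun x hx => hinj x hx
  obtain ⟨k, hk⟩ := (LinearMap.injective_iff_surjective.1 hL) (𝟙 M)
  have hkg : k ≫ g = 𝟙 M := hk
  have hk' : dag k = k := by
    have h2 := congrArg dag hkg
    rw [dag_comp, hg, dag_id] at h2
    rw [← Category.id_comp (dag k), ← hkg, Category.assoc, h2, Category.comp_id]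
  have hgk : g ≫ k = 𝟙 M := by
    have h2 := congrArg dag hkg
    rwa [dag_comp, hg, dag_id, hk'] at h2
  refine ⟨⟨g, k, hgk, hkg⟩, ?_⟩
  rw [isUnitaryLeft_iff]
  have e1 : coact (A ◁ k ≫ a ≫ g) = k ≫ coact a ≫ A ◁ g := by
    calc coact (A ◁ k ≫ a ≫ g)
        = 𝟙 _ ⊗≫ ((η[A] ≫ dag μ[A]) ▷ M ≫ (A ⊗ A) ◁ k) ⊗≫ A ◁ a ≫ A ◁ g := by
          rw [coact]; monoidal
      _ = _ := by rw [← whisker_exchange, coact]; monoidal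
  have e2 : dag (A ◁ k ≫ a ≫ g) = g ≫ dag a ≫ A ◁ k := by
    rw [dag_comp, dag_comp, dag_whiskerLeft, hg, hk', Category.assoc]
  -- Coassociativity and the Frobenius relation make `H` a module morphism from the action `a` to
  -- the action `dag (coact a)`; conjugating by `√H` therefore identifies the two.
  have e3 : coact a ≫ A ◁ (g ≫ g) = g ≫ g ≫ dag a := by
    have h3 := congrArg dag (coact_coassoc h)
    simp only [dag_comp, dag_whiskerLeft, dag_whiskerRight, dag_associator, dag_dag,
      Category.assoc] at h3
    have h4 : A ◁ (coact a ≫ dag (coact a)) ≫ dag (coact a) = a ≫ coact a ≫ dag (coact a) := by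
      rw [MonoidalCategory.whiskerLeft_comp, Category.assoc, h3, ← Category.assoc a, act_coact h,
        ← coact_mul]
      simp
    have h5 := congrArg dag h4
    simp only [dag_comp, dag_whiskerLeft, dag_dag, Category.assoc] at h5
    rw [hgg, h5, reassoc_of% hgg]
  change dag (A ◁ k ≫ a ≫ g) = coact (A ◁ k ≫ a ≫ g)
  rw [e1, e2]
  have e4 : coact a ≫ A ◁ g = g ≫ g ≫ dag a ≫ A ◁ k := by
    have := e3 =≫ A ◁ k
    simp only [Category.assoc] at this
    rw [← this, ← MonoidalCategory.whiskerLeft_comp, Category.assoc, hgk, Category.comp_id]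
  rw [e4, reassoc_of% hkg]

end Unitarize

/-! ### Duals of modules -/

section Dual

variable {C : Type u} [Category.{v} C] [Preadditive C] [Linear ℂ C] [StarCategory C]
  [MonoidalCategory C] [BraidedCategory C] [IsBraidedCStarTensorCategory C] {A : C} [MonObj A]

open IsCStarTensorCategory IsBraidedCStarTensorCategory

theorem exists_transpose {X Y : C} (p : ExactPairing X Y) {Z : C} (h : Z ⊗ X ⟶ 𝟙_ C) :
    ∃ f : Z ⟶ Y, f ▷ X ≫ p.evaluation' = h := by
  have hz := p.evaluation_coevaluation'
  refine ⟨(ρ_ Z).inv ≫ Z ◁ p.coevaluation' ≫ (α_ Z X Y).inv ≫ h ▷ Y ≫ (λ_ Y).hom, ?_⟩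
  calc ((ρ_ Z).inv ≫ Z ◁ p.coevaluation' ≫ (α_ Z X Y).inv ≫ h ▷ Y ≫ (λ_ Y).hom) ▷ X ≫
        p.evaluation'
      = 𝟙 _ ⊗≫ Z ◁ p.coevaluation' ▷ X ⊗≫ (h ▷ (Y ⊗ X) ≫ 𝟙_ C ◁ p.evaluation') ⊗≫ 𝟙 _ := by
        monoidal
    _ = 𝟙 _ ⊗≫ Z ◁ (p.coevaluation' ▷ X ≫ (α_ X Y X).hom ≫ X ◁ p.evaluation') ⊗≫ h ⊗≫ 𝟙 _ := by
        rw [← whisker_exchange]; monoidal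
    _ = _ := by rw [hz]; monoidal

theorem braiding_whiskerRight_cap {P Q : C} (f : P ⊗ Q ⟶ 𝟙_ C) (Y : C) :
    (β_ P Y).hom ▷ Q ≫ (α_ Y P Q).hom ≫ Y ◁ f ≫ (ρ_ Y).hom =
      (α_ P Y Q).hom ≫ P ◁ (β_ Q Y).inv ≫ (α_ P Q Y).inv ≫ f ▷ Y ≫ (λ_ Y).hom := by
  have h := BraidedCategory.braiding_naturality_left f Y
  rw [BraidedCategory.braiding_tensor_left_hom, braiding_tensorUnit_left] at h
  have h' := h =≫ (ρ_ Y).hom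
  simp only [Category.assoc, Iso.inv_hom_id, Category.comp_id] at h'
  rw [h']
  simp

theorem braiding_inv_whiskerRight_cap {P Q : C} (f : P ⊗ Q ⟶ 𝟙_ C) (Y : C) :
    (β_ Y P).inv ▷ Q ≫ (α_ Y P Q).hom ≫ Y ◁ f ≫ (ρ_ Y).hom =
      (α_ P Y Q).hom ≫ P ◁ (β_ Y Q).hom ≫ (α_ P Q Y).inv ≫ f ▷ Y ≫ (λ_ Y).hom := by
  have h := BraidedCategory.braiding_inv_naturality_left f Y
  rw [BraidedCategory.braiding_tensor_right_inv, braiding_inv_tensorUnit_right] at h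
  have h' := h =≫ (ρ_ Y).hom
  simp only [Category.assoc, Iso.inv_hom_id, Category.comp_id] at h'
  rw [h']
  simp

theorem cup_braiding_inv {P Q : C} (c : 𝟙_ C ⟶ P ⊗ Q) (Y : C) :
    (ρ_ Y).inv ≫ Y ◁ c ≫ (α_ Y P Q).inv ≫ (β_ P Y).inv ▷ Q =
      (λ_ Y).inv ≫ c ▷ Y ≫ (α_ P Q Y).hom ≫ P ◁ (β_ Q Y).hom ≫ (α_ P Y Q).inv := by
  have h := BraidedCategory.braiding_naturality_left c Y
  rw [BraidedCategory.braiding_tensor_left_hom, braiding_tensorUnit_left] at h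
  have h' := (λ_ Y).inv ≫= h
  simp only [Category.assoc, Iso.inv_hom_id_assoc] at h'
  rw [← reassoc_of% h']
  simp

theorem cup_braiding {P Q : C} (c : 𝟙_ C ⟶ P ⊗ Q) (Y : C) :
    (ρ_ Y).inv ≫ Y ◁ c ≫ (α_ Y P Q).inv ≫ (β_ Y P).hom ▷ Q =
      (λ_ Y).inv ≫ c ▷ Y ≫ (α_ P Q Y).hom ≫ P ◁ (β_ Y Q).inv ≫ (α_ P Y Q).inv := by
  have h := BraidedCategory.braiding_naturality_right Y c
  rw [BraidedCategory.braiding_tensor_right_hom, braiding_tensorUnit_right] at h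
  have h' := (ρ_ Y).inv ≫= h
  simp only [Category.assoc, Iso.inv_hom_id_assoc] at h'
  rw [← reassoc_of% h']
  simp

/-- Unitarity writes the action on `X` as an emission of an `A`-strand capped with the incoming one.
The cap and the evaluation slide past the crossings, turning the crossing `e` at `Y` into the
crossing `b` at `X`. -/
theorem slide_action (X : RepU A) {Y : C} (p : ExactPairing X.obj Y) {e : A ⊗ Y ⟶ Y ⊗ A}
    {e' : Y ⊗ A ⟶ A ⊗ Y} {b : A ⊗ X.obj ⟶ X.obj ⊗ A}
    (h₁ : e ▷ A ≫ (α_ Y A A).hom ≫ Y ◁ evA A ≫ (ρ_ Y).hom =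
      (α_ A Y A).hom ≫ A ◁ e' ≫ (α_ A A Y).inv ≫ evA A ▷ Y ≫ (λ_ Y).hom)
    (h₂ : e' ▷ X.obj ≫ (α_ A Y X.obj).hom ≫ A ◁ p.evaluation' ≫ (ρ_ A).hom =
      (α_ Y A X.obj).hom ≫ Y ◁ b ≫ (α_ Y X.obj A).inv ≫ p.evaluation' ▷ A ≫ (λ_ A).hom) :
    e ▷ X.obj ≫ (α_ Y A X.obj).hom ≫ Y ◁ X.act ≫ p.evaluation' =
      (α_ A Y X.obj).hom ≫ A ◁ (Y ◁ (dag X.act ≫ b) ≫ (α_ Y X.obj A).inv ≫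
        p.evaluation' ▷ A ≫ (λ_ A).hom) ≫ evA A := by
  calc e ▷ X.obj ≫ (α_ Y A X.obj).hom ≫ Y ◁ X.act ≫ p.evaluation'
      = 𝟙 _ ⊗≫ (e ▷ X.obj ≫ (Y ⊗ A) ◁ dag X.act) ⊗≫ Y ◁ evA A ▷ X.obj ⊗≫ p.evaluation' := by
        conv_lhs => rw [X.unitary]
        monoidal
    _ = 𝟙 _ ⊗≫ (A ⊗ Y) ◁ dag X.act ⊗≫
          (e ▷ A ≫ (α_ Y A A).hom ≫ Y ◁ evA A ≫ (ρ_ Y).hom) ▷ X.obj ⊗≫ p.evaluation' := by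
        rw [← whisker_exchange]; monoidal
    _ = 𝟙 _ ⊗≫ (A ⊗ Y) ◁ dag X.act ⊗≫ A ◁ e' ▷ X.obj ⊗≫
          (evA A ▷ (Y ⊗ X.obj) ≫ 𝟙_ C ◁ p.evaluation') ⊗≫ 𝟙 _ := by rw [h₁]; monoidal
    _ = 𝟙 _ ⊗≫ (A ⊗ Y) ◁ dag X.act ⊗≫
          A ◁ (e' ▷ X.obj ≫ (α_ A Y X.obj).hom ≫ A ◁ p.evaluation' ≫ (ρ_ A).hom) ⊗≫ evA A := by
        rw [← whisker_exchange]; monoidal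
    _ = _ := by rw [h₂]; monoidal

theorem dag_act_braiding (X : RepU A) :
    dag X.act ≫ (β_ A X.obj).hom = dag X.act ≫ (β_ X.obj A).inv := by
  have h := congrArg dag X.singleValued
  simp only [dag_comp, dag_braiding, Category.assoc] at h
  conv_lhs => rw [← h]
  simp

/-- Sliding moves the two possible crossings at `Y` to the two crossings at `X`, which agree because
`X` is single-valued. -/
theorem braiding_action_eq (X : RepU A) {Y : C} (p : ExactPairing X.obj Y) :
    (β_ A Y).hom ▷ X.obj ≫ (α_ Y A X.obj).hom ≫ Y ◁ X.act ≫ p.evaluation' =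
      (β_ Y A).inv ▷ X.obj ≫ (α_ Y A X.obj).hom ≫ Y ◁ X.act ≫ p.evaluation' := by
  rw [slide_action X p (e' := (β_ A Y).inv) (b := (β_ A X.obj).hom),
    slide_action X p (e' := (β_ Y A).hom) (b := (β_ X.obj A).inv), dag_act_braiding]
  · exact braiding_inv_whiskerRight_cap (evA A) Y
  · exact braiding_whiskerRight_cap p.evaluation' A
  · exact braiding_whiskerRight_cap (evA A) Y
  · exact braiding_inv_whiskerRight_cap p.evaluation' A

variable [IsQSystem A] [IsCommMonObj A]

/-- The dual of a module, with a balanced evaluation. -/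
theorem RepU.exists_dual (hC : IsRigid C) (X : RepU A) :
    ∃ (Y : RepU A) (p : ExactPairing X.obj Y.obj), Y.actR ▷ X.obj ≫ p.evaluation' =
      (α_ Y.obj A X.obj).hom ≫ Y.obj ◁ X.act ≫ p.evaluation' := by
  obtain ⟨Y, ⟨p⟩⟩ := hC X.obj
  -- `r` is the right action on the dual obtained by transposing the action on `X`; its properties
  -- are checked after pairing with `X`.
  obtain ⟨r, hr⟩ := exists_transpose p ((α_ Y A X.obj).hom ≫ Y ◁ X.act ≫ p.evaluation')
  have hloc : (β_ A Y).hom ≫ r = (β_ Y A).inv ≫ r := by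
    apply whiskerRight_ev_cancel p
    rw [comp_whiskerRight, comp_whiskerRight, Category.assoc, Category.assoc, hr,
      braiding_action_eq]
  have hone : Y ◁ η[A] ≫ r = (ρ_ Y).hom := by
    apply whiskerRight_ev_cancel p
    have h := X.one_act
    rw [comp_whiskerRight, Category.assoc, hr]
    calc (Y ◁ η[A]) ▷ X.obj ≫ (α_ Y A X.obj).hom ≫ Y ◁ X.act ≫ p.evaluation'
        = 𝟙 _ ⊗≫ Y ◁ (η[A] ▷ X.obj ≫ X.act) ≫ p.evaluation' := by monoidal
      _ = _ := by rw [h]; monoidal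
  have hassoc : r ▷ A ≫ r = (α_ Y A A).hom ≫ Y ◁ μ[A] ≫ r := by
    apply whiskerRight_ev_cancel p
    have h := X.assoc
    calc (r ▷ A ≫ r) ▷ X.obj ≫ p.evaluation'
        = r ▷ A ▷ X.obj ≫ r ▷ X.obj ≫ p.evaluation' := by simp
      _ = 𝟙 _ ⊗≫ (r ▷ (A ⊗ X.obj) ≫ Y ◁ X.act) ≫ p.evaluation' := by rw [hr]; monoidal
      _ = 𝟙 _ ⊗≫ (Y ⊗ A) ◁ X.act ≫ r ▷ X.obj ≫ p.evaluation' := by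
          rw [← whisker_exchange]; monoidal
      _ = 𝟙 _ ⊗≫ Y ◁ ((α_ A A X.obj).hom ≫ A ◁ X.act ≫ X.act) ≫ p.evaluation' := by
          rw [hr]; monoidal
      _ = 𝟙 _ ⊗≫ (Y ◁ μ[A]) ▷ X.obj ≫ (α_ Y A X.obj).hom ≫ Y ◁ X.act ≫ p.evaluation' := by
          rw [← h]; monoidal
      _ = _ := by rw [← hr]; monoidal
  have h1 : η[A] ▷ Y ≫ (β_ A Y).hom ≫ r = (λ_ Y).hom := by
    rw [BraidedCategory.braiding_naturality_left_assoc, hone, braiding_rightUnitor]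
  have h2 : μ[A] ▷ Y ≫ (β_ A Y).hom ≫ r =
      (α_ A A Y).hom ≫ A ◁ ((β_ A Y).hom ≫ r) ≫ (β_ A Y).hom ≫ r := by
    rw [MonoidalCategory.whiskerLeft_comp, Category.assoc,
      BraidedCategory.braiding_naturality_right_assoc, hassoc,
      BraidedCategory.braiding_naturality_left_assoc]
    simp only [BraidedCategory.braiding_tensor_left_hom,
      BraidedCategory.braiding_tensor_right_hom, Category.assoc, Iso.inv_hom_id_assoc]
    rw [← MonoidalCategory.whiskerLeft_comp_assoc Y (β_ A A).hom, IsCommMonObj.mul_comm]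
  obtain ⟨a, ha⟩ : ∃ a, a = (β_ A Y).hom ≫ r := ⟨_, rfl⟩
  rw [← ha] at h1 h2
  -- The transposed action need not be unitary. The conjugation by `g` is compensated in the pairing
  -- `p'`, which keeps the evaluation balanced.
  obtain ⟨g, hg⟩ := exists_unitarization hC h1 h2
  let Z : RepU A :=
    { obj := Y
      act := A ◁ g.inv ≫ a ≫ g.hom
      one_act := by
        rw [← whisker_exchange_assoc, reassoc_of% h1, leftUnitor_naturality_assoc]
        simp
      assoc := by
        have h3 : A ◁ (A ◁ g.inv ≫ a ≫ g.hom) ≫ A ◁ g.inv =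
            A ◁ A ◁ g.inv ≫ A ◁ a := by
          rw [← MonoidalCategory.whiskerLeft_comp, Category.assoc, Category.assoc, g.hom_inv_id,
            Category.comp_id, MonoidalCategory.whiskerLeft_comp]
        rw [reassoc_of% h3, ← whisker_exchange_assoc, ← Category.assoc (μ[A] ▷ Y), h2]
        simp
      unitary := hg
      singleValued := by
        rw [← BraidedCategory.braiding_naturality_left_assoc,
          ← BraidedCategory.braiding_naturality_right_assoc, ha]
        conv_lhs => rw [hloc]
        simp }
  let p' : ExactPairing X.obj Z.obj := exactPairingCongrRight (X := X.obj) (Y' := Y) g.symm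
  refine ⟨Z, p', ?_⟩
  have hR : Z.actR = g.inv ▷ A ≫ r ≫ g.hom := by
    change (β_ Y A).hom ≫ A ◁ g.inv ≫ a ≫ g.hom = _
    rw [← BraidedCategory.braiding_naturality_left_assoc, ha, hloc]
    simp
  have hp : p'.evaluation' = g.inv ▷ X.obj ≫ p.evaluation' := rfl
  rw [hR, hp]
  change (g.inv ▷ A ≫ r ≫ g.hom) ▷ X.obj ≫ g.inv ▷ X.obj ≫ p.evaluation' =
    (α_ Y A X.obj).hom ≫ Y ◁ X.act ≫ g.inv ▷ X.obj ≫ p.evaluation'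
  rw [whisker_exchange_assoc, ← associator_naturality_left_assoc, ← hr]
  simp

end Dual

/-! ### Rigidity of the category of modules -/

section ModuleRigid

variable {C : Type u} [Category.{v} C] [Preadditive C] [Linear ℂ C] [StarCategory C]
  [MonoidalCategory C] [BraidedCategory C] [IsBraidedCStarTensorCategory C] {A : C} [MonObj A]
  [IsQSystem A] [IsCommMonObj A]

open IsCStarTensorCategory IsBraidedCStarTensorCategory

namespace RepU

theorem dag_act_linearR (X : RepU A) :
    dag X.act ▷ A ≫ (α_ A X.obj A).hom ≫ A ◁ X.actR = X.actR ≫ dag X.act := by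
  have h : A ◁ dag X.actR ≫ (α_ A X.obj A).inv ≫ X.act ▷ A = X.act ≫ dag X.actR :=
    dag_linear (tensor_unitaryLeft X.unitary A) X.unitary (f := X.actR) (by
      rw [Category.assoc, X.actR_assocM, Iso.inv_hom_id_assoc])
  have h' := congrArg dag h
  simpa [dag_comp, dag_whiskerLeft, dag_whiskerRight, dag_associator_inv, dag_dag] using h'

/-- The multiple `d` of the evaluation of modules attached to an evaluation in `C`. -/
def preEv {X Y : RepU A} (ev : Y.obj ⊗ X.obj ⟶ 𝟙_ C) : Y.obj ⊗ X.obj ⟶ A :=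
  dag Y.act ▷ X.obj ≫ (α_ A Y.obj X.obj).hom ≫ A ◁ ev ≫ (ρ_ A).hom

variable {X Y : RepU A} {ev : Y.obj ⊗ X.obj ⟶ 𝟙_ C}

theorem preEv_linear : A ◁ preEv ev ≫ μ[A] =
    (α_ A Y.obj X.obj).inv ≫ Y.act ▷ X.obj ≫ preEv ev := by
  have h := act_dag_act Y
  calc A ◁ preEv ev ≫ μ[A]
      = 𝟙 _ ⊗≫ A ◁ dag Y.act ▷ X.obj ⊗≫ ((A ⊗ A) ◁ ev ≫ μ[A] ▷ 𝟙_ C) ⊗≫ 𝟙 _ := by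
        rw [preEv]; monoidal
    _ = 𝟙 _ ⊗≫ (A ◁ dag Y.act ≫ (α_ A A Y.obj).inv ≫ μ[A] ▷ Y.obj) ▷ X.obj ⊗≫ A ◁ ev ⊗≫
          𝟙 _ := by rw [whisker_exchange]; monoidal
    _ = _ := by rw [h, preEv]; monoidal

theorem preEv_balanced
    (hev : Y.actR ▷ X.obj ≫ ev = (α_ Y.obj A X.obj).hom ≫ Y.obj ◁ X.act ≫ ev) :
    Y.actR ▷ X.obj ≫ preEv ev =
    (α_ Y.obj A X.obj).hom ≫ Y.obj ◁ X.act ≫ preEv ev := by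
  have h := dag_act_linearR Y
  calc Y.actR ▷ X.obj ≫ preEv ev
      = (Y.actR ≫ dag Y.act) ▷ X.obj ⊗≫ A ◁ ev ⊗≫ 𝟙 _ := by rw [preEv]; monoidal
    _ = 𝟙 _ ⊗≫ dag Y.act ▷ A ▷ X.obj ⊗≫ A ◁ (Y.actR ▷ X.obj ≫ ev) ⊗≫ 𝟙 _ := by
        rw [← h]; monoidal
    _ = 𝟙 _ ⊗≫ (dag Y.act ▷ (A ⊗ X.obj) ≫ (A ⊗ Y.obj) ◁ X.act) ⊗≫ A ◁ ev ⊗≫ 𝟙 _ := by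
        rw [hev]; monoidal
    _ = _ := by rw [← whisker_exchange, preEv]; monoidal

/-- The `A`-strand may be emitted by `X` instead of `Y`, since `ev` is balanced; the second zigzag
of `modulePairing` needs this form. -/
theorem preEv_eq
    (hev : Y.actR ▷ X.obj ≫ ev = (α_ Y.obj A X.obj).hom ≫ Y.obj ◁ X.act ≫ ev) :
    preEv ev = Y.obj ◁ dag X.act ≫ (α_ Y.obj A X.obj).inv ≫
    (β_ A Y.obj).inv ▷ X.obj ≫ (α_ A Y.obj X.obj).hom ≫ A ◁ ev ≫ (ρ_ A).hom := by
  have h := cup_braiding_inv (η[A] ≫ dag μ[A]) Y.obj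
  have hY : Y.act = (β_ A Y.obj).hom ≫ Y.actR := Y.singleValued.symm
  symm
  calc _ = 𝟙 _ ⊗≫ Y.obj ◁ (η[A] ≫ dag μ[A]) ▷ X.obj ⊗≫
          ((Y.obj ⊗ A) ◁ X.act ≫ (β_ A Y.obj).inv ▷ X.obj) ⊗≫ A ◁ ev ⊗≫ 𝟙 _ := by
        rw [dag_act X.unitary]; monoidal
    _ = ((ρ_ Y.obj).inv ≫ Y.obj ◁ (η[A] ≫ dag μ[A]) ≫ (α_ Y.obj A A).inv ≫
            (β_ A Y.obj).inv ▷ A) ▷ X.obj ⊗≫ A ◁ (Y.obj ◁ X.act ≫ ev) ⊗≫ 𝟙 _ := by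
        rw [whisker_exchange]; monoidal
    _ = 𝟙 _ ⊗≫ (η[A] ≫ dag μ[A]) ▷ Y.obj ▷ X.obj ⊗≫ A ◁ (β_ A Y.obj).hom ▷ X.obj ⊗≫
          A ◁ ((α_ Y.obj A X.obj).hom ≫ Y.obj ◁ X.act ≫ ev) ⊗≫ 𝟙 _ := by rw [h]; monoidal
    _ = _ := by rw [← hev, preEv, dag_act Y.unitary, hY]; monoidal

variable [T : UnitaryTensorSystem A]

theorem rightUnitor_inv_hom (X : RepU A) :
    (ρ_ X).inv.hom = (ρ_ X.obj).inv ≫ X.obj ◁ η[A] ≫ m X (𝟙_ (RepU A)) := rfl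

theorem leftUnitor_inv_hom (X : RepU A) :
    (λ_ X).inv.hom = (λ_ X.obj).inv ≫ η[A] ▷ X.obj ≫ m (𝟙_ (RepU A)) X := rfl

theorem m_leftUnitor_hom (X : RepU A) : m (𝟙_ (RepU A)) X ≫ (λ_ X).hom.hom = X.act :=
  m_leftUnitor X

theorem m_rightUnitor_hom (X : RepU A) : m X (𝟙_ (RepU A)) ≫ (ρ_ X).hom.hom = X.actR :=
  m_rightUnitor X

theorem m_m_associator (X Y Z : RepU A) : m X Y ▷ Z.obj ≫ m (X ⊗ Y) Z ≫ (α_ X Y Z).hom.hom =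
    (α_ X.obj Y.obj Z.obj).hom ≫ X.obj ◁ m Y Z ≫ m X (Y ⊗ Z) := by
  have h := mL_assocHom X Y Z
  rwa [mL, Category.assoc, mR] at h

theorem m_m_associator_inv (X Y Z : RepU A) :
    X.obj ◁ m Y Z ≫ m X (Y ⊗ Z) ≫ (α_ X Y Z).inv.hom =
      (α_ X.obj Y.obj Z.obj).inv ≫ m X Y ▷ Z.obj ≫ m (X ⊗ Y) Z := by
  have h := mR_assocInv X Y Z
  rwa [mR, Category.assoc, mL] at h

theorem m_braiding (X Y : RepU A) :
    m X Y ≫ (β_ X Y).hom.hom = (β_ X.obj Y.obj).hom ≫ m Y X := m_braidHom X Y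

theorem zigzag_left {X Y : RepU A} {c : 𝟙_ (RepU A) ⟶ X ⊗ Y} {e : Y ⊗ X ⟶ 𝟙_ (RepU A)}
    {c₀ : 𝟙_ C ⟶ X.obj ⊗ Y.obj} (hc : η[A] ≫ c.hom = c₀ ≫ m X Y) :
    ((ρ_ Y).inv ≫ Y ◁ c ≫ (α_ Y X Y).inv ≫ e ▷ Y ≫ (λ_ Y).hom).hom =
      (ρ_ Y.obj).inv ≫ Y.obj ◁ c₀ ≫ (α_ Y.obj X.obj Y.obj).inv ≫ (m Y X ≫ e.hom) ▷ Y.obj ≫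
        Y.act := by
  have h1 : m Y (𝟙_ (RepU A)) ≫ (Y ◁ c).hom = Y.obj ◁ c.hom ≫ m Y (X ⊗ Y) := m_whiskerLeft Y c
  have h2 := m_m_associator_inv Y X Y
  have h3 : m (Y ⊗ X) Y ≫ (e ▷ Y).hom = e.hom ▷ Y.obj ≫ m (𝟙_ (RepU A)) Y := m_whiskerRight e Y
  have h4 := m_leftUnitor_hom Y
  have h0 : Y.obj ◁ η[A] ≫ Y.obj ◁ c.hom = Y.obj ◁ c₀ ≫ Y.obj ◁ m X Y := by
    rw [← MonoidalCategory.whiskerLeft_comp, hc, MonoidalCategory.whiskerLeft_comp]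
  simp only [comp_hom, rightUnitor_inv_hom, Category.assoc]
  rw [reassoc_of% h1, reassoc_of% h0, reassoc_of% h2, reassoc_of% h3, h4, comp_whiskerRight,
    Category.assoc]

theorem zigzag_right {X Y : RepU A} {c : 𝟙_ (RepU A) ⟶ X ⊗ Y} {e : Y ⊗ X ⟶ 𝟙_ (RepU A)}
    {c₀ : 𝟙_ C ⟶ X.obj ⊗ Y.obj} (hc : η[A] ≫ c.hom = c₀ ≫ m X Y) :
    ((λ_ X).inv ≫ c ▷ X ≫ (α_ X Y X).hom ≫ X ◁ e ≫ (ρ_ X).hom).hom =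
      (λ_ X.obj).inv ≫ c₀ ▷ X.obj ≫ (α_ X.obj Y.obj X.obj).hom ≫ X.obj ◁ (m Y X ≫ e.hom) ≫
        X.actR := by
  have h1 : m (𝟙_ (RepU A)) X ≫ (c ▷ X).hom = c.hom ▷ X.obj ≫ m (X ⊗ Y) X := m_whiskerRight c X
  have h2 := m_m_associator X Y X
  have h3 : m X (Y ⊗ X) ≫ (X ◁ e).hom = X.obj ◁ e.hom ≫ m X (𝟙_ (RepU A)) := m_whiskerLeft X e
  have h4 := m_rightUnitor_hom X
  have h0 : η[A] ▷ X.obj ≫ c.hom ▷ X.obj = c₀ ▷ X.obj ≫ m X Y ▷ X.obj := by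
    rw [← comp_whiskerRight, hc, comp_whiskerRight]
  simp only [comp_hom, leftUnitor_inv_hom, Category.assoc]
  rw [reassoc_of% h1, reassoc_of% h0, reassoc_of% h2, reassoc_of% h3, h4,
    MonoidalCategory.whiskerLeft_comp, Category.assoc]

/-- The pairing of modules attached to a pairing in `C` with balanced evaluation. -/
noncomputable abbrev modulePairing (p : ExactPairing X.obj Y.obj)
    (hp : Y.actR ▷ X.obj ≫ p.evaluation' =
      (α_ Y.obj A X.obj).hom ≫ Y.obj ◁ X.act ≫ p.evaluation') : ExactPairing X Y where
  coevaluation' := ofPoint (X := X ⊗ Y) (p.coevaluation' ≫ m X Y)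
  -- In each zigzag the `A`-strand is emitted and then reabsorbed, which gives the factor `d` that
  -- is cancelled here.
  evaluation' := (dA A)⁻¹ • desc (Z := unitObj) (preEv p.evaluation') (preEv_balanced hp)
    preEv_linear
  coevaluation_evaluation' := by
    rw [← cancel_mono (λ_ Y).hom, ← cancel_epi (ρ_ Y).inv]
    simp only [Category.assoc, Iso.inv_hom_id, Category.comp_id]
    have hz := p.coevaluation_evaluation'
    apply hom_ext
    rw [zigzag_left (point_ofPoint (X := X ⊗ Y) (p.coevaluation' ≫ m X Y)), smul_hom,
      Linear.comp_smul, m_desc, MonoidalLinear.smul_whiskerRight, Linear.smul_comp,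
      Linear.comp_smul, Linear.comp_smul, Linear.comp_smul, inv_smul_eq_iff₀ dA_ne]
    calc (ρ_ Y.obj).inv ≫ Y.obj ◁ p.coevaluation' ≫ (α_ Y.obj X.obj Y.obj).inv ≫
          preEv p.evaluation' ▷ Y.obj ≫ Y.act
        = 𝟙 _ ⊗≫ (Y.obj ◁ p.coevaluation' ≫ dag Y.act ▷ (X.obj ⊗ Y.obj)) ⊗≫
            A ◁ p.evaluation' ▷ Y.obj ⊗≫ Y.act := by rw [preEv]; monoidal
      _ = dag Y.act ⊗≫ A ◁ (Y.obj ◁ p.coevaluation' ≫ (α_ Y.obj X.obj Y.obj).inv ≫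
            p.evaluation' ▷ Y.obj) ⊗≫ Y.act := by rw [whisker_exchange]; monoidal
      _ = dag Y.act ≫ Y.act := by rw [hz]; monoidal
      _ = _ := dag_act_act Y
  evaluation_coevaluation' := by
    rw [← cancel_mono (ρ_ X).hom, ← cancel_epi (λ_ X).inv]
    simp only [Category.assoc, Iso.inv_hom_id, Category.comp_id]
    have hz := p.evaluation_coevaluation'
    have hb := cup_braiding p.coevaluation' A
    apply hom_ext
    rw [zigzag_right (point_ofPoint (X := X ⊗ Y) (p.coevaluation' ≫ m X Y)), smul_hom,
      Linear.comp_smul, m_desc, MonoidalLinear.whiskerLeft_smul, Linear.smul_comp,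
      Linear.comp_smul, Linear.comp_smul, Linear.comp_smul, inv_smul_eq_iff₀ dA_ne]
    calc (λ_ X.obj).inv ≫ p.coevaluation' ▷ X.obj ≫ (α_ X.obj Y.obj X.obj).hom ≫
          X.obj ◁ preEv p.evaluation' ≫ X.actR
        = 𝟙 _ ⊗≫ (p.coevaluation' ▷ X.obj ≫ (X.obj ⊗ Y.obj) ◁ dag X.act) ⊗≫
            X.obj ◁ (β_ A Y.obj).inv ▷ X.obj ⊗≫ (X.obj ⊗ A) ◁ p.evaluation' ⊗≫ X.actR := by
          rw [preEv_eq hp]; monoidal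
      _ = dag X.act ⊗≫ ((λ_ A).inv ≫ p.coevaluation' ▷ A ≫ (α_ X.obj Y.obj A).hom ≫
            X.obj ◁ (β_ A Y.obj).inv ≫ (α_ X.obj A Y.obj).inv) ▷ X.obj ⊗≫
              (X.obj ⊗ A) ◁ p.evaluation' ⊗≫ X.actR := by rw [← whisker_exchange]; monoidal
      _ = dag X.act ⊗≫ A ◁ p.coevaluation' ▷ X.obj ⊗≫
            ((β_ A X.obj).hom ▷ (Y.obj ⊗ X.obj) ≫ (X.obj ⊗ A) ◁ p.evaluation') ⊗≫ X.actR := by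
          rw [← hb]; monoidal
      _ = dag X.act ⊗≫ A ◁ (p.coevaluation' ▷ X.obj ≫ (α_ X.obj Y.obj X.obj).hom ≫
            X.obj ◁ p.evaluation') ⊗≫ (β_ A X.obj).hom ≫ X.actR := by
          rw [← whisker_exchange]; monoidal
      _ = dag X.act ≫ (β_ A X.obj).hom ≫ X.actR := by rw [hz]; monoidal
      _ = _ := by rw [braiding_actR, dag_act_act]; rfl

theorem isRigid (hC : IsRigid C) : IsRigid (RepU A) := by
  intro X
  obtain ⟨Y, p, hp⟩ := exists_dual hC X
  exact ⟨Y, ⟨modulePairing p hp⟩⟩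

/-! ### Restriction of pairings of modules -/

attribute [local instance] isSplitEpi_whiskerLeft isSplitEpi_whiskerRight

theorem m_dag_eq (X Y : RepU A) : m X Y ≫ dag (m X Y) =
    X.obj ◁ dag Y.act ≫ (α_ X.obj A Y.obj).inv ≫ X.actR ▷ Y.obj := by
  rw [← balancing_eq]
  exact m_dag X Y

/-- A Frobenius relation for the projections `m`, which reduces the zigzags of `restrictPairing` to
those of modules. After composing with the epimorphism `X ◁ m Y Z`, both sides let `Z` emit a strand
that acts on `X ⊗_A Y`. -/
theorem dag_m_frobenius (X Y Z : RepU A) :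
    X.obj ◁ dag (m Y Z) ≫ (α_ X.obj Y.obj Z.obj).inv ≫ m X Y ▷ Z.obj =
      m X (Y ⊗ Z) ≫ (α_ X Y Z).inv.hom ≫ dag (m (X ⊗ Y) Z) := by
  have h1 := m_m_associator_inv X Y Z
  have h2 : m (X ⊗ Y) Z ≫ dag (m (X ⊗ Y) Z) = (X ⊗ Y : RepU A).obj ◁ dag Z.act ≫
    (α_ (X ⊗ Y : RepU A).obj A Z.obj).inv ≫ (X ⊗ Y : RepU A).actR ▷ Z.obj := m_dag_eq (X ⊗ Y) Z
  have h3 : m X Y ▷ A ≫ (X ⊗ Y : RepU A).actR =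
    (α_ X.obj Y.obj A).hom ≫ X.obj ◁ Y.actR ≫ m X Y := m_linearR X Y
  have h4 := m_dag_eq Y Z
  rw [← cancel_epi (X.obj ◁ m Y Z), reassoc_of% h1]
  calc X.obj ◁ m Y Z ≫ X.obj ◁ dag (m Y Z) ≫ (α_ X.obj Y.obj Z.obj).inv ≫ m X Y ▷ Z.obj
      = X.obj ◁ (m Y Z ≫ dag (m Y Z)) ≫ (α_ X.obj Y.obj Z.obj).inv ≫ m X Y ▷ Z.obj := by simp
    _ = 𝟙 _ ⊗≫ (X.obj ⊗ Y.obj) ◁ dag Z.act ⊗≫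
          ((α_ X.obj Y.obj A).hom ≫ X.obj ◁ Y.actR ≫ m X Y) ▷ Z.obj := by rw [h4]; monoidal
    _ = 𝟙 _ ⊗≫ ((X.obj ⊗ Y.obj) ◁ dag Z.act ≫ m X Y ▷ (A ⊗ Z.obj)) ⊗≫
          (X ⊗ Y : RepU A).actR ▷ Z.obj := by rw [← h3]; monoidal
    _ = _ := by rw [whisker_exchange, h2]; monoidal

theorem dag_associator_hom (X Y Z : RepU A) : dag (α_ X Y Z).inv.hom = (α_ X Y Z).hom.hom := by
  rw [← dag_hom, ← dag_assoc_hom, dag_dag]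

theorem dag_m_frobenius' (X Y Z : RepU A) :
    dag (m X Y) ▷ Z.obj ≫ (α_ X.obj Y.obj Z.obj).hom ≫ X.obj ◁ m Y Z =
      m (X ⊗ Y) Z ≫ (α_ X Y Z).hom.hom ≫ dag (m X (Y ⊗ Z)) := by
  have h := congrArg dag (dag_m_frobenius X Y Z)
  simpa [dag_comp, dag_whiskerLeft, dag_whiskerRight, dag_associator_inv, dag_dag,
    dag_associator_hom] using h

variable [IsBraidedCStarTensorCategory (RepU A)]

theorem dag_m_whiskerLeft (X : RepU A) {Y Y' : RepU A} (g : Y ⟶ Y') :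
    dag (m X Y) ≫ X.obj ◁ g.hom = (X ◁ g).hom ≫ dag (m X Y') := by
  have h := congrArg dag (m_whiskerLeft X (dag g))
  rw [dag_comp, dag_comp, ← dag_hom, dag_whiskerLeft, dag_dag, dag_hom, dag_whiskerLeft,
    dag_dag] at h
  exact h.symm

theorem dag_m_whiskerRight {X X' : RepU A} (f : X ⟶ X') (Y : RepU A) :
    dag (m X Y) ≫ f.hom ▷ Y.obj = (f ▷ Y).hom ≫ dag (m X' Y) := by
  have h := congrArg dag (m_whiskerRight (dag f) Y)
  rw [dag_comp, dag_comp, ← dag_hom, dag_whiskerRight, dag_dag, dag_hom, dag_whiskerRight,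
    dag_dag] at h
  exact h.symm

theorem leftUnitor_inv_hom_dag (Y : RepU A) :
    (λ_ Y).inv.hom ≫ dag (m (𝟙_ (RepU A)) Y) ≫ dag η[A] ▷ Y.obj = (λ_ Y.obj).inv := by
  have h : dag (λ_ Y).inv.hom = (λ_ Y).hom.hom := by
    rw [← dag_hom, dag_leftUnitor_inv]
  have h1 : η[A] ▷ Y.obj ≫ m (𝟙_ (RepU A)) Y ≫ (λ_ Y).hom.hom = (λ_ Y.obj).hom := by
    rw [m_leftUnitor_hom, Y.one_act]
  have h2 := congrArg dag h1
  rwa [← h, dag_comp, dag_comp, dag_dag, dag_whiskerRight, dag_leftUnitor, Category.assoc] at h2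

theorem rightUnitor_inv_hom_dag (X : RepU A) :
    (ρ_ X).inv.hom ≫ dag (m X (𝟙_ (RepU A))) ≫ X.obj ◁ dag η[A] = (ρ_ X.obj).inv := by
  have h : dag (ρ_ X).inv.hom = (ρ_ X).hom.hom := by
    rw [← dag_hom, dag_rightUnitor_inv]
  have h0 : X.obj ◁ η[A] ≫ X.actR = (ρ_ X.obj).hom := X.bim.actR_one
  have h1 : X.obj ◁ η[A] ≫ m X (𝟙_ (RepU A)) ≫ (ρ_ X).hom.hom = (ρ_ X.obj).hom := by
    rw [m_rightUnitor_hom, h0]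
  have h2 := congrArg dag h1
  rwa [← h, dag_comp, dag_comp, dag_dag, dag_whiskerLeft, dag_rightUnitor, Category.assoc] at h2

/-- The pairing in `C` underlying a pairing of modules. -/
noncomputable abbrev restrictPairing {X Y : RepU A} (q : ExactPairing X Y) : ExactPairing X.obj Y.obj where
  coevaluation' := η[A] ≫ q.coevaluation'.hom ≫ dag (m X Y)
  evaluation' := m Y X ≫ q.evaluation'.hom ≫ dag η[A]
  coevaluation_evaluation' := by
    have h1 : m Y (𝟙_ (RepU A)) ≫ (Y ◁ q.coevaluation').hom =
      Y.obj ◁ q.coevaluation'.hom ≫ m Y (X ⊗ Y) := m_whiskerLeft Y q.coevaluation'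
    have h2 := dag_m_frobenius Y X Y
    have h3 : dag (m (Y ⊗ X) Y) ≫ q.evaluation'.hom ▷ Y.obj =
      (q.evaluation' ▷ Y).hom ≫ dag (m (𝟙_ (RepU A)) Y) := dag_m_whiskerRight q.evaluation' Y
    have h4 : (Y ◁ q.coevaluation').hom ≫ (α_ Y X Y).inv.hom ≫ (q.evaluation' ▷ Y).hom =
      (ρ_ Y).hom.hom ≫ (λ_ Y).inv.hom := congrArg Hom.hom q.coevaluation_evaluation'
    have h5 : Y.obj ◁ η[A] ≫ Y.actR = (ρ_ Y.obj).hom := Y.bim.actR_one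
    have h6 := m_rightUnitor_hom Y
    simp only [MonoidalCategory.whiskerLeft_comp, comp_whiskerRight, Category.assoc]
    rw [reassoc_of% h2, reassoc_of% h3, ← reassoc_of% h1, reassoc_of% h4, reassoc_of% h6,
      reassoc_of% h5, leftUnitor_inv_hom_dag]
  evaluation_coevaluation' := by
    have h1 : m (𝟙_ (RepU A)) X ≫ (q.coevaluation' ▷ X).hom =
      q.coevaluation'.hom ▷ X.obj ≫ m (X ⊗ Y) X := m_whiskerRight q.coevaluation' X
    have h2 := dag_m_frobenius' X Y X
    have h3 : dag (m X (Y ⊗ X)) ≫ X.obj ◁ q.evaluation'.hom =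
      (X ◁ q.evaluation').hom ≫ dag (m X (𝟙_ (RepU A))) := dag_m_whiskerLeft X q.evaluation'
    have h4 : (q.coevaluation' ▷ X).hom ≫ (α_ X Y X).hom.hom ≫ (X ◁ q.evaluation').hom =
      (λ_ X).hom.hom ≫ (ρ_ X).inv.hom := congrArg Hom.hom q.evaluation_coevaluation'
    have h6 := m_leftUnitor_hom X
    have h7 := X.one_act
    simp only [MonoidalCategory.whiskerLeft_comp, comp_whiskerRight, Category.assoc]
    rw [reassoc_of% h2, reassoc_of% h3, ← reassoc_of% h1, reassoc_of% h4, reassoc_of% h6,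
      reassoc_of% h7, rightUnitor_inv_hom_dag]

theorem restrictPairing_coev {X Y : RepU A} (q : ExactPairing X Y) :
    (restrictPairing q).coevaluation' = η[A] ≫ q.coevaluation'.hom ≫ dag (m X Y) := rfl

theorem restrictPairing_ev {X Y : RepU A} (q : ExactPairing X Y) :
    (restrictPairing q).evaluation' = m Y X ≫ q.evaluation'.hom ≫ dag η[A] := rfl

/-- The conditional expectation of `End X.obj` onto the module endomorphisms. -/
noncomputable def condExp (X : RepU A) (F : X.obj ⟶ X.obj) : X ⟶ X where
  hom := (dA A)⁻¹ • (dag X.act ≫ A ◁ F ≫ X.act)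
  comm := by
    have h1 := act_dag_act X
    have h2 := X.assoc
    have h3 : A ◁ (dag X.act ≫ A ◁ F ≫ X.act) ≫ X.act =
        X.act ≫ dag X.act ≫ A ◁ F ≫ X.act := by
      rw [← Category.assoc X.act, ← h1]
      calc A ◁ (dag X.act ≫ A ◁ F ≫ X.act) ≫ X.act
          = A ◁ dag X.act ⊗≫ (A ⊗ A) ◁ F ⊗≫ ((α_ A A X.obj).hom ≫ A ◁ X.act ≫ X.act) := by
            monoidal
        _ = A ◁ dag X.act ⊗≫ ((A ⊗ A) ◁ F ≫ μ[A] ▷ X.obj) ≫ X.act := by rw [← h2]; monoidal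
        _ = _ := by rw [whisker_exchange]; monoidal
    rw [MonoidalLinear.whiskerLeft_smul, Linear.smul_comp, Linear.comp_smul, h3]

theorem condExp_eq (X : RepU A) (F : X.obj ⟶ X.obj) :
    (condExp X F).hom = (dA A)⁻¹ • (dag X.actR ≫ F ▷ A ≫ X.actR) := by
  rw [actR, dag_comp, dag_braiding]
  simp [condExp]

theorem dag_m_balanced (X Y : RepU A) : dag (m X Y) ≫ dag X.actR ▷ Y.obj =
    dag (m X Y) ≫ X.obj ◁ dag Y.act ≫ (α_ X.obj A Y.obj).inv := by
  have h := congrArg dag (m_balanced X Y)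
  simpa [dag_comp, dag_whiskerLeft, dag_whiskerRight, dag_associator] using h

/-- The averaging loop around `F` can be moved across the tensor product onto `Y`, where it closes
up to the scalar `d`. -/
theorem dag_m_condExp_right (X Y : RepU A) (F : X.obj ⟶ X.obj) :
    dag (m X Y) ≫ F ▷ Y.obj ≫ m X Y = dag (m X Y) ≫ (condExp X F).hom ▷ Y.obj ≫ m X Y := by
  have h1 := dag_m_balanced X Y
  have h2 := m_balanced X Y
  rw [condExp_eq, MonoidalLinear.smul_whiskerRight, Linear.smul_comp, Linear.comp_smul,
    eq_inv_smul_iff₀ dA_ne]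
  simp only [comp_whiskerRight, Category.assoc]
  rw [reassoc_of% h1, h2, associator_naturality_left_assoc, ← whisker_exchange_assoc,
    Iso.inv_hom_id_assoc, ← MonoidalCategory.whiskerLeft_comp_assoc, dag_act_act]
  simp

theorem dag_m_condExp_left (X Y : RepU A) (F : X.obj ⟶ X.obj) :
    dag (m Y X) ≫ Y.obj ◁ F ≫ m Y X = dag (m Y X) ≫ Y.obj ◁ (condExp X F).hom ≫ m Y X := by
  have h1 : dag (m Y X) ≫ Y.obj ◁ dag X.act = dag (m Y X) ≫ dag Y.actR ▷ X.obj ≫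
      (α_ Y.obj A X.obj).hom := by
    rw [reassoc_of% (dag_m_balanced Y X)]; simp
  have h2 := m_balanced' Y X
  rw [condExp, MonoidalLinear.whiskerLeft_smul, Linear.smul_comp, Linear.comp_smul,
    eq_inv_smul_iff₀ dA_ne]
  simp only [MonoidalCategory.whiskerLeft_comp, Category.assoc]
  rw [reassoc_of% h1, h2, associator_inv_naturality_right_assoc, whisker_exchange_assoc,
    Iso.hom_inv_id_assoc, ← comp_whiskerRight_assoc, dag_actR_actR]
  simp

variable (A) in
/-- The ratio of the traces in `C` and in the category of modules. -/
noncomputable def traceRatio : ℂ := dA A * sc C (η[A] ≫ dag η[A])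

theorem unit_end_eq (f : 𝟙_ (RepU A) ⟶ 𝟙_ (RepU A)) : f.hom = sc (RepU A) f • 𝟙 A := by
  have h : f = sc (RepU A) f • 𝟙 (𝟙_ (RepU A)) := (sc (RepU A)).injective (by simp [sc_smul_id])
  conv_lhs => rw [h]
  rfl

/-- Between `dag m` and `m` the endomorphism `F` acts as its expectation, at the cost of `d`. The
module trace is a scalar endomorphism of `A`, and closing it with the unit of `A` contributes the
squared norm of that unit. -/
theorem trL_restrictPairing {X Y : RepU A} (q : ExactPairing X Y) (F : X.obj ⟶ X.obj) :
    trL (restrictPairing q) F = traceRatio A * trL q (condExp X F) := by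
  have h1 : ∀ G : X ⟶ X, dag (m X Y) ≫ G.hom ▷ Y.obj ≫ m X Y = dA A • (G ▷ Y).hom := by
    intro G
    rw [← m_whiskerRight, ← Category.assoc, dag_m_m]
    simp
  have h2 := unit_end_eq (q.coevaluation' ≫ condExp X F ▷ Y ≫ dag q.coevaluation')
  rw [trL_apply, trL_apply, restrictPairing_coev, dag_comp, dag_comp, dag_dag]
  simp only [comp_hom, dag_hom] at h2
  simp only [Category.assoc]
  rw [← Category.assoc (F ▷ Y.obj), ← Category.assoc (dag (m X Y)), dag_m_condExp_right, h1]
  simp only [Linear.smul_comp, Linear.comp_smul]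
  rw [← Category.assoc ((condExp X F) ▷ Y).hom, ← Category.assoc q.coevaluation'.hom, h2]
  simp only [Linear.smul_comp, Linear.comp_smul, map_smul, smul_eq_mul]
  change dA A * (_ * sc C (η[A] ≫ 𝟙 A ≫ dag η[A])) = _
  rw [traceRatio, Category.id_comp]
  ring

theorem trR_restrictPairing {X Y : RepU A} (q : ExactPairing X Y) (F : X.obj ⟶ X.obj) :
    trR (restrictPairing q) F = traceRatio A * trR q (condExp X F) := by
  have h1 : ∀ G : X ⟶ X, dag (m Y X) ≫ Y.obj ◁ G.hom ≫ m Y X = dA A • (Y ◁ G).hom := by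
    intro G
    rw [← m_whiskerLeft, ← Category.assoc, dag_m_m]
    simp
  have h2 := unit_end_eq (dag q.evaluation' ≫ Y ◁ condExp X F ≫ q.evaluation')
  rw [trR_apply, trR_apply, restrictPairing_ev, dag_comp, dag_comp, dag_dag]
  simp only [comp_hom, dag_hom] at h2
  simp only [Category.assoc]
  rw [← Category.assoc (Y.obj ◁ F), ← Category.assoc (dag (m Y X)), dag_m_condExp_left, h1]
  simp only [Linear.smul_comp, Linear.comp_smul]
  rw [← Category.assoc (Y ◁ condExp X F).hom, ← Category.assoc (dag q.evaluation'.hom), h2]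
  simp only [Linear.smul_comp, Linear.comp_smul, map_smul, smul_eq_mul]
  change dA A * (_ * sc C (η[A] ≫ 𝟙 A ≫ dag η[A])) = _
  rw [traceRatio, Category.id_comp]
  ring

theorem isStandard_restrictPairing {X Y : RepU A} {q : ExactPairing X Y} (hq : IsStandard q) :
    IsStandard (restrictPairing q) := by
  rw [isStandard_iff] at hq ⊢
  ext F
  rw [trL_restrictPairing, trR_restrictPairing, hq]

/-- `m` intertwines braidings and whiskerings, so the twist relation for modules pulls back to `C`;
with `isStandard_restrictPairing` this is why the canonical twists agree. -/
theorem isTwistFor_restrictPairing {X Y : RepU A} {q : ExactPairing X Y} {θ : X ⟶ X}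
    (h : IsTwistFor q θ) : IsTwistFor (restrictPairing q) θ.hom := by
  have h1 := m_whiskerRight θ Y
  have h2 := m_braiding X Y
  have h3 : (θ ▷ Y).hom ≫ (β_ X Y).hom.hom ≫ q.evaluation'.hom = dag q.coevaluation'.hom :=
    congrArg Hom.hom h
  unfold IsTwistFor
  rw [restrictPairing_coev, restrictPairing_ev, dag_comp, dag_comp, dag_dag, ← reassoc_of% h2,
    ← reassoc_of% h1, reassoc_of% h3, Category.assoc]

theorem condExp_hom {X : RepU A} (F : X ⟶ X) : condExp X F.hom = F := by
  apply hom_ext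
  change (dA A)⁻¹ • (dag X.act ≫ A ◁ F.hom ≫ X.act) = F.hom
  rw [F.comm, ← Category.assoc, dag_act_act]
  simp [smul_smul, dA_ne]

theorem tr_condExp (hC : IsRigid C) (hR : IsRigid (RepU A)) (X : RepU A) (F : X.obj ⟶ X.obj) :
    tr hC X.obj F = traceRatio A * tr hR X (condExp X F) := by
  obtain ⟨Y, q, hq⟩ := exists_standard hR X
  rw [tr_eq hC (isStandard_restrictPairing hq), tr_eq hR hq, trL_restrictPairing]

theorem tr_hom (hC : IsRigid C) (hR : IsRigid (RepU A)) {X : RepU A} (F : X ⟶ X) :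
    tr hC X.obj F.hom = traceRatio A * tr hR X F := by
  rw [tr_condExp hC hR, condExp_hom]

theorem exists_canonicalTwist (hC : IsRigid C) (hR : IsRigid (RepU A)) (X : RepU A) :
    ∃ θ : X ⟶ X, IsUnitary θ ∧ IsCanonicalTwistAt X θ ∧ IsCanonicalTwistAt X.obj θ.hom := by
  obtain ⟨Y, q, hq⟩ := exists_standard hR X
  obtain ⟨θ, h1, h2⟩ := hq.exists_twist hR
  exact ⟨θ, h1, h2.isCanonicalTwistAt hR hq,
    (isTwistFor_restrictPairing h2).isCanonicalTwistAt hC (isStandard_restrictPairing hq)⟩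

/-- `A` is the unit object of `RepU A`, where the canonical twist is the identity. -/
theorem isCanonicalTwistAt_algebra (hC : IsRigid C) (hR : IsRigid (RepU A)) :
    IsCanonicalTwistAt A (𝟙 A) := by
  obtain ⟨θ, -, h1, h2⟩ := exists_canonicalTwist hC hR (𝟙_ (RepU A))
  rw [h1.unique (isCanonicalTwistAt_unit hR)] at h2
  exact h2

end RepU

end ModuleRigid

/-! ### Partial traces and monodromy -/

section Monodromy

variable {C : Type u} [Category.{v} C] [Preadditive C] [Linear ℂ C] [StarCategory C]
  [MonoidalCategory C] [BraidedCategory C] [IsBraidedCStarTensorCategory C]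

open IsCStarTensorCategory IsBraidedCStarTensorCategory

/-- The canonical twist turns the braided evaluation into the adjoint coevaluation of a standard
pairing. Changing the dual inserts mutually inverse isomorphisms, so `p` itself need not be
standard. -/
theorem ribbonTrace_eq (hC : IsRigid C) {θ : ∀ X : C, X ⟶ X} {X Y : C}
    (hθ : IsCanonicalTwistAt X (θ X)) (p : ExactPairing X Y) (F : X ⟶ X) :
    ribbonTrace θ p F = tr hC X F • 𝟙 (𝟙_ C) := by
  obtain ⟨Z, q, hq⟩ := exists_standard hC X
  have h1 := hθ.isTwistFor hC hq
  obtain ⟨u, -, -, -, h2, h3, -⟩ := exists_dual_iso p q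
  unfold IsTwistFor at h1
  unfold ribbonTrace
  rw [tr_eq hC hq, trL_apply, sc_smul_id, ← h1, ← h3, ← h2, comp_whiskerRight,
    ← BraidedCategory.braiding_naturality_right_assoc]
  simp only [Category.assoc]
  rw [whisker_exchange_assoc, whisker_exchange_assoc]

/-- The right partial trace. -/
def partialTrace {Y Z : C} (p : ExactPairing Y Z) {X : C} (F : X ⊗ Y ⟶ X ⊗ Y) : X ⟶ X :=
  (ρ_ X).inv ≫ X ◁ p.coevaluation' ≫ (α_ X Y Z).inv ≫ F ▷ Z ≫ (α_ X Y Z).hom ≫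
    X ◁ dag p.coevaluation' ≫ (ρ_ X).hom

/-- The left partial trace. -/
def leftPartialTrace {X W : C} (p : ExactPairing X W) {Y : C} (F : X ⊗ Y ⟶ X ⊗ Y) : Y ⟶ Y :=
  (λ_ Y).inv ≫ dag p.evaluation' ▷ Y ≫ (α_ W X Y).hom ≫ W ◁ F ≫ (α_ W X Y).inv ≫
    p.evaluation' ▷ Y ≫ (λ_ Y).hom

/-- The product of two pairings. -/
abbrev tensorPairing {X Y W Z : C} (p : ExactPairing X W) (q : ExactPairing Y Z) :
    ExactPairing (X ⊗ Y) (Z ⊗ W) := ExactPairing.tensor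

theorem tensorPairing_coev {X Y W Z : C} (p : ExactPairing X W) (q : ExactPairing Y Z) :
    (tensorPairing p q).coevaluation' = p.coevaluation' ≫
      ((ρ_ X).inv ≫ X ◁ q.coevaluation' ≫ (α_ X Y Z).inv) ▷ W ≫ (α_ (X ⊗ Y) Z W).hom := by
  have h : (tensorPairing p q).coevaluation' =
      p.coevaluation' ⊗≫ (X ◁ q.coevaluation') ▷ W ⊗≫ 𝟙 _ := rfl
  rw [h]
  monoidal

theorem tensorPairing_ev {X Y W Z : C} (p : ExactPairing X W) (q : ExactPairing Y Z) :
    (tensorPairing p q).evaluation' = (α_ Z W (X ⊗ Y)).hom ≫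
      Z ◁ ((α_ W X Y).inv ≫ p.evaluation' ▷ Y ≫ (λ_ Y).hom) ≫ q.evaluation' := by
  have h : (tensorPairing p q).evaluation' =
      𝟙 _ ⊗≫ Z ◁ (p.evaluation' ▷ Y) ⊗≫ q.evaluation' := rfl
  rw [h]
  monoidal

theorem trL_tensorPairing {X Y W Z : C} (p : ExactPairing X W) (q : ExactPairing Y Z)
    (F : X ⊗ Y ⟶ X ⊗ Y) : trL (tensorPairing p q) F = trL p (partialTrace q F) := by
  rw [trL_apply, trL_apply, tensorPairing_coev, partialTrace]
  congr 1
  simp [dag_comp, dag_whiskerLeft, dag_whiskerRight, dag_associator, dag_associator_inv,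
    dag_leftUnitor_inv]

theorem trR_tensorPairing {X Y W Z : C} (p : ExactPairing X W) (q : ExactPairing Y Z)
    (F : X ⊗ Y ⟶ X ⊗ Y) : trR (tensorPairing p q) F = trR q (leftPartialTrace p F) := by
  rw [trR_apply, trR_apply, tensorPairing_ev, leftPartialTrace]
  congr 1
  simp [dag_comp, dag_whiskerLeft, dag_whiskerRight, dag_associator, dag_associator_inv,
    dag_leftUnitor]

theorem trR_partialTrace {X Y W Z : C} (p : ExactPairing X W) (q : ExactPairing Y Z)
    (F : X ⊗ Y ⟶ X ⊗ Y) : trR p (partialTrace q F) = trL q (leftPartialTrace p F) := by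
  rw [trR_apply, trL_apply, partialTrace, leftPartialTrace]
  congr 1
  have h1 := whisker_exchange (dag p.evaluation') q.coevaluation'
  have h2 := whisker_exchange p.evaluation' (dag q.coevaluation')
  calc _ = 𝟙 _ ⊗≫ (dag p.evaluation' ▷ 𝟙_ C ≫ (W ⊗ X) ◁ q.coevaluation') ⊗≫ W ◁ F ▷ Z ⊗≫
        ((W ⊗ X) ◁ dag q.coevaluation' ≫ p.evaluation' ▷ 𝟙_ C) ⊗≫ 𝟙 _ := by monoidal
    _ = _ := by rw [← h1, h2]; monoidal

/-- Both traces on `X ⊗ Y` are iterated partial traces; each factor can be switched between left and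
right closure in turn. -/
theorem IsStandard.tensor {X Y W Z : C} {p : ExactPairing X W} {q : ExactPairing Y Z}
    (hp : IsStandard p) (hq : IsStandard q) : IsStandard (tensorPairing p q) := by
  rw [isStandard_iff] at hp hq ⊢
  ext F
  rw [trL_tensorPairing, trR_tensorPairing, hp, trR_partialTrace, hq]

theorem tr_partialTrace (hC : IsRigid C) {X Y Z : C} {q : ExactPairing Y Z} (hq : IsStandard q)
    (F : X ⊗ Y ⟶ X ⊗ Y) : tr hC X (partialTrace q F) = tr hC (X ⊗ Y) F := by
  obtain ⟨W, p, hp⟩ := exists_standard hC X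
  rw [tr_eq hC hp, tr_eq hC (hp.tensor hq), trL_tensorPairing]

/-- The monodromy. -/
def monodromy (X Y : C) : X ⊗ Y ⟶ X ⊗ Y := (β_ X Y).hom ≫ (β_ Y X).hom

theorem monodromy_naturality_left {X X' : C} (f : X ⟶ X') (Y : C) :
    f ▷ Y ≫ monodromy X' Y = monodromy X Y ≫ f ▷ Y := by
  simp [monodromy]

theorem monodromy_naturality_right (X : C) {Y Y' : C} (f : Y ⟶ Y') :
    X ◁ f ≫ monodromy X Y' = monodromy X Y ≫ X ◁ f := by
  simp [monodromy]

theorem monodromy_naturality_right_assoc (X : C) {Y Y' Z : C} (f : Y ⟶ Y') (g : X ⊗ Y' ⟶ Z) :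
    X ◁ f ≫ monodromy X Y' ≫ g = monodromy X Y ≫ X ◁ f ≫ g := by
  simp [monodromy]

theorem monodromy_tensor_right (X Y Z : C) : monodromy X (Y ⊗ Z) =
    (α_ X Y Z).inv ≫ (β_ X Y).hom ▷ Z ≫ (α_ Y X Z).hom ≫ Y ◁ monodromy X Z ≫
      (α_ Y X Z).inv ≫ (β_ Y X).hom ▷ Z ≫ (α_ X Y Z).hom := by
  simp [monodromy, BraidedCategory.braiding_tensor_left_hom,
    BraidedCategory.braiding_tensor_right_hom]

/-- The two decompositions of the full twist on three strands. -/
theorem fullTwist (X Y Z : C) :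
    (α_ X Y Z).inv ≫ monodromy (X ⊗ Y) Z ≫ monodromy X Y ▷ Z ≫ (α_ X Y Z).hom =
      X ◁ monodromy Y Z ≫ monodromy X (Y ⊗ Z) := by
  have h3 : X ◁ monodromy Y Z ≫ monodromy X (Y ⊗ Z) = X ◁ (β_ Y Z).hom ≫
      monodromy X (Z ⊗ Y) ≫ X ◁ (β_ Z Y).hom := by
    rw [← monodromy_naturality_right, ← MonoidalCategory.whiskerLeft_comp_assoc]
    rfl
  have h4 : monodromy (X ⊗ Y) Z ≫ monodromy X Y ▷ Z =
      (β_ (X ⊗ Y) Z).hom ≫ Z ◁ monodromy X Y ≫ (β_ Z (X ⊗ Y)).hom := by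
    rw [BraidedCategory.braiding_naturality_right, monodromy, Category.assoc]
  rw [h3, monodromy_tensor_right, reassoc_of% h4, BraidedCategory.braiding_tensor_left_hom,
    BraidedCategory.braiding_tensor_right_hom]
  simp

/-- The trace of the monodromy. -/
noncomputable def hopf (hC : IsRigid C) (X Y : C) : ℂ := tr hC (X ⊗ Y) (monodromy X Y)

theorem hopf_comm (hC : IsRigid C) (X Y : C) : hopf hC X Y = hopf hC Y X := by
  rw [hopf, hopf, monodromy, tr_comm, monodromy]

theorem hopf_sum_right (hC : IsRigid C) {J : Type*} [Fintype J] (X : C) {Y : C} {W : J → C}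
    (a : ∀ t, W t ⟶ Y) (b : ∀ t, Y ⟶ W t) (hab : ∀ t, a t ≫ b t = 𝟙 (W t))
    (hs : ∑ t, b t ≫ a t = 𝟙 Y) : hopf hC X Y = ∑ t, hopf hC X (W t) := by
  have h : monodromy X Y = ∑ t, X ◁ b t ≫ X ◁ a t ≫ monodromy X Y := by
    conv_lhs => rw [← Category.id_comp (monodromy X Y), ← MonoidalCategory.whiskerLeft_id, ← hs,
      whiskerLeft_sum', Preadditive.sum_comp]
    simp
  rw [hopf, h, map_sum]
  refine Finset.sum_congr rfl fun t _ => ?_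
  rw [tr_comm, hopf, monodromy_naturality_right, Category.assoc,
    ← MonoidalCategory.whiskerLeft_comp, hab]
  simp

theorem hopf_sum_left (hC : IsRigid C) {J : Type*} [Fintype J] (X : C) {Y : C} {W : J → C}
    (a : ∀ t, W t ⟶ Y) (b : ∀ t, Y ⟶ W t) (hab : ∀ t, a t ≫ b t = 𝟙 (W t))
    (hs : ∑ t, b t ≫ a t = 𝟙 Y) : hopf hC Y X = ∑ t, hopf hC (W t) X := by
  rw [hopf_comm, hopf_sum_right hC X a b hab hs]
  exact Finset.sum_congr rfl fun t _ => hopf_comm hC _ _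

theorem whiskerLeft_partialTrace {Y Z : C} (q : ExactPairing Y Z) (W : C) {X : C}
    (F : X ⊗ Y ⟶ X ⊗ Y) (G : W ⊗ X ⟶ W ⊗ X) :
    partialTrace q ((α_ W X Y).hom ≫ W ◁ F ≫ (α_ W X Y).inv ≫ G ▷ Y) =
      W ◁ partialTrace q F ≫ G := by
  have h := whisker_exchange G (dag q.coevaluation')
  unfold partialTrace
  calc _ = 𝟙 _ ⊗≫ W ◁ X ◁ q.coevaluation' ⊗≫ W ◁ F ▷ Z ⊗≫
        (G ▷ (Y ⊗ Z) ≫ (W ⊗ X) ◁ dag q.coevaluation') ⊗≫ 𝟙 _ := by monoidal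
    _ = _ := by rw [← h]; monoidal

/-- Closing the `Y'`-strand encircling the simple object `S` gives a scalar endomorphism of `S`, so
the two encircling strands contribute independently. -/
theorem hopf_tensor (hC : IsRigid C) {S : C} (hS : Module.finrank ℂ (S ⟶ S) = 1) (Y Y' : C) :
    hopf hC S (Y ⊗ Y') * tr hC S (𝟙 S) = hopf hC S Y * hopf hC S Y' := by
  obtain ⟨Z, q, hq⟩ := exists_standard hC Y'
  obtain ⟨c, hc⟩ := exists_smul_id hS (partialTrace q (monodromy S Y'))
  have h1 : hopf hC S Y' = c * tr hC S (𝟙 S) := by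
    rw [hopf, ← tr_partialTrace hC hq, hc, map_smul, smul_eq_mul]
  have h2 : hopf hC S (Y ⊗ Y') = c * hopf hC S Y := by
    have h3 : tr hC (S ⊗ Y ⊗ Y') (monodromy S (Y ⊗ Y')) =
        tr hC ((Y ⊗ S) ⊗ Y') ((α_ Y S Y').hom ≫ Y ◁ monodromy S Y' ≫ (α_ Y S Y').inv ≫
          monodromy Y S ▷ Y') := by
      rw [monodromy_tensor_right, ← Category.assoc, tr_comm]
      congr 1
      simp [monodromy]
    rw [hopf, h3, ← tr_partialTrace hC hq, whiskerLeft_partialTrace, hc, hopf_comm, hopf]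
    simp
  rw [h1, h2]
  ring

end Monodromy

/-! ### Families of simple objects -/

section SimpleFamily

variable {C : Type u} [Category.{v} C] [Preadditive C] [Linear ℂ C] [StarCategory C]
  [MonoidalCategory C] [IsCStarTensorCategory C]

open IsCStarTensorCategory

/-- Schur's lemma: the scalars of `f ≫ dag f` and `dag f ≫ f` coincide and are nonzero, so `dag f`
is the inverse up to scaling. -/
theorem exists_inverse_of_simple {S S' : C} (hS : Module.finrank ℂ (S ⟶ S) = 1)
    (hS' : Module.finrank ℂ (S' ⟶ S') = 1) {f : S ⟶ S'} (hf : f ≠ 0) :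
    ∃ g : S' ⟶ S, f ≫ g = 𝟙 S ∧ g ≫ f = 𝟙 S' := by
  obtain ⟨c, hc⟩ := exists_smul_id hS (f ≫ dag f)
  obtain ⟨c', hc'⟩ := exists_smul_id hS' (dag f ≫ f)
  have hc0 : c ≠ 0 := by
    rintro rfl
    rw [zero_smul] at hc
    exact hf (eq_zero_of_comp_dag hc)
  have h1 : c • f = c' • f := by
    have h := f ≫= hc'
    rw [← Category.assoc, hc] at h
    simpa using h
  have h2 : c = c' := smul_left_injective ℂ hf h1
  refine ⟨c⁻¹ • dag f, ?_, ?_⟩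
  · rw [Linear.comp_smul, hc, inv_smul_smul₀ hc0]
  · rw [Linear.smul_comp, hc', ← h2, inv_smul_smul₀ hc0]

/-- If every nonzero object receives a nonzero morphism from a fixed object, there are finitely
many simple objects. -/
theorem exists_simple_family (hC : IsRigid C) (M : C)
    (hM : ∀ X : C, 𝟙 X ≠ 0 → ∃ f : M ⟶ X, f ≠ 0) :
    ∃ (n : ℕ) (S : Fin n → C), (∀ i, Module.finrank ℂ (S i ⟶ S i) = 1) ∧
      (∀ i j, i ≠ j → ∀ f : S i ⟶ S j, f = 0) ∧
      (∀ X : C, ∃ (k : ℕ) (c : Fin k → Fin n) (a : ∀ t, S (c t) ⟶ X) (b : ∀ t, X ⟶ S (c t)),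
        (∀ t, a t ≫ b t = 𝟙 _) ∧ (∀ t t', t ≠ t' → a t ≫ b t' = 0) ∧
          ∑ t, b t ≫ a t = 𝟙 X) := by
  classical
  obtain ⟨J, _, W, v, hv, hW⟩ := exists_decomposition hC M
  have htrans : ∀ {X Y Z : C}, Module.finrank ℂ (X ⟶ X) = 1 → Module.finrank ℂ (Y ⟶ Y) = 1 →
      (∃ f : X ⟶ Y, f ≠ 0) → (∃ g : Y ⟶ Z, g ≠ 0) → ∃ h : X ⟶ Z, h ≠ 0 := by
    rintro X Y Z hX hY ⟨f, hf⟩ ⟨g, hg⟩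
    obtain ⟨f', -, h2⟩ := exists_inverse_of_simple hX hY hf
    refine ⟨f ≫ g, fun h => hg ?_⟩
    rw [← Category.id_comp g, ← h2, Category.assoc, h, Limits.comp_zero]
  -- The simple objects are the summands of `M` up to isomorphism; for simple summands this means
  -- existence of a nonzero morphism.
  let r : Setoid J :=
    { r := fun s s' => ∃ f : W s ⟶ W s', f ≠ 0
      iseqv :=
        { refl := fun s => ⟨𝟙 _, id_ne_zero_of_finrank (hW s)⟩
          symm := by
            rintro s s' ⟨f, hf⟩
            exact ⟨dag f, fun h => hf (by rw [← dag_dag f, h, dag_zero])⟩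
          trans := fun {s s' _} h h' => htrans (hW s) (hW s') h h' } }
  let e : Quotient r ≃ Fin (Fintype.card (Quotient r)) := Fintype.equivFin _
  have hrep : ∀ X : C, Module.finrank ℂ (X ⟶ X) = 1 →
      ∃ i, ∃ f : W (e.symm i).out ⟶ X, f ≠ 0 := by
    intro X hX
    obtain ⟨f, hf⟩ := hM X (id_ne_zero_of_finrank hX)
    obtain ⟨s, hs⟩ : ∃ s, dag (v s) ≫ f ≠ 0 := by
      by_contra hcon
      push Not at hcon
      apply hf
      rw [← Category.id_comp f, ← hv.sum, Preadditive.sum_comp]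
      exact Finset.sum_eq_zero fun s _ => by rw [Category.assoc, hcon s, Limits.comp_zero]
    refine ⟨e ⟦s⟧, ?_⟩
    rw [e.symm_apply_apply]
    exact htrans (hW _) (hW s) (Quotient.mk_out (s := r) s) ⟨_, hs⟩
  refine ⟨_, fun i => W (e.symm i).out, fun i => hW _, fun i j hij f => ?_, fun X => ?_⟩
  · by_contra hf
    apply hij
    have h : (⟦(e.symm i).out⟧ : Quotient r) = ⟦(e.symm j).out⟧ := Quotient.sound ⟨f, hf⟩
    rw [Quotient.out_eq, Quotient.out_eq] at h
    exact e.symm.injective h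
  · obtain ⟨K, _, W', v', hv', hW'⟩ := exists_decomposition hC X
    choose c φ hφ using fun t => hrep (W' t) (hW' t)
    choose ψ h1 h2 using fun t => exists_inverse_of_simple (hW _) (hW' t) (hφ t)
    let k : K ≃ Fin (Fintype.card K) := Fintype.equivFin K
    refine ⟨_, fun t => c (k.symm t), fun t => φ (k.symm t) ≫ dag (v' (k.symm t)),
      fun t => v' (k.symm t) ≫ ψ (k.symm t), fun t => ?_, fun t t' htt => ?_, ?_⟩
    · rw [Category.assoc, reassoc_of% (hv'.isometry (k.symm t)), h1]
    · rw [Category.assoc, reassoc_of% (hv'.orthogonal _ _ fun h => htt (k.symm.injective h))]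
      simp
    · rw [Equiv.sum_comp k.symm fun t => (v' t ≫ ψ t) ≫ φ t ≫ dag (v' t), ← hv'.sum]
      refine Finset.sum_congr rfl fun t _ => ?_
      rw [Category.assoc, reassoc_of% (h2 t)]

end SimpleFamily

/-! ### Local induction -/

section LocalInduction

variable {C : Type u} [Category.{v} C] [Preadditive C] [Linear ℂ C] [StarCategory C]
  [MonoidalCategory C] [BraidedCategory C] [IsBraidedCStarTensorCategory C] {A : C} [MonObj A]
  [IsQSystem A] [IsCommMonObj A]

open IsCStarTensorCategory IsBraidedCStarTensorCategory

namespace RepU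

/-- The action on a free module. -/
def freeAct (A : C) [MonObj A] (V : C) : A ⊗ A ⊗ V ⟶ A ⊗ V := (α_ A A V).inv ≫ μ[A] ▷ V

variable (V : C)

theorem freeAct_one : η[A] ▷ (A ⊗ V) ≫ freeAct A V = (λ_ (A ⊗ V)).hom := by
  rw [freeAct, associator_inv_naturality_left_assoc, ← comp_whiskerRight, MonObj.one_mul]
  monoidal

theorem freeAct_assoc : μ[A] ▷ (A ⊗ V) ≫ freeAct A V =
    (α_ A A (A ⊗ V)).hom ≫ A ◁ freeAct A V ≫ freeAct A V := by
  have h := MonObj.mul_assoc A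
  calc μ[A] ▷ (A ⊗ V) ≫ freeAct A V = 𝟙 _ ⊗≫ (μ[A] ▷ A ≫ μ[A]) ▷ V := by rw [freeAct]; monoidal
    _ = _ := by rw [h, freeAct]; monoidal

theorem freeAct_unitary : IsUnitaryLeft A (freeAct A V) :=
  tensor_unitaryLeft (unitObj (A := A)).unitary V

theorem dag_freeAct : dag (freeAct A V) = dag μ[A] ▷ V ≫ (α_ A A V).hom := by
  rw [freeAct, dag_comp, dag_whiskerRight, dag_associator_inv]

theorem dag_freeAct_freeAct : dag (freeAct A V) ≫ freeAct A V = dA A • 𝟙 (A ⊗ V) := by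
  rw [dag_freeAct, freeAct]
  simp only [Category.assoc, Iso.hom_inv_id_assoc]
  rw [← comp_whiskerRight, dag_mul_mul]
  simp

/-- The multiple `d` of the projection of a free module onto its single-valued part. -/
def localizing (A : C) [MonObj A] (V : C) : A ⊗ V ⟶ A ⊗ V :=
  dag (freeAct A V) ≫ monodromy A (A ⊗ V) ≫ freeAct A V

theorem dag_mul_braiding : dag μ[A] ≫ (β_ A A).hom = dag μ[A] := by
  have h := congrArg dag (IsCommMonObj.mul_comm A)
  rw [dag_comp, dag_braiding] at h
  conv_lhs => rw [← h]
  simp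

theorem localizing_eq : localizing A V = dag μ[A] ▷ V ≫ (α_ A A V).hom ≫ A ◁ monodromy A V ≫
    (α_ A A V).inv ≫ μ[A] ▷ V := by
  rw [localizing, dag_freeAct, freeAct, monodromy_tensor_right]
  simp only [Category.assoc, Iso.hom_inv_id_assoc]
  rw [← comp_whiskerRight_assoc (dag μ[A]), dag_mul_braiding, ← comp_whiskerRight,
    IsCommMonObj.mul_comm]

theorem localizing_linear :
    A ◁ localizing A V ≫ freeAct A V = freeAct A V ≫ localizing A V := by
  have h := MonObj.mul_assoc A
  have h' : A ◁ dag μ[A] ≫ (α_ A A A).inv ≫ μ[A] ▷ A = μ[A] ≫ dag μ[A] := by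
    have := congrArg dag (IsQSystem.frobenius (A := A))
    simpa [dag_comp, dag_whiskerLeft, dag_whiskerRight, dag_associator, dag_dag] using this
  calc A ◁ localizing A V ≫ freeAct A V
      = 𝟙 _ ⊗≫ A ◁ dag μ[A] ▷ V ⊗≫ A ◁ A ◁ monodromy A V ⊗≫
          ((α_ A A A).hom ≫ A ◁ μ[A] ≫ μ[A]) ▷ V := by rw [localizing_eq, freeAct]; monoidal
    _ = 𝟙 _ ⊗≫ A ◁ dag μ[A] ▷ V ⊗≫ ((A ⊗ A) ◁ monodromy A V ≫ μ[A] ▷ (A ⊗ V)) ⊗≫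
          μ[A] ▷ V := by rw [← h]; monoidal
    _ = 𝟙 _ ⊗≫ (A ◁ dag μ[A] ≫ (α_ A A A).inv ≫ μ[A] ▷ A) ▷ V ⊗≫ A ◁ monodromy A V ⊗≫
          μ[A] ▷ V := by rw [whisker_exchange]; monoidal
    _ = _ := by rw [h', localizing_eq, freeAct]; monoidal

theorem monodromy_mul : monodromy A A ≫ μ[A] = μ[A] := by
  simp [monodromy]

/-- The full twist on three strands splits in two ways; the crossing of the two `A`-strands
disappears into the commutative product, leaving one monodromy inside `localizing` and one outside.
-/
theorem freeAct_localizing : freeAct A V ≫ localizing A V =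
    A ◁ localizing A V ≫ monodromy A (A ⊗ V) ≫ freeAct A V := by
  have h1 : A ◁ dag (freeAct A V) ≫ (α_ A A (A ⊗ V)).inv ≫ μ[A] ▷ (A ⊗ V) =
      freeAct A V ≫ dag (freeAct A V) :=
    dag_linear (tensor_unitaryLeft (unitObj (A := A)).unitary _) (freeAct_unitary V)
      (f := freeAct A V) (by rw [Category.assoc, freeAct_assoc, Iso.inv_hom_id_assoc])
  have h2 := monodromy_naturality_left μ[A] (A ⊗ V)
  have h3 := fullTwist A A (A ⊗ V)
  have h4 : monodromy A A ▷ (A ⊗ V) ≫ μ[A] ▷ (A ⊗ V) = μ[A] ▷ (A ⊗ V) := by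
    rw [← comp_whiskerRight, monodromy_mul]
  have h5 := freeAct_assoc (A := A) V
  have h6 := monodromy_naturality_right A (freeAct A V)
  conv_lhs => rw [localizing]
  rw [← Category.assoc, ← h1]
  simp only [Category.assoc]
  rw [reassoc_of% h2, ← h4]
  simp only [Category.assoc]
  rw [h5, reassoc_of% h3, ← reassoc_of% h6, localizing]
  simp

theorem localizing_singleValued : monodromy A (A ⊗ V) ≫ freeAct A V ≫ localizing A V =
    freeAct A V ≫ localizing A V := by
  rw [← localizing_linear, ← monodromy_naturality_right_assoc, localizing_linear,
    freeAct_localizing]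

theorem localizing_sq : localizing A V ≫ localizing A V = dA A • localizing A V := by
  conv_lhs => enter [1]; rw [localizing]
  rw [Category.assoc, Category.assoc, localizing_singleValued, ← Category.assoc,
    dag_freeAct_freeAct]
  simp

/-- Single-valuedness gives `L* L = d L` for `L = localizing A V`, and the left side is selfadjoint.
-/
theorem dag_localizing : dag (localizing A V) = localizing A V := by
  have h1 : dag (monodromy A (A ⊗ V)) ≫ monodromy A (A ⊗ V) = 𝟙 _ := by
    rw [monodromy, dag_comp, dag_braiding, dag_braiding]
    simp only [Category.assoc, Iso.inv_hom_id_assoc, Iso.inv_hom_id]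
  have h2 : dag (monodromy A (A ⊗ V)) ≫ freeAct A V ≫ localizing A V =
      freeAct A V ≫ localizing A V := by
    conv_lhs => rw [← localizing_singleValued, reassoc_of% h1]
  have h3 : dag (localizing A V) ≫ localizing A V = dA A • localizing A V := by
    conv_lhs => enter [1]; rw [localizing]
    rw [dag_comp, dag_comp, dag_dag, Category.assoc, Category.assoc, h2, ← Category.assoc,
      dag_freeAct_freeAct]
    simp
  have h4 := congrArg dag h3
  rw [dag_comp, dag_dag, h3, dag_smul, conj_dA] at h4
  exact (smul_right_injective _ dA_ne h4).symm

theorem exists_localInduction : ∃ (N : RepU A) (q : A ⊗ V ⟶ N.obj), dag q ≫ q = 𝟙 N.obj ∧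
    q ≫ dag q = (dA A)⁻¹ • localizing A V ∧ A ◁ q ≫ N.act = freeAct A V ≫ q := by
  have hd := dA_ne (A := A)
  refine exists_split (freeAct_one V) (freeAct_assoc V) (freeAct_unitary V) ?_ ?_ ?_ ?_
  · rw [Linear.smul_comp, Linear.comp_smul, localizing_sq, inv_smul_smul₀ hd]
  · rw [dag_smul, dag_localizing, map_inv₀, conj_dA]
  · rw [MonoidalLinear.whiskerLeft_smul, Linear.smul_comp, Linear.comp_smul, localizing_linear]
  · have h := localizing_singleValued (A := A) V
    simp only [monodromy, Category.assoc] at h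
    rw [Linear.comp_smul, Linear.comp_smul, Linear.comp_smul, h]

variable {V}

/-- `f` extends to the free module; as the target is single-valued, the extension is fixed by the
localizing projection and so survives on its image. -/
theorem exists_hom_of_localInduction {N : RepU A} {q : A ⊗ V ⟶ N.obj}
    (h2 : q ≫ dag q = (dA A)⁻¹ • localizing A V) (h3 : A ◁ q ≫ N.act = freeAct A V ≫ q)
    {X : RepU A} {f : V ⟶ X.obj} (hf : f ≠ 0) : ∃ g : N ⟶ X, g ≠ 0 := by
  let g : A ⊗ V ⟶ X.obj := A ◁ f ≫ X.act
  have hg : A ◁ g ≫ X.act = freeAct A V ≫ g := by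
    have h := X.assoc
    calc A ◁ g ≫ X.act = 𝟙 _ ⊗≫ (A ⊗ A) ◁ f ≫ ((α_ A A X.obj).hom ≫ A ◁ X.act ≫ X.act) := by
          change A ◁ (A ◁ f ≫ X.act) ≫ X.act = _
          monoidal
      _ = 𝟙 _ ⊗≫ ((A ⊗ A) ◁ f ≫ μ[A] ▷ X.obj) ≫ X.act := by rw [← h]; monoidal
      _ = freeAct A V ≫ A ◁ f ≫ X.act := by rw [whisker_exchange, freeAct]; monoidal
  have hloc : localizing A V ≫ g = dA A • g := by
    have h5 : monodromy A X.obj ≫ X.act = X.act := by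
      rw [monodromy, Category.assoc, X.singleValued]
    rw [localizing, Category.assoc, Category.assoc, ← hg, ← monodromy_naturality_right_assoc, h5,
      hg, ← Category.assoc, dag_freeAct_freeAct]
    simp
  have hdq : A ◁ dag q ≫ freeAct A V = N.act ≫ dag q :=
    dag_linear (freeAct_unitary V) N.unitary h3
  refine ⟨⟨dag q ≫ g, ?_⟩, fun h => hf ?_⟩
  · rw [MonoidalCategory.whiskerLeft_comp, Category.assoc, hg, reassoc_of% hdq]
  · have h6 : dag q ≫ g = 0 := congrArg Hom.hom h
    have h7 : g = 0 := by
      have h8 := q ≫= h6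
      rw [← Category.assoc, h2, Linear.smul_comp, hloc, inv_smul_smul₀ dA_ne,
        Limits.comp_zero] at h8
      exact h8
    have h9 : η[A] ▷ V ≫ g = (λ_ V).hom ≫ f := by
      change η[A] ▷ V ≫ A ◁ f ≫ X.act = _
      rw [← whisker_exchange_assoc, X.one_act, leftUnitor_naturality]
    rw [h7, Limits.comp_zero] at h9
    have h10 := (λ_ V).inv ≫= h9
    simpa using h10.symm

/-! The balancing of `X` with a free module -/

theorem actR_dag_actR (X : RepU A) : X.actR ≫ dag X.actR =
    X.obj ◁ dag μ[A] ≫ (α_ X.obj A A).inv ≫ X.actR ▷ A := by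
  have h1 : X.actR ▷ A ≫ X.actR = (α_ X.obj A A).hom ≫ X.obj ◁ μ[A] ≫ X.actR := X.bim.assocR
  have h2 := mul_cup (A := A)
  calc X.actR ≫ dag X.actR
      = 𝟙 _ ⊗≫ (X.actR ▷ 𝟙_ C ≫ X.obj ◁ (η[A] ≫ dag μ[A])) ⊗≫ X.actR ▷ A := by
        rw [dag_actR]; monoidal
    _ = 𝟙 _ ⊗≫ (X.obj ⊗ A) ◁ (η[A] ≫ dag μ[A]) ⊗≫ (X.actR ▷ A ≫ X.actR) ▷ A := by
        rw [← whisker_exchange]; monoidal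
    _ = X.obj ◁ ((ρ_ A).inv ≫ A ◁ (η[A] ≫ dag μ[A]) ≫ (α_ A A A).inv ≫ μ[A] ▷ A) ⊗≫
          X.actR ▷ A := by rw [h1]; monoidal
    _ = _ := by rw [h2]; monoidal

/-- The multiple `d` of the projection of `X ⊗ (A ⊗ V)` onto `X ⊗_A (A ⊗ V) = X ⊗ V`. -/
def freeBalancing (X : RepU A) (V : C) : X.obj ⊗ A ⊗ V ⟶ X.obj ⊗ A ⊗ V :=
  (α_ X.obj A V).inv ≫ X.actR ▷ V ≫ dag X.actR ▷ V ≫ (α_ X.obj A V).hom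

theorem freeBalancing_eq (X : RepU A) : freeBalancing X V =
    X.obj ◁ dag (freeAct A V) ≫ (α_ X.obj A (A ⊗ V)).inv ≫ X.actR ▷ (A ⊗ V) := by
  rw [freeBalancing, ← comp_whiskerRight_assoc, actR_dag_actR, dag_freeAct]
  monoidal

theorem freeBalancing_eq' (X : RepU A) : freeBalancing X V =
    dag X.actR ▷ (A ⊗ V) ≫ (α_ X.obj A (A ⊗ V)).hom ≫ X.obj ◁ freeAct A V := by
  have h := congrArg dag (freeBalancing_eq (V := V) X)
  simpa [freeBalancing, dag_comp, dag_whiskerLeft, dag_whiskerRight, dag_associator,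
    dag_associator_inv, dag_dag] using h

theorem freeBalancing_balanced (X : RepU A) : X.actR ▷ (A ⊗ V) ≫ freeBalancing X V =
    (α_ X.obj A (A ⊗ V)).hom ≫ X.obj ◁ freeAct A V ≫ freeBalancing X V := by
  have h1 : X.actR ▷ A ≫ X.actR = (α_ X.obj A A).hom ≫ X.obj ◁ μ[A] ≫ X.actR := X.bim.assocR
  calc X.actR ▷ (A ⊗ V) ≫ freeBalancing X V
      = 𝟙 _ ⊗≫ (X.actR ▷ A ≫ X.actR) ▷ V ⊗≫ dag X.actR ▷ V ⊗≫ 𝟙 _ := by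
        rw [freeBalancing]; monoidal
    _ = _ := by rw [h1, freeBalancing, freeAct]; monoidal

theorem freeBalancing_sq (X : RepU A) :
    freeBalancing X V ≫ freeBalancing X V = dA A • freeBalancing X V := by
  have h := dag_actR_comp_actR X
  have h' : dag X.actR ▷ V ≫ X.actR ▷ V = dA A • 𝟙 _ := by
    rw [← comp_whiskerRight, h]; simp
  unfold freeBalancing
  simp only [Category.assoc, Iso.hom_inv_id_assoc]
  rw [reassoc_of% h']
  simp

theorem freeBalancing_monodromy (X : RepU A) :
    freeBalancing X V ≫ monodromy X.obj (A ⊗ V) ≫ freeBalancing X V =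
      X.obj ◁ localizing A V ≫ monodromy X.obj (A ⊗ V) ≫ freeBalancing X V := by
  have h1 := monodromy_naturality_left X.actR (A ⊗ V)
  have h2 := fullTwist X.obj A (A ⊗ V)
  have h3 : monodromy X.obj A ≫ X.actR = X.actR := by
    rw [monodromy, Category.assoc, show (β_ A X.obj).hom ≫ X.actR = X.act from X.singleValued]
    rfl
  have h4 : monodromy X.obj A ▷ (A ⊗ V) ≫ X.actR ▷ (A ⊗ V) = X.actR ▷ (A ⊗ V) := by
    rw [← comp_whiskerRight, h3]
  have h5 := freeBalancing_balanced (V := V) X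
  have h6 := monodromy_naturality_right X.obj (freeAct A V)
  conv_lhs => enter [1]; rw [freeBalancing_eq]
  simp only [Category.assoc]
  rw [reassoc_of% h1, ← h4]
  simp only [Category.assoc]
  rw [h5, reassoc_of% h2, ← reassoc_of% h6, localizing]
  simp

variable [T : UnitaryTensorSystem A] [IsBraidedCStarTensorCategory (RepU A)]

theorem m_monodromy (X Y : RepU A) :
    m X Y ≫ (monodromy X Y).hom = monodromy X.obj Y.obj ≫ m X Y := by
  have h1 := m_braiding X Y
  have h2 := m_braiding Y X
  simp only [monodromy, comp_hom, Category.assoc]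
  rw [reassoc_of% h1, h2]

theorem traceRatio_mul_hopf (hC : IsRigid C) (hR : IsRigid (RepU A)) (X Y : RepU A) :
    traceRatio A * hopf hR X Y =
      (dA A)⁻¹ * tr hC _ (monodromy X.obj Y.obj ≫ balancing X Y) := by
  have h1 : balancing X Y = m X Y ≫ dag (m X Y) := (m_dag X Y).symm
  rw [hopf, ← tr_hom hC, eq_of_m_comp (m_monodromy X Y), map_smul, smul_eq_mul, tr_comm,
    Category.assoc, ← h1]

/-- Under the trace the localizing projection is absorbed by the balancing projection of `X` with
the free module. An `A`-loop around the monodromy of `X` and `V` remains; it becomes a conditional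
expectation, which preserves the trace. -/
theorem hopf_localInduction (hC : IsRigid C) (hR : IsRigid (RepU A)) (X : RepU A) {N : RepU A}
    {q : A ⊗ V ⟶ N.obj} (h1 : dag q ≫ q = 𝟙 N.obj)
    (h2 : q ≫ dag q = (dA A)⁻¹ • localizing A V) (h3 : A ◁ q ≫ N.act = freeAct A V ≫ q) :
    traceRatio A * hopf hR X N = hopf hC X.obj V := by
  have hd := dA_ne (A := A)
  have e1 : X.obj ◁ q ≫ balancing X N = freeBalancing X V ≫ X.obj ◁ q := by
    rw [freeBalancing_eq', balancing, whisker_exchange_assoc, associator_naturality_right_assoc,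
      ← MonoidalCategory.whiskerLeft_comp, h3]
    simp
  have e2 : tr hC _ (monodromy X.obj N.obj ≫ balancing X N) =
      tr hC _ (monodromy X.obj (A ⊗ V) ≫ freeBalancing X V) := by
    calc tr hC _ (monodromy X.obj N.obj ≫ balancing X N)
        = tr hC _ ((monodromy X.obj N.obj ≫ balancing X N ≫ X.obj ◁ dag q) ≫ X.obj ◁ q) := by
          simp only [Category.assoc]
          rw [← MonoidalCategory.whiskerLeft_comp, h1]
          simp
      _ = tr hC _ (monodromy X.obj (A ⊗ V) ≫ freeBalancing X V ≫ X.obj ◁ (q ≫ dag q)) := by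
          rw [tr_comm, monodromy_naturality_right_assoc, reassoc_of% e1,
            MonoidalCategory.whiskerLeft_comp]
      _ = (dA A)⁻¹ * tr hC _ (X.obj ◁ localizing A V ≫ monodromy X.obj (A ⊗ V) ≫
            freeBalancing X V) := by
          rw [h2, MonoidalLinear.whiskerLeft_smul, Linear.comp_smul, Linear.comp_smul, map_smul,
            smul_eq_mul, ← Category.assoc, tr_comm]
      _ = (dA A)⁻¹ * tr hC _ ((monodromy X.obj (A ⊗ V) ≫ freeBalancing X V) ≫
            freeBalancing X V) := by
          rw [← freeBalancing_monodromy, tr_comm]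
      _ = _ := by
          rw [Category.assoc, freeBalancing_sq, Linear.comp_smul, map_smul, smul_eq_mul,
            inv_mul_cancel_left₀ hd]
  have e3 : tr hC _ (monodromy X.obj (A ⊗ V) ≫ freeBalancing X V) =
      tr hC _ (dag X.act ▷ V ≫ (α_ A X.obj V).hom ≫ A ◁ monodromy X.obj V ≫
        (α_ A X.obj V).inv ≫ X.act ▷ V) := by
    have h4 : (β_ A X.obj).hom ▷ V ≫ X.actR ▷ V = X.act ▷ V := by
      rw [← comp_whiskerRight]; exact congrArg (· ▷ V) X.singleValued
    have h5 : dag X.actR ▷ V ≫ (β_ X.obj A).hom ▷ V = dag X.act ▷ V := by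
      rw [← comp_whiskerRight, actR, dag_comp, dag_braiding]
      simp
    calc tr hC _ (monodromy X.obj (A ⊗ V) ≫ freeBalancing X V)
        = tr hC _ ((monodromy X.obj (A ⊗ V) ≫ (α_ X.obj A V).inv ≫ X.actR ▷ V) ≫
            dag X.actR ▷ V ≫ (α_ X.obj A V).hom) := by
          simp only [freeBalancing, Category.assoc]
      _ = tr hC _ (dag X.actR ▷ V ≫ (β_ X.obj A).hom ▷ V ≫ (α_ A X.obj V).hom ≫
            A ◁ monodromy X.obj V ≫ (α_ A X.obj V).inv ≫ (β_ A X.obj).hom ▷ V ≫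
              X.actR ▷ V) := by
          rw [tr_comm, monodromy_tensor_right]
          simp only [Category.assoc, Iso.hom_inv_id_assoc]
      _ = _ := by rw [h4, reassoc_of% h5]
  obtain ⟨Z, p, hp⟩ := exists_standard hC V
  -- Closing the `V`-strand leaves an endomorphism of `X` averaged by the remaining `A`-loop.
  have e4 : partialTrace p (dag X.act ▷ V ≫ (α_ A X.obj V).hom ≫ A ◁ monodromy X.obj V ≫
        (α_ A X.obj V).inv ≫ X.act ▷ V) =
      dA A • (condExp X (partialTrace p (monodromy X.obj V))).hom := by
    change _ = dA A • (dA A)⁻¹ • _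
    rw [smul_inv_smul₀ hd]
    have h4 := whisker_exchange (dag X.act) p.coevaluation'
    have h5 := whisker_exchange X.act (dag p.coevaluation')
    unfold partialTrace
    calc _ = 𝟙 _ ⊗≫ (X.obj ◁ p.coevaluation' ≫ dag X.act ▷ (V ⊗ Z)) ⊗≫
          A ◁ monodromy X.obj V ▷ Z ⊗≫ (X.act ▷ (V ⊗ Z) ≫ X.obj ◁ dag p.coevaluation') ⊗≫
            𝟙 _ := by monoidal
      _ = _ := by rw [h4, ← h5]; monoidal
  rw [traceRatio_mul_hopf hC, e2, e3, ← tr_partialTrace hC hp, e4, map_smul, smul_eq_mul,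
    inv_mul_cancel_left₀ hd, tr_hom hC hR, ← tr_condExp hC hR, tr_partialTrace hC hp, hopf]

end RepU

end LocalInduction

/-! ### Invertibility of S-matrices -/

section SMatrix

theorem hasFiniteBiproducts {C : Type u} [Category.{v} C] [Preadditive C] [Linear ℂ C]
    [StarCategory C] [MonoidalCategory C] [IsCStarTensorCategory C] :
    Limits.HasFiniteBiproducts C := by
  classical
  refine ⟨fun n => ⟨fun F => ?_⟩⟩
  obtain ⟨X, w, hw⟩ := exists_orthogonalSum F
  refine Limits.hasBiproduct_of_total ⟨X, w, fun s => dag (w s), fun s t => ?_⟩ hw.sum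
  by_cases h : s = t
  · subst h
    simpa using hw.isometry s
  · simpa [h] using hw.orthogonal s t h

variable {C : Type u} [Category.{v} C] [Preadditive C] [Linear ℂ C] [StarCategory C]
  [MonoidalCategory C] [BraidedCategory C] [IsBraidedCStarTensorCategory C]

open IsCStarTensorCategory IsBraidedCStarTensorCategory

/-- The matrix of traces of monodromies is invertible if a combination of such traces detects
the unit object. -/
theorem isUnit_hopf (hC : IsRigid C) {n : ℕ} {S : Fin n → C}
    (hS : ∀ i, Module.finrank ℂ (S i ⟶ S i) = 1) (horth : ∀ i j, i ≠ j → ∀ f : S i ⟶ S j, f = 0)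
    (hdec : ∀ X : C, ∃ (k : ℕ) (c : Fin k → Fin n) (a : ∀ t, S (c t) ⟶ X)
      (b : ∀ t, X ⟶ S (c t)), (∀ t, a t ≫ b t = 𝟙 _) ∧ (∀ t t', t ≠ t' → a t ≫ b t' = 0) ∧
        ∑ t, b t ≫ a t = 𝟙 X)
    {J : Type*} [Fintype J] (N : J → C) (c : J → ℂ)
    (hN : ∀ Z : C, ∑ i, c i * hopf hC (N i) Z ≠ 0 ↔ ∃ f : 𝟙_ C ⟶ Z, f ≠ 0) :
    IsUnit (Matrix.of fun i j => hopf hC (S i) (S j)) := by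
  rw [← Matrix.mulVec_injective_iff_isUnit]
  refine (injective_iff_map_eq_zero (Matrix.mulVecLin _)).2 fun x hx => funext fun k => ?_
  -- With `D` dual to `S k`, the unit maps nontrivially to `S j ⊗ D` only for `j = k`, so the
  -- detector isolates `x k`.
  obtain ⟨D, ⟨q⟩⟩ := hC (S k)
  have h1 : ∀ i, ∑ j, hopf hC (S i) (S j) * x j = 0 := fun i => congrFun hx i
  have h2 : ∀ i, ∑ j, hopf hC (S i) (S j ⊗ D) * x j = 0 := by
    intro i
    have h0 := tr_id_ne_zero hC (id_ne_zero_of_finrank (hS i))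
    apply mul_left_cancel₀ h0
    rw [mul_zero, Finset.mul_sum]
    calc _ = ∑ j, hopf hC (S i) D * (hopf hC (S i) (S j) * x j) :=
          Finset.sum_congr rfl fun j _ => by
            have := hopf_tensor hC (hS i) (S j) D
            linear_combination x j * this
      _ = 0 := by rw [← Finset.mul_sum, h1, mul_zero]
  have h3 : ∀ X : C, ∑ j, hopf hC X (S j ⊗ D) * x j = 0 := by
    intro X
    obtain ⟨_, d, a, b, hab, -, hs⟩ := hdec X
    have h4 : ∀ j, hopf hC X (S j ⊗ D) * x j = ∑ t, hopf hC (S (d t)) (S j ⊗ D) * x j := by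
      intro j
      rw [hopf_sum_left hC (S j ⊗ D) a b hab hs, Finset.sum_mul]
    simp only [h4]
    rw [Finset.sum_comm]
    exact Finset.sum_eq_zero fun t _ => h2 (d t)
  have h5 : ∑ j, (∑ i, c i * hopf hC (N i) (S j ⊗ D)) * x j = 0 := by
    simp only [Finset.sum_mul]
    rw [Finset.sum_comm]
    refine Finset.sum_eq_zero fun i _ => ?_
    simp only [mul_assoc]
    rw [← Finset.mul_sum, h3, mul_zero]
  rw [Finset.sum_eq_single k] at h5
  · refine (mul_eq_zero.1 h5).resolve_left ((hN _).2 ⟨q.coevaluation', fun h => ?_⟩)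
    apply id_ne_zero_of_finrank (hS k)
    have h6 := q.evaluation_coevaluation'
    rw [h, MonoidalPreadditive.zero_whiskerRight, Limits.zero_comp] at h6
    have h7 := (λ_ (S k)).inv ≫= h6 =≫ (ρ_ (S k)).hom
    simpa using h7.symm
  · intro j _ hjk
    rw [mul_eq_zero]
    left
    by_contra hne
    obtain ⟨f, hf⟩ := (hN _).1 hne
    apply hf
    let _ := q
    apply (tensorRightHomEquiv (𝟙_ C) (S k) D (S j)).symm.injective
    have hz : ∀ g : 𝟙_ C ⊗ S k ⟶ S j, g = 0 := by
      intro g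
      have := horth k j (Ne.symm hjk) ((λ_ _).inv ≫ g)
      rw [← Category.id_comp g, ← Iso.hom_inv_id (λ_ (S k)), Category.assoc, this,
        Limits.comp_zero]
    rw [hz ((tensorRightHomEquiv (𝟙_ C) (S k) D (S j)).symm f), hz ((tensorRightHomEquiv _ _ _ _).symm 0)]
  · simp

/-- In a unitary modular tensor category a combination of traces of monodromies detects the unit
object. -/
theorem IsUnitaryModular.exists_hopf_detects {θ : ∀ X : C, X ⟶ X} (h : IsUnitaryModular C θ)
    (hC : IsRigid C) : ∃ (n : ℕ) (W : Fin n → C) (c : Fin n → ℂ),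
      (∀ X : C, 𝟙 X ≠ 0 → ∃ i, ∃ f : W i ⟶ X, f ≠ 0) ∧
      ∀ Z : C, ∑ i, c i * hopf hC (W i) Z ≠ 0 ↔ ∃ f : 𝟙_ C ⟶ Z, f ≠ 0 := by
  classical
  obtain ⟨n, W, hW, horth, hdec, D, p, s, hs, hu⟩ := h.modular.exists_simples
  have hs' : ∀ i j, s i j = hopf hC (W i) (W j) := by
    intro i j
    have h1 := hs i j
    rw [ribbonTrace_eq hC (h.canonical _)] at h1
    exact (smul_left_injective ℂ id_unit_ne_zero h1).symm
  -- Solving for the coefficients with `s⁻¹` makes the combination on `Z` count the summands of `Z`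
  -- that receive a nonzero morphism from the unit.
  let δ : Fin n → ℂ := fun l => if ∃ f : 𝟙_ C ⟶ W l, f ≠ 0 then 1 else 0
  have hc : ∀ l, ∑ i, Matrix.vecMul δ s⁻¹ i * hopf hC (W i) (W l) = δ l := by
    intro l
    have h1 : Matrix.vecMul (Matrix.vecMul δ s⁻¹) s = δ := by
      rw [Matrix.vecMul_vecMul, Matrix.nonsing_inv_mul _ ((Matrix.isUnit_iff_isUnit_det _).1 hu),
        Matrix.vecMul_one]
    conv_rhs => rw [← h1]
    simp only [← hs']
    rfl
  refine ⟨n, W, Matrix.vecMul δ s⁻¹, fun X hX => ?_, fun Z => ?_⟩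
  · obtain ⟨k, c, a, b, -, -, hsum⟩ := hdec X
    by_contra hcon
    push Not at hcon
    apply hX
    rw [← hsum]
    exact Finset.sum_eq_zero fun t _ => by rw [hcon _ (a t), Limits.comp_zero]
  · obtain ⟨k, c, a, b, hab, -, hsum⟩ := hdec Z
    have h1 : ∑ i, Matrix.vecMul δ s⁻¹ i * hopf hC (W i) Z = ∑ t, δ (c t) := by
      simp only [hopf_sum_right hC _ a b hab hsum, Finset.mul_sum]
      rw [Finset.sum_comm]
      exact Finset.sum_congr rfl fun t _ => hc (c t)
    have h2 : ∑ t, δ (c t) =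
        ((Finset.univ.filter fun t => ∃ f : 𝟙_ C ⟶ W (c t), f ≠ 0).card : ℂ) := by
      simp [δ, Finset.sum_boole]
    rw [h1, h2, Nat.cast_ne_zero, Finset.card_ne_zero, Finset.filter_nonempty_iff]
    constructor
    · rintro ⟨t, -, f, hf⟩
      refine ⟨f ≫ a t, fun h0 => hf ?_⟩
      rw [← Category.comp_id f, ← hab, ← Category.assoc, h0, Limits.zero_comp]
    · rintro ⟨f, hf⟩
      by_contra hcon
      push Not at hcon
      apply hf
      rw [← Category.comp_id f, ← hsum, Preadditive.comp_sum]
      exact Finset.sum_eq_zero fun t ht => by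
        rw [← Category.assoc, hcon t ht (f ≫ b t), Limits.zero_comp]

end SMatrix

/-! ### Modularity of the category of modules -/

section Modular

variable {C : Type u} [Category.{v} C] [Preadditive C] [Linear ℂ C] [StarCategory C]
  [MonoidalCategory C] [BraidedCategory C] [IsBraidedCStarTensorCategory C] {A : C} [MonObj A]
  [IsQSystem A] [IsCommMonObj A] [T : UnitaryTensorSystem A]

open IsCStarTensorCategory IsBraidedCStarTensorCategory

namespace RepU

variable [IsBraidedCStarTensorCategory (RepU A)]

/-- The tensor rule follows from naturality of `θ` along the epimorphism `m`, and the duality rule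
from the restricted pairing after cancelling `d`. -/
theorem isRibbonTwist {θ : ∀ X : C, X ⟶ X} (h : IsRibbonTwist C θ) {θA : ∀ X : RepU A, X ⟶ X}
    (hθ : ∀ X, (θA X).hom = θ X.obj) (hu : ∀ X, IsUnitary (θA X)) :
    IsRibbonTwist (RepU A) θA where
  isIso X := ⟨dag (θA X), hu X⟩
  naturality {X Y} f := by
    apply hom_ext
    simp only [comp_hom, hθ]
    exact h.naturality f.hom
  tensor X Y := by
    apply prod_ext
    have h1 := m_braiding X Y
    have h2 := m_braiding Y X
    simp only [comp_hom, hθ]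
    rw [reassoc_of% h1, reassoc_of% h2, MonoidalCategory.tensorHom_def, comp_hom,
      ← Category.assoc (m X Y), m_whiskerRight, Category.assoc, m_whiskerLeft, hθ, hθ]
    have h3 := h.naturality (m X Y)
    refine h3.trans ?_
    rw [h.tensor, MonoidalCategory.tensorHom_def]
    simp only [Category.assoc]
  dual {X Y} q := by
    apply unit_point_injective
    have h1 := h.dual (restrictPairing q)
    rw [restrictPairing_coev] at h1
    have h2 := h1 =≫ m X Y
    have h3 := m_whiskerRight (θA X) Y
    have h4 := m_whiskerLeft X (θA Y)
    rw [hθ] at h3 h4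
    have h5 : dag (m X Y) ≫ m X Y = dA A • 𝟙 _ := dag_m_m X Y
    simp only [Category.assoc] at h2
    rw [← h3, ← h4, reassoc_of% h5, reassoc_of% h5] at h2
    simp only [Linear.smul_comp, Linear.comp_smul, Category.id_comp] at h2
    exact smul_right_injective _ dA_ne h2

theorem isUnitaryModular {θ : ∀ X : C, X ⟶ X} (h : IsUnitaryModular C θ)
    (hC : IsRigid C) (hR : IsRigid (RepU A)) :
    ∃ θA : ∀ X : RepU A, X ⟶ X, (∀ X, (θA X).hom = θ X.obj) ∧ IsUnitaryModular (RepU A) θA := by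
  choose θA h1 h2 h3 using exists_canonicalTwist (A := A) hC hR
  have h4 : ∀ X, (θA X).hom = θ X.obj := fun X => (h3 X).unique (h.canonical X.obj)
  obtain ⟨m, W, c, hW, hc⟩ := h.exists_hopf_detects hC
  choose N q hq1 hq2 hq3 using fun i => exists_localInduction (A := A) (W i)
  -- The modules induced from the simple objects of `C` inherit the detector, because points of
  -- `Z.obj` are the module morphisms from `A`.
  have hN : ∀ Z : RepU A, ∑ i, (c i * traceRatio A) * hopf hR (N i) Z ≠ 0 ↔
      ∃ f : 𝟙_ (RepU A) ⟶ Z, f ≠ 0 := by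
    intro Z
    have h5 : ∀ i, (c i * traceRatio A) * hopf hR (N i) Z = c i * hopf hC (W i) Z.obj := by
      intro i
      rw [mul_assoc, hopf_comm, hopf_localInduction hC hR Z (hq1 i) (hq2 i) (hq3 i), hopf_comm]
    simp only [h5]
    rw [hc]
    constructor
    · rintro ⟨x, hx⟩
      refine ⟨ofPoint x, fun h0 => hx ?_⟩
      rw [← point_ofPoint x, show (ofPoint x).hom = 0 from congrArg Hom.hom h0, Limits.comp_zero]
    · rintro ⟨f, hf⟩
      refine ⟨η[A] ≫ f.hom, fun h0 => hf (unit_point_injective ?_)⟩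
      rw [h0, zero_hom, Limits.comp_zero]
  obtain ⟨M, w, hw⟩ := exists_orthogonalSum N
  obtain ⟨n, S, hS, horth, hdec⟩ := exists_simple_family hR M fun X hX => by
    obtain ⟨i, f, hf⟩ := hW X.obj fun h0 => hX (hom_ext h0)
    obtain ⟨g, hg⟩ := exists_hom_of_localInduction (hq2 i) (hq3 i) hf
    refine ⟨w i ≫ g, fun h0 => hg ?_⟩
    rw [← Category.id_comp g, ← hw.isometry i, Category.assoc, h0, Limits.comp_zero]
  refine ⟨θA, h4, inferInstance, ?_, h2⟩
  exact
    { rigid := hR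
      ribbon := isRibbonTwist h.modular.ribbon h4 h1
      simple_unit := simple_unit
      hasFiniteBiproducts := hasFiniteBiproducts
      exists_simples := by
        choose D p using fun i j => hR (S i ⊗ S j)
        refine ⟨n, S, hS, horth, hdec, D, fun i j => (p i j).some, _, fun i j => ?_,
          isUnit_hopf hR hS horth hdec N _ hN⟩
        rw [ribbonTrace_eq hR (h2 _)]
        rfl }

end RepU

end Modular

end CStarRep

theorem mainTheorem11 {C : Type u} [Category.{v} C] [Preadditive C] [Linear ℂ C]
    [StarCategory C] [MonoidalCategory C] [BraidedCategory C] [IsBraidedCStarTensorCategory C]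
    (hC : IsRigid C) (A : C) [MonObj A] [IsCommMonObj A] [IsQSystem A] (hA : IsHaploid A) :
    Nonempty (UnitaryTensorSystem A) ∧
    IsCanonicalTwistAt A (𝟙 A) ∧
    ∀ _T : UnitaryTensorSystem A,
      IsBraidedCStarTensorCategory (RepU A) ∧ IsRigid (RepU A) ∧
      (∀ X : RepU A, ∃ θ : X ⟶ X,
        IsUnitary θ ∧ IsCanonicalTwistAt X θ ∧ IsCanonicalTwistAt X.obj θ.hom) ∧
      (∀ θ : ∀ X : C, X ⟶ X, IsUnitaryModular C θ →
        ∃ θA : ∀ X : RepU A, X ⟶ X,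
          (∀ X, (θA X).hom = θ X.obj) ∧ IsUnitaryModular (RepU A) θA) := by
  have hT : Nonempty (UnitaryTensorSystem A) := RepU.nonempty_unitaryTensorSystem A
  refine ⟨hT, ?_, fun _T => ?_⟩
  -- The twist of `A` does not depend on tensor products of modules, so any choice of them serves.
  · obtain ⟨_T⟩ := hT
    have := RepU.isBraidedCStarTensorCategory (A := A) hC hA
    exact RepU.isCanonicalTwistAt_algebra hC (RepU.isRigid hC)
  · have := RepU.isBraidedCStarTensorCategory (A := A) hC hA
    have hR : IsRigid (RepU A) := RepU.isRigid hC
    exact ⟨this, hR, RepU.exists_canonicalTwist hC hR,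
      fun θ h => RepU.isUnitaryModular h hC hR⟩
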